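/- Let $n\ge 1$ and, for $j=1,\dots,n$, let $0<r_j<\infty$, $1\le p_j<\infty$, $1\le\theta_j\le\infty$. Let $S_0(\mathbb R^n)$ be the class of measurable, a.e. finite functions $f$ with $|\{|f|>y\}|<\infty$ for all $y>0$, and put $f^*(t)=\sup_{|E|=t}\inf_{x\in E}|f(x)|$ and $\|f\|_{q,1}=\int_0^\infty t^{1/q}f^*(t)\,\frac{dt}{t}$. Let $\Delta_j^k(h)f(x)=\sum_{i=0}^k(-1)^{k-i}\binom ki f(x+ihe_j)$. For $s>0$, $1\le u<\infty$, $1\le\eta\le\infty$ and an integer $k>s$ put $$\|f\|_{b^{s}_{u,\eta;j}}=\Big(\int_0^\infty\big[h^{-s}\|\Delta_j^{k}(h)f\|_{L^u}\big]^{\eta}\frac{dh}{h}\Big)^{1/\eta}$$ (the essential supremum over $h>0$ if $\eta=\infty$), where any integer $k>s$ may be used, and let $b^{s_1,\dots,s_n}_{u_1,\dots,u_n;\eta_1,\dots,\eta_n}(\mathbb R^n)$ be the space of all $f\in S_0(\mathbb R^n)$ with $\sum_{j}\|f\|_{b^{s_j}_{u_j,\eta_j;j}}<\infty$. Define $$r=n\Big(\sum_{j}\frac1{r_j}\Big)^{-1},\quad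 p=\frac nr\Big(\sum_j\frac1{p_jr_j}\Big)^{-1},\quad \theta=\frac nr\Big(\sum_j\frac1{\theta_jr_j}\Big)^{-1},\quad \beta_j=\frac1{r_j}\Big(\frac rn+\frac1{p_j}-\frac1p\Big),$$ and suppose that $\beta_j>0$ for all $j$. Let $p_j<q_j<\infty$ satisfy $\frac1{q_j}>\frac1p-\frac rn$ for all $j$, and put $$\varkappa_j=1-\frac1{\beta_jr_j}\Big(\frac1{p_j}-\frac1{q_j}\Big),\qquad \alpha_j=\varkappa_jr_j,\qquad \frac1{\theta_j'}=\frac{1-\varkappa_j}{\theta}+\frac{\varkappa_j}{\theta_j}.$$ Then for all integers $k_j>r_j$ there is a constant $c$, independent of $f$, such that for every $f\in b^{r_1,\dots,r_n}_{p_1,\dots,p_n;\theta_1,\dots,\theta_n}(\mathbb R^n)$ and every $j$ $$\Big(\int_0^\infty\big[h^{-\alpha_j}\|\Delta_j^{k_j}(h)f\|_{q_j,1}\big]^{\theta_j'}\frac{dh}{h}\Big)^{1/\theta_j'}\le c\sum_{i=1}^n\|f\|_{b^{r_i}_{p_i,\theta_i;i}}$$ (with the essential supremum on the left if $\theta'_j=\infty$).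 Moreover $b^{r_1,\dots,r_n}_{p_1,\dots,p_n;\theta_1,\dots,\theta_n}(\mathbb R^n)\hookrightarrow b^{\alpha_1,\dots,\alpha_n}_{q_1,\dots,q_n;\theta_1',\dots,\theta_n'}(\mathbb R^n)$, that is, the first space is contained in the second and the seminorm of the second is bounded by a constant times the seminorm of the first. -/

import Mathlib

open MeasureTheory Set
open scoped ENNReal NNReal

namespace AnisoBesov

noncomputable section

/-- The measure `du/u` on `(0, ∞)`. -/
def mulMeasure : Measure ℝ :=
  (volume.restrict (Ioi 0)).withDensity (fun u => ENNReal.ofReal u⁻¹)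

/-- The norm of `𝓛^θ = L^θ((0, ∞), du/u)`, `1 ≤ θ ≤ ∞`, of a nonnegative function
(for `θ = ∞` it is the essential supremum over `(0, ∞)`). -/
def calNorm (θ : ℝ≥0∞) (g : ℝ → ℝ≥0∞) : ℝ≥0∞ := eLpNorm g θ mulMeasure

variable {𝕜 : Type*} [RCLike 𝕜] {n : ℕ}

/-- The class `S₀(ℝⁿ)`: Lebesgue measurable functions all of whose sets `{|f| > y}`, `y > 0`,
have finite measure. The functions take finite values, so they are trivially finite a.e.
Only the Lebesgue measure of `ℝⁿ` matters here, not a norm on it. -/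
def MemS0 (f : (Fin n → ℝ) → 𝕜) : Prop :=
  AEStronglyMeasurable f volume ∧ ∀ y : ℝ, 0 < y → volume {x | y < ‖f x‖} < ∞

/-- The non-increasing rearrangement `f*(t) = sup_{|E| = t} inf_{x ∈ E} |f(x)|`. -/
def rearrangement (f : (Fin n → ℝ) → 𝕜) (t : ℝ) : ℝ≥0∞ :=
  ⨆ (E : Set (Fin n → ℝ)) (_ : MeasurableSet E ∧ volume E = ENNReal.ofReal t),
    ⨅ x ∈ E, ‖f x‖ₑ

/-- The Lorentz norm `‖f‖_{q,s} = (∫₀^∞ (t^{1/q} f*(t))^s dt/t)^{1/s}`. -/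
def lorentzNorm (q : ℝ) (s : ℝ≥0∞) (f : (Fin n → ℝ) → 𝕜) : ℝ≥0∞ :=
  calNorm s (fun t => ENNReal.ofReal (t ^ (1 / q)) * rearrangement f t)

/-- The difference `Δ_j^k(h) f` of degree `k` with step `h` in the direction of `x_j`. -/
def diff (j : Fin n) (k : ℕ) (h : ℝ) (f : (Fin n → ℝ) → 𝕜) : (Fin n → ℝ) → 𝕜 :=
  (fwdDiff (Pi.single j h))^[k] f

/-- `Δ_j^k(h) f(x) = ∑_{i=0}^k (-1)^{k-i} (k choose i) f(x + i h e_j)`. -/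
theorem diff_apply (j : Fin n) (k : ℕ) (h : ℝ) (f : (Fin n → ℝ) → 𝕜) (x : Fin n → ℝ) :
    diff j k h f x = ∑ i ∈ Finset.range (k + 1),
      (-1 : 𝕜) ^ (k - i) * (k.choose i : 𝕜) * f (x + (i * h) • Pi.single j (1 : ℝ)) := by
  unfold diff
  rw [fwdDiff_iter_eq_sum_shift]
  refine Finset.sum_congr rfl fun i _ => ?_
  have e : (i : ℕ) • (Pi.single j h : Fin n → ℝ) = (i * h) • Pi.single j (1 : ℝ) := by
    rw [← Pi.single_smul, ← Pi.single_smul]; simp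
  rw [e, zsmul_eq_mul]
  push_cast
  rfl

/-- The directional Besov seminorm
`‖f‖_{b^r_{p,θ;j}} = ‖ h^{-r} ‖Δ_j^k(h) f‖_p ‖_{𝓛^θ}` formed with differences of degree `k`
(to be used with `k > r`). -/
def besovDir (j : Fin n) (k : ℕ) (r p : ℝ) (θ : ℝ≥0∞) (f : (Fin n → ℝ) → 𝕜) : ℝ≥0∞ :=
  calNorm θ (fun h => ENNReal.ofReal (h ^ (-r)) *
    eLpNorm (diff j k h f) (ENNReal.ofReal p) volume)

/-- The same expression with the Lorentz norm `‖·‖_{q,s}` in place of the `L^p` norm. -/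
def besovLorentzDir (j : Fin n) (k : ℕ) (r q : ℝ) (s θ : ℝ≥0∞) (f : (Fin n → ℝ) → 𝕜) : ℝ≥0∞ :=
  calNorm θ (fun h => ENNReal.ofReal (h ^ (-r)) * lorentzNorm q s (diff j k h f))

/-- The seminorm `∑_j ‖f‖_{b^{r_j}_{p_j,θ_j;j}}`, with differences of degree `k_j` in `x_j`. -/
def besovSeminorm (k : Fin n → ℕ) (r p : Fin n → ℝ) (θ : Fin n → ℝ≥0∞)
    (f : (Fin n → ℝ) → 𝕜) : ℝ≥0∞ :=
  ∑ j, besovDir j (k j) (r j) (p j) (θ j) f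

/-- The space `b^{r_1,…,r_n}_{p_1,…,p_n;θ_1,…,θ_n}(ℝⁿ)`: the functions of `S₀(ℝⁿ)` with finite
seminorm. -/
def besovSpace (𝕜 : Type*) [RCLike 𝕜] (k : Fin n → ℕ) (r p : Fin n → ℝ) (θ : Fin n → ℝ≥0∞) :
    Set ((Fin n → ℝ) → 𝕜) :=
  {f | MemS0 f ∧ besovSeminorm k r p θ f < ∞}

/-- The harmonic mean `r = n (∑ 1/r_j)⁻¹`. -/
def meanR (r : Fin n → ℝ) : ℝ := n * (∑ j, 1 / r j)⁻¹

/-- The mean exponent `p = (n/r) (∑ 1/(p_j r_j))⁻¹`. -/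
def meanP (r p : Fin n → ℝ) : ℝ := n / meanR r * (∑ j, 1 / (p j * r j))⁻¹

/-- The mean exponent `θ = (n/r) (∑ 1/(θ_j r_j))⁻¹` in `[1, ∞]`, with `1/∞ = 0`, `1/0 = ∞`. -/
def meanTheta (r : Fin n → ℝ) (θ : Fin n → ℝ≥0∞) : ℝ≥0∞ :=
  ENNReal.ofReal (n / meanR r) * (∑ j, 1 / (θ j * ENNReal.ofReal (r j)))⁻¹

/-- `β_j = (1/r_j) (r/n + 1/p_j - 1/p)`. -/
def beta (r p : Fin n → ℝ) (j : Fin n) : ℝ :=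
  1 / r j * (meanR r / n + 1 / p j - 1 / meanP r p)

/-- `ϰ_j = 1 - (1/(β_j r_j)) (1/p_j - 1/q_j)`. -/
def kappa (r p q : Fin n → ℝ) (j : Fin n) : ℝ :=
  1 - 1 / (beta r p j * r j) * (1 / p j - 1 / q j)

/-- `α_j = ϰ_j r_j`. -/
def alpha (r p q : Fin n → ℝ) (j : Fin n) : ℝ := kappa r p q j * r j

/-- The exponent `θ'_j ∈ [1, ∞]` with `1/θ'_j = (1 - ϰ_j)/θ + ϰ_j/θ_j`. -/
def theta' (r p q : Fin n → ℝ) (θ : Fin n → ℝ≥0∞) (j : Fin n) : ℝ≥0∞ :=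
  (ENNReal.ofReal (1 - kappa r p q j) / meanTheta r θ
    + ENNReal.ofReal (kappa r p q j) / θ j)⁻¹

end

end AnisoBesov

/-! In the logarithmic variables t = e^τ, h = e^x the measures dt/t and dh/h become Lebesgue measure
and powers become linear functions. Up to a constant, the modulus ‖Δ_i^{m_i}(e^x) f‖_{p_i} is at
most e^{r_i x + a_i(x)}, where a_i has a small Lipschitz constant and the L^{θ_i} norm of e^{a_i} is
controlled by the seminorm of f (`exists_dirModulus_majorant`).

A function g can be recovered from its differences along boxes with sides comparable to e^{X_i}, Σ
X_i = τ, and from its values at shifted lattice points. Averaging over such boxes gives g*(e^τ) ≤ C₀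
g*(e^{τ+s}) + C max_i e^{-τ/p_i} sup ‖Δ_i^{m_i}(h) g‖_{p_i}, with h comparable to e^{X_i} and C₀
independent of s (`decrRearr_le_of_diff_bounds`). The best box makes the n terms equal: r_i X_i +
a_i(X_i) - τ/p_i = ℓ(τ) for every i (`exists_balance`). For a = 0 the solution is linear, X_i with
slope β_i and ℓ with slope ρ = r/n - 1/p; for slowly varying a_i the slopes stay within δ of these.

Take g = Δ_j^{k+m_j}(e^{X_j(τ)}) f. In its Lorentz norm, the range t ≤ e^τ is summed by the estimate
above: the first term is absorbed for large s, and the second grows geometrically because 1/q_j + ρ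
> 0. The range t > e^τ is handled by Chebyshev's inequality in L^{p_j}, since p_j < q_j. Both ranges
give e^{τ/q_j + ℓ(τ)} (`lorentzSum_diff_le_of_balance`). Marchaud's inequality lowers the degree to
any k > α_j.

Finally τ is expressed through x = X_j(τ). By `balanced_exponent` the bound equals e^{α_j x} ∏_i
e^{w_{ji} a_i(X_i)}, with weights satisfying Σ_i w_{ji} = 1 and Σ_i w_{ji}/θ_i = 1/θ'_j. Hölder's
inequality and bi-Lipschitz changes of variable conclude (`exists_lorentzSum_majorant`). -/

namespace AnisoBesov

/-! ### Rearrangements and a discrete Lorentz norm -/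

section

/-- The exponential function with values in `[0, ∞]`. -/
noncomputable def expE (x : ℝ) : ℝ≥0∞ := ENNReal.ofReal (Real.exp x)

theorem expE_add (x y : ℝ) : expE (x + y) = expE x * expE y := by
  rw [expE, Real.exp_add, ENNReal.ofReal_mul (Real.exp_pos x).le]; rfl

theorem expE_zero : expE 0 = 1 := by simp [expE]

theorem expE_ne_zero (x : ℝ) : expE x ≠ 0 := by simp [expE, Real.exp_pos]

theorem expE_ne_top (x : ℝ) : expE x ≠ ∞ := by simp [expE]

theorem expE_mono {x y : ℝ} (h : x ≤ y) : expE x ≤ expE y :=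
  ENNReal.ofReal_le_ofReal (Real.exp_le_exp.2 h)

theorem expE_rpow (x s : ℝ) : expE x ^ s = expE (x * s) := by
  rw [expE, ENNReal.ofReal_rpow_of_pos (Real.exp_pos x), ← Real.exp_mul]; rfl

theorem expE_neg (x : ℝ) : expE (-x) = (expE x)⁻¹ := by
  rw [expE, Real.exp_neg, ENNReal.ofReal_inv_of_pos (Real.exp_pos x)]; rfl

theorem measurable_expE : Measurable expE :=
  ENNReal.measurable_ofReal.comp Real.measurable_exp

theorem expE_natCast_mul (x : ℝ) (k : ℕ) : expE (k * x) = expE x ^ k := by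
  rw [← ENNReal.rpow_natCast, expE_rpow, mul_comm]

variable {𝕜 : Type*} [RCLike 𝕜] {n : ℕ}

/-- The right-continuous non-increasing rearrangement, `inf {y | |{|g| > y}| ≤ t}`. -/
noncomputable def decrRearr (g : (Fin n → ℝ) → 𝕜) (t : ℝ≥0∞) : ℝ≥0∞ :=
  sInf {y : ℝ≥0∞ | volume {x | y < ‖g x‖ₑ} ≤ t}

theorem decrRearr_le {g : (Fin n → ℝ) → 𝕜} {t y : ℝ≥0∞} (h : volume {x | y < ‖g x‖ₑ} ≤ t) :
    decrRearr g t ≤ y := sInf_le h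

/-- The infimum is attained: along a sequence decreasing to it the level sets increase, and measure
is continuous from below. -/
theorem measure_decrRearr_lt (g : (Fin n → ℝ) → 𝕜) (t : ℝ≥0∞) :
    volume {x | decrRearr g t < ‖g x‖ₑ} ≤ t := by
  have hne : {y : ℝ≥0∞ | volume {x | y < ‖g x‖ₑ} ≤ t}.Nonempty := ⟨∞, by simp⟩
  obtain ⟨u, hu, hlim, hmem⟩ := exists_seq_tendsto_sInf hne (OrderBot.bddBelow _)
  have hsub : {x | decrRearr g t < ‖g x‖ₑ} = ⋃ m, {x | u m < ‖g x‖ₑ} := by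
    ext x
    simp only [mem_ofPred_eq, mem_iUnion]
    constructor
    · intro hx
      exact (hlim.eventually (gt_mem_nhds hx)).exists
    · rintro ⟨m, hm⟩
      exact (sInf_le (hmem m)).trans_lt hm
  rw [hsub, Monotone.measure_iUnion]
  · exact iSup_le hmem
  · intro a b hab x hx
    exact (hu hab).trans_lt hx

theorem decrRearr_anti (g : (Fin n → ℝ) → 𝕜) : Antitone (decrRearr g) := fun _ _ h =>
  decrRearr_le ((measure_decrRearr_lt g _).trans h)

theorem decrRearr_le_of_ae_le {𝕜' : Type*} [RCLike 𝕜'] {g : (Fin n → ℝ) → 𝕜}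
    {g' : (Fin n → ℝ) → 𝕜'} (h : ∀ᵐ x, ‖g x‖ₑ ≤ ‖g' x‖ₑ) (t : ℝ≥0∞) :
    decrRearr g t ≤ decrRearr g' t := by
  refine decrRearr_le ((measure_mono_ae ?_).trans (measure_decrRearr_lt g' t))
  filter_upwards [h] with x hx hx' using lt_of_lt_of_le hx' hx

theorem decrRearr_congr_ae {g g' : (Fin n → ℝ) → 𝕜} (h : g =ᵐ[volume] g') :
    decrRearr g = decrRearr g' := by
  funext t
  refine le_antisymm (decrRearr_le_of_ae_le ?_ t) (decrRearr_le_of_ae_le ?_ t) <;>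
  filter_upwards [h] with x hx using by rw [hx]

theorem decrRearr_add_le (g g' : (Fin n → ℝ) → 𝕜) (s t : ℝ≥0∞) :
    decrRearr (g + g') (s + t) ≤ decrRearr g s + decrRearr g' t := by
  refine decrRearr_le (le_trans (measure_mono ?_) ((measure_union_le _ _).trans
    (add_le_add (measure_decrRearr_lt g s) (measure_decrRearr_lt g' t))))
  intro x hx
  by_contra hc
  simp only [mem_union, mem_ofPred_eq, not_or, not_lt] at hc hx
  exact absurd hx (not_lt.2 ((enorm_add_le _ _).trans (add_le_add hc.1 hc.2)))

theorem decrRearr_zero (t : ℝ≥0∞) : decrRearr (0 : (Fin n → ℝ) → 𝕜) t = 0 :=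
  le_antisymm (decrRearr_le (by simp)) zero_le

theorem decrRearr_sum_le {ι : Type*} (s : Finset ι) (g : ι → (Fin n → ℝ) → 𝕜) (t : ι → ℝ≥0∞) :
    decrRearr (∑ i ∈ s, g i) (∑ i ∈ s, t i) ≤ ∑ i ∈ s, decrRearr (g i) (t i) := by
  classical
  induction s using Finset.induction_on with
  | empty => simp [decrRearr_zero]
  | insert a s ha ih =>
    rw [Finset.sum_insert ha, Finset.sum_insert ha, Finset.sum_insert ha]
    exact (decrRearr_add_le _ _ _ _).trans (add_le_add le_rfl ih)

theorem decrRearr_smul_le (c : 𝕜) (g : (Fin n → ℝ) → 𝕜) (t : ℝ≥0∞) :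
    decrRearr (c • g) t ≤ ‖c‖ₑ * decrRearr g t := by
  refine decrRearr_le ((measure_mono ?_).trans (measure_decrRearr_lt g t))
  intro x hx
  by_contra hc
  simp only [mem_ofPred_eq, not_lt, Pi.smul_apply, smul_eq_mul, enorm_mul] at hc hx
  exact absurd hx (not_lt.2 (by gcongr))

theorem decrRearr_translate (g : (Fin n → ℝ) → 𝕜) (v : Fin n → ℝ) (t : ℝ≥0∞) :
    decrRearr (fun x => g (x + v)) t = decrRearr g t := by
  unfold decrRearr
  congr 1
  ext y
  have : {x | y < ‖g (x + v)‖ₑ} = (fun x => x + v) ⁻¹' {x | y < ‖g x‖ₑ} := rfl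
  rw [mem_ofPred_eq, mem_ofPred_eq, this, measure_preimage_add_right]

/-- Chebyshev's inequality at the level e^{-τ/p} ‖g‖_p. -/
theorem decrRearr_le_eLpNorm {g : (Fin n → ℝ) → 𝕜} (hg : AEStronglyMeasurable g volume)
    {p : ℝ} (hp : 0 < p) (τ : ℝ) :
    decrRearr g (expE τ) ≤ expE (-τ / p) * eLpNorm g (ENNReal.ofReal p) volume := by
  set N := eLpNorm g (ENNReal.ofReal p) volume with hN
  rcases eq_or_ne N ∞ with h | hfin
  · rw [h, ENNReal.mul_top (expE_ne_zero _)]; exact le_top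
  rcases eq_or_ne N 0 with h0 | h0
  · have : g =ᵐ[volume] 0 := (eLpNorm_eq_zero_iff hg (by simpa using hp)).1 h0
    rw [decrRearr_congr_ae this, decrRearr_zero]; exact zero_le
  refine decrRearr_le ?_
  have h1 := meas_ge_le_mul_pow_eLpNorm_enorm volume (p := ENNReal.ofReal p) (by simpa using hp)
    ENNReal.ofReal_ne_top hg (ε := expE (-τ / p) * N)
    (mul_ne_zero (expE_ne_zero _) h0)
    (fun h => absurd h (ENNReal.mul_ne_top (expE_ne_top _) hfin))
  refine (measure_mono fun x hx => ?_).trans (h1.trans ?_)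
  · exact le_of_lt (by simpa using hx)
  · rw [← hN, ENNReal.toReal_ofReal hp.le, ENNReal.mul_inv (Or.inr hfin) (Or.inr h0),
      ENNReal.mul_rpow_of_nonneg _ _ hp.le, mul_assoc,
      ← ENNReal.mul_rpow_of_nonneg _ _ hp.le, ENNReal.inv_mul_cancel h0 hfin, ← expE_neg,
      expE_rpow]
    simp only [ENNReal.one_rpow, mul_one]
    refine expE_mono (le_of_eq ?_)
    field_simp

/-- The sets {|g| > m+1} have finite measure and decrease to the empty set. This is how the class S₀
enters: finiteness removes the remainder in Marchaud's inequality and makes absorption legitimate.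
-/
theorem decrRearr_lt_top {g : (Fin n → ℝ) → 𝕜} (hg : MemS0 g) {t : ℝ≥0∞} (ht : t ≠ 0) :
    decrRearr g t < ∞ := by
  have hlim : Filter.Tendsto (fun m : ℕ => volume {x | ((m : ℝ) + 1) < ‖g x‖}) Filter.atTop
      (nhds (volume (⋂ m : ℕ, {x | ((m : ℝ) + 1) < ‖g x‖}))) := by
    refine tendsto_measure_iInter_atTop (fun m => ?_) ?_ ⟨0, (hg.2 _ (by positivity)).ne⟩
    · exact nullMeasurableSet_lt aemeasurable_const hg.1.norm.aemeasurable
    · intro a b hab x hx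
      have : (a : ℝ) ≤ b := by exact_mod_cast hab
      simp only [mem_ofPred_eq] at hx ⊢
      linarith
  have h0 : (⋂ m : ℕ, {x | ((m : ℝ) + 1) < ‖g x‖}) = ∅ := by
    refine eq_empty_of_forall_notMem fun x hx => ?_
    obtain ⟨m, hm⟩ := exists_nat_gt ‖g x‖
    have := mem_iInter.1 hx m
    simp only [mem_ofPred_eq] at this
    linarith
  rw [h0, measure_empty] at hlim
  obtain ⟨m, hm⟩ := (hlim.eventually (gt_mem_nhds (pos_iff_ne_zero.2 ht))).exists
  refine lt_of_le_of_lt (decrRearr_le (y := ENNReal.ofReal (m + 1)) ?_) ENNReal.ofReal_lt_top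
  refine (measure_mono fun x hx => ?_).trans hm.le
  simp only [mem_ofPred_eq] at hx ⊢
  rw [← ofReal_norm] at hx
  exact (ENNReal.ofReal_lt_ofReal_iff_of_nonneg (by positivity)).1 hx

/-- A set of measure t > s cannot lie inside {|g| > g*(s)}, whose measure is at most s. The strict
inequality is paid for later by one unit of logarithmic scale. -/
theorem rearrangement_le_decrRearr (g : (Fin n → ℝ) → 𝕜) {t : ℝ} {s : ℝ≥0∞}
    (h : s < ENNReal.ofReal t) : rearrangement g t ≤ decrRearr g s := by
  refine iSup₂_le fun E hE => ?_
  by_contra hc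
  push Not at hc
  have : E ⊆ {x | decrRearr g s < ‖g x‖ₑ} := fun x hx => hc.trans_le (iInf₂_le x hx)
  have h2 := (measure_mono this).trans (measure_decrRearr_lt g s)
  rw [hE.2] at h2
  exact absurd h (not_lt.2 h2)

/-- A discrete version of the Lorentz norm `‖·‖_{q,1}`. -/
noncomputable def lorentzSum (q : ℝ) (g : (Fin n → ℝ) → 𝕜) : ℝ≥0∞ :=
  ∑' ν : ℤ, expE (ν / q) * decrRearr g (expE ν)

theorem lorentzSum_congr_ae {g g' : (Fin n → ℝ) → 𝕜} (h : g =ᵐ[volume] g') (q : ℝ) :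
    lorentzSum q g = lorentzSum q g' := by
  unfold lorentzSum; rw [decrRearr_congr_ae h]

theorem tsum_shift_decrRearr (q : ℝ) (g : (Fin n → ℝ) → 𝕜) (d : ℤ) :
    ∑' ν : ℤ, expE (ν / q) * decrRearr g (expE (ν - d)) = expE (d / q) * lorentzSum q g := by
  unfold lorentzSum
  rw [← ENNReal.tsum_mul_left, ← (Equiv.addRight d).tsum_eq]
  refine tsum_congr fun ν => ?_
  rw [← mul_assoc, ← expE_add]
  simp only [Equiv.coe_addRight]
  push_cast
  congr 2 <;> ring_nf

/-- Pointwise bounds by a function of the integer part integrate to a series. -/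
theorem lintegral_le_tsum_floor {F : ℝ → ℝ≥0∞} {a : ℤ → ℝ≥0∞}
    (h : ∀ (ν : ℤ), ∀ x ∈ Ico (ν : ℝ) (ν + 1), F x ≤ a ν) : ∫⁻ x, F x ≤ ∑' ν, a ν := by
  rw [← setLIntegral_univ, ← iUnion_Ico_intCast (α := ℝ)]
  refine (lintegral_iUnion_le _ _).trans (ENNReal.tsum_le_tsum fun ν => ?_)
  refine (setLIntegral_mono' measurableSet_Ico (h ν)).trans ?_
  simp

/-- Cutting |g| into the layers between consecutive values b (ν+1) and b ν bounds the integral of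
|g|^q by e Σ (e^{ν/q} b ν)^q; then ℓ¹ ⊂ ℓ^q. -/
theorem eLpNorm_le_lorentzSum {q : ℝ} (hq : 1 ≤ q) (g : (Fin n → ℝ) → 𝕜) :
    eLpNorm g (ENNReal.ofReal q) volume ≤ expE 1 * lorentzSum q g := by
  have hq0 : 0 < q := by linarith
  rcases eq_or_ne (lorentzSum q g) ∞ with hinf | hfin
  · rw [hinf, ENNReal.mul_top (expE_ne_zero _)]; exact le_top
  set b : ℤ → ℝ≥0∞ := fun ν => decrRearr g (expE ν) with hb
  -- the values of `g` are a.e. zero or in one of the layers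
  have hlimsmall : ∀ y : ℝ≥0∞, y ≠ 0 → ∃ N : ℤ, b N < y := by
    intro y hy
    by_contra hc
    push Not at hc
    refine hfin (top_unique ?_)
    calc ∞ = ∑' _ : ℕ, y := (ENNReal.tsum_const_eq_top_of_ne_zero hy).symm
      _ ≤ ∑' k : ℕ, expE ((k : ℤ) / q) * b k := by
          refine ENNReal.tsum_le_tsum fun k => ?_
          refine (hc k).trans (le_mul_of_one_le_left zero_le ?_)
          rw [← expE_zero]; exact expE_mono (by positivity)
      _ ≤ lorentzSum q g :=
          ENNReal.tsum_comp_le_tsum_of_injective (f := fun k : ℕ => (k : ℤ))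
            Nat.cast_injective (fun ν : ℤ => expE (ν / q) * b ν)
  have hanti : Antitone b := fun _ _ h => decrRearr_anti g (expE_mono (by exact_mod_cast h))
  -- The exceptional set lies in {b (-m) < |g|} for every m, so its measure is at most e^{-m}.
  have hae : ∀ᵐ x, ∃ ν : ℤ, ‖g x‖ₑ ≤ b ν := by
    rw [ae_iff]
    refine le_antisymm (le_of_forall_gt fun c hc => ?_) zero_le
    obtain ⟨m, hm⟩ : ∃ m : ℕ, expE (-m) < c := by
      have : Filter.Tendsto (fun m : ℕ => expE (-m)) Filter.atTop (nhds 0) := by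
        have h1 : Filter.Tendsto (fun m : ℕ => Real.exp (-(m : ℝ))) Filter.atTop (nhds 0) :=
          Real.tendsto_exp_neg_atTop_nhds_zero.comp tendsto_natCast_atTop_atTop
        simpa [expE] using ENNReal.tendsto_ofReal h1
      exact (this.eventually (gt_mem_nhds hc)).exists
    refine lt_of_le_of_lt ((measure_mono ?_).trans (measure_decrRearr_lt g (expE (-m)))) hm
    intro x hx
    simp only [mem_ofPred_eq, not_exists, not_le] at hx ⊢
    simpa [hb] using hx (-m)
  -- As `g` is not assumed measurable, the layers are replaced by measurable hulls of the same
  -- measure.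
  have hpt : ∀ᵐ x, ‖g x‖ₑ ^ q ≤ ∑' ν : ℤ, (toMeasurable volume {x | b (ν + 1) < ‖g x‖ₑ}).indicator
      (fun _ => b ν ^ q) x := by
    filter_upwards [hae] with x ⟨ν₀, hν₀⟩
    rcases eq_or_ne (‖g x‖ₑ) 0 with h0 | h0
    · rw [h0, ENNReal.zero_rpow_of_pos hq0]; exact zero_le
    obtain ⟨N, hN⟩ := hlimsmall _ h0
    obtain ⟨ν, hν, hmax⟩ := Int.exists_greatest_of_bdd (P := fun ν => ‖g x‖ₑ ≤ b ν)
      ⟨N, fun z hz => by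
        by_contra hzN
        push Not at hzN
        exact absurd (hz.trans (hanti hzN.le)) (not_le.2 hN)⟩ ⟨ν₀, hν₀⟩
    have hlt : b (ν + 1) < ‖g x‖ₑ := by
      by_contra hc
      have := hmax (ν + 1) (not_lt.1 hc)
      lia
    refine le_trans ?_ (ENNReal.le_tsum ν)
    have hmem : x ∈ toMeasurable volume {x | b (ν + 1) < ‖g x‖ₑ} := subset_toMeasurable _ _ hlt
    rw [indicator_of_mem hmem]
    gcongr
  have hmain : ∫⁻ x, ‖g x‖ₑ ^ q ≤ (expE 1 * lorentzSum q g) ^ q := by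
    calc ∫⁻ x, ‖g x‖ₑ ^ q ≤ ∫⁻ x, ∑' ν : ℤ,
          (toMeasurable volume {x | b (ν + 1) < ‖g x‖ₑ}).indicator (fun _ => b ν ^ q) x :=
          lintegral_mono_ae hpt
      _ = ∑' ν : ℤ, b ν ^ q * volume {x | b (ν + 1) < ‖g x‖ₑ} := by
          rw [lintegral_tsum fun ν =>
            (measurable_const.indicator (measurableSet_toMeasurable _ _)).aemeasurable]
          refine tsum_congr fun ν => ?_
          rw [lintegral_indicator (measurableSet_toMeasurable _ _), setLIntegral_const,
            measure_toMeasurable]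
      _ ≤ ∑' ν : ℤ, b ν ^ q * expE ((ν : ℝ) + 1) := by
          refine ENNReal.tsum_le_tsum fun ν => ?_
          gcongr
          have := measure_decrRearr_lt g (expE ((ν + 1 : ℤ) : ℝ))
          push_cast at this ⊢
          simpa [hb] using this
      _ = expE 1 * ∑' ν : ℤ, (expE (ν / q) * b ν) ^ q := by
          rw [← ENNReal.tsum_mul_left]
          refine tsum_congr fun ν => ?_
          rw [ENNReal.mul_rpow_of_nonneg _ _ hq0.le, expE_rpow, expE_add,
            div_mul_cancel₀ _ hq0.ne']
          ring
      _ ≤ expE 1 * lorentzSum q g ^ q := by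
          gcongr
          -- Each term is at most the whole sum, so q - 1 of its q factors may be replaced by the
          -- sum.
          have : ∀ ν : ℤ, (expE (ν / q) * b ν) ^ q ≤
              (expE (ν / q) * b ν) * lorentzSum q g ^ (q - 1) := by
            intro ν
            have hle : expE (ν / q) * b ν ≤ lorentzSum q g :=
              ENNReal.le_tsum (f := fun ν : ℤ => expE (ν / q) * b ν) ν
            rcases eq_or_ne (expE (ν / q) * b ν) 0 with h0 | h0
            · rw [h0, ENNReal.zero_rpow_of_pos hq0]; exact zero_le
            · calc (expE (ν / q) * b ν) ^ q = (expE (ν / q) * b ν) ^ (1 + (q - 1)) := by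
                    congr 1; ring
                _ = (expE (ν / q) * b ν) * (expE (ν / q) * b ν) ^ (q - 1) := by
                    rw [ENNReal.rpow_add _ _ h0 (ne_top_of_le_ne_top hfin hle), ENNReal.rpow_one]
                _ ≤ _ := by
                    gcongr
          calc _ ≤ ∑' ν : ℤ, (expE (ν / q) * b ν) * lorentzSum q g ^ (q - 1) :=
                ENNReal.tsum_le_tsum this
            _ = lorentzSum q g * lorentzSum q g ^ (q - 1) := by
                rw [ENNReal.tsum_mul_right]; rfl
            _ = lorentzSum q g ^ q := by
                rcases eq_or_ne (lorentzSum q g) 0 with h0 | h0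
                · rw [h0, ENNReal.zero_rpow_of_pos hq0, zero_mul]
                · conv_lhs => rw [← ENNReal.rpow_one (lorentzSum q g), ← ENNReal.rpow_mul, one_mul,
                    ← ENNReal.rpow_add _ _ h0 hfin]
                  congr 1; ring
      _ ≤ (expE 1 * lorentzSum q g) ^ q := by
          rw [ENNReal.mul_rpow_of_nonneg _ _ hq0.le, expE_rpow]
          gcongr
          exact expE_mono (by linarith)
  rw [eLpNorm_eq_lintegral_rpow_enorm_toReal (by simpa using hq0) ENNReal.ofReal_ne_top,
    ENNReal.toReal_ofReal hq0.le]
  calc _ ≤ ((expE 1 * lorentzSum q g) ^ q) ^ (1 / q) := by gcongr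
    _ = _ := by rw [← ENNReal.rpow_mul, mul_one_div_cancel hq0.ne', ENNReal.rpow_one]

/-- The Jacobian e^x of the exponential cancels the density 1/u. Through this every 𝓛^θ norm becomes
an ordinary L^θ norm in the logarithmic step. -/
theorem mulMeasure_eq_map : mulMeasure = Measure.map Real.exp volume := by
  refine Measure.ext fun s hs => ?_
  rw [mulMeasure, withDensity_apply _ hs, Measure.restrict_restrict hs,
    Measure.map_apply Real.measurable_exp hs]
  have himg : s ∩ Ioi 0 = Real.exp '' (Real.exp ⁻¹' s) := by
    rw [image_preimage_eq_inter_range, Real.range_exp]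
  rw [himg, lintegral_image_eq_lintegral_abs_deriv_mul (f' := Real.exp)
    (Real.measurable_exp hs) (fun x _ => (Real.hasDerivAt_exp x).hasDerivWithinAt)
    Real.exp_injective.injOn]
  rw [setLIntegral_congr_fun (g := fun _ => 1) (Real.measurable_exp hs)]
  · simp
  · intro x _
    simp only [abs_of_pos (Real.exp_pos x)]
    rw [← ENNReal.ofReal_mul (Real.exp_pos x).le, mul_inv_cancel₀ (Real.exp_pos x).ne']
    simp

theorem measurableEmbedding_exp : MeasurableEmbedding Real.exp :=
  Real.continuous_exp.measurableEmbedding Real.exp_injective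

theorem calNorm_eq (θ : ℝ≥0∞) (g : ℝ → ℝ≥0∞) :
    calNorm θ g = eLpNorm (fun x => g (Real.exp x)) θ volume := by
  rw [calNorm, mulMeasure_eq_map, measurableEmbedding_exp.eLpNorm_map_measure]
  rfl

theorem lorentzNorm_le_lorentzSum {q : ℝ} (hq : 1 ≤ q) (g : (Fin n → ℝ) → 𝕜) :
    lorentzNorm q 1 g ≤ expE 2 * lorentzSum q g := by
  have hq0 : 0 < q := by linarith
  rw [lorentzNorm, calNorm_eq, eLpNorm_one_eq_lintegral_enorm]
  -- On [ν, ν+1) the weight is taken at ν+1 and the rearrangement at ν-1, where strictness holds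
  -- even at x = ν. The total loss is e^{2/q} ≤ e².
  refine (lintegral_le_tsum_floor (a := fun ν : ℤ =>
    expE (1 / q) * (expE (ν / q) * decrRearr g (expE (ν - (1 : ℤ))))) fun ν x hx => ?_).trans ?_
  · rw [enorm_eq_self, ← mul_assoc, ← expE_add]
    refine mul_le_mul' ?_ (rearrangement_le_decrRearr g ?_)
    · rw [← Real.exp_mul]
      refine expE_mono ?_
      have := hx.2
      rw [← add_div, mul_one_div]
      gcongr
      linarith
    · refine (ENNReal.ofReal_lt_ofReal_iff (Real.exp_pos x)).2 (Real.exp_lt_exp.2 ?_)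
      have := hx.1
      push_cast
      linarith
  · rw [ENNReal.tsum_mul_left, tsum_shift_decrRearr, ← mul_assoc, ← expE_add]
    gcongr
    refine expE_mono ?_
    have : 1 / q ≤ 1 := by rw [div_le_one hq0]; exact hq
    push_cast
    linarith

end

/-! ### Translations, differences and Marchaud's inequality -/

section

variable {𝕜 : Type*} [RCLike 𝕜] {n : ℕ}

/-- Translation of functions by `v`, as a linear endomorphism. -/
def shift (𝕜 : Type*) [RCLike 𝕜] (v : Fin n → ℝ) : Module.End 𝕜 ((Fin n → ℝ) → 𝕜) where
  toFun f x := f (x + v)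
  map_add' _ _ := rfl
  map_smul' _ _ := rfl

theorem shift_apply (v : Fin n → ℝ) (f : (Fin n → ℝ) → 𝕜) (x : Fin n → ℝ) :
    shift 𝕜 v f x = f (x + v) := rfl

theorem shift_mul (v w : Fin n → ℝ) : shift 𝕜 v * shift 𝕜 w = shift 𝕜 (v + w) := by
  ext f x
  simp [shift_apply, Module.End.mul_apply, add_assoc]

theorem shift_pow (v : Fin n → ℝ) (k : ℕ) : shift 𝕜 v ^ k = shift 𝕜 (k • v) := by
  induction k with
  | zero => ext f x; simp [shift_apply]
  | succ k ih => rw [pow_succ, ih, shift_mul, succ_nsmul]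

theorem shift_commute (v w : Fin n → ℝ) : Commute (shift 𝕜 v) (shift 𝕜 w) := by
  rw [commute_iff_eq, shift_mul, shift_mul, add_comm]

theorem diff_eq_pow (j : Fin n) (k : ℕ) (h : ℝ) (f : (Fin n → ℝ) → 𝕜) :
    diff j k h f = ((shift 𝕜 (Pi.single j h) - 1) ^ k) f := by
  induction k with
  | zero => rfl
  | succ k ih =>
    have : diff j (k + 1) h f = fwdDiff (Pi.single j h) (diff j k h f) :=
      Function.iterate_succ_apply' _ _ _
    rw [this, ih, pow_succ', Module.End.mul_apply]
    rfl

theorem diff_zero (j : Fin n) (h : ℝ) (f : (Fin n → ℝ) → 𝕜) : diff j 0 h f = f := rfl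

theorem diff_add (j : Fin n) (a b : ℕ) (h : ℝ) (f : (Fin n → ℝ) → 𝕜) :
    diff j (a + b) h f = diff j a h (diff j b h f) := by
  simp only [diff_eq_pow, pow_add, Module.End.mul_apply]

theorem diff_comm (i j : Fin n) (a b : ℕ) (u h : ℝ) (f : (Fin n → ℝ) → 𝕜) :
    diff i a u (diff j b h f) = diff j b h (diff i a u f) := by
  simp only [diff_eq_pow, ← Module.End.mul_apply]
  congr 1
  have h0 : Commute (shift 𝕜 (Pi.single i u) - 1) (shift 𝕜 (Pi.single j h) - 1) :=
    ((shift_commute _ _).sub_left (Commute.one_left _)).sub_right (Commute.one_right _)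
  exact h0.pow_pow a b

theorem diff_step_zero (j : Fin n) {k : ℕ} (hk : k ≠ 0) (f : (Fin n → ℝ) → 𝕜) :
    diff j k 0 f = 0 := by
  have : shift 𝕜 (Pi.single j 0 : Fin n → ℝ) = 1 := by
    ext f x; simp [shift_apply]
  rw [diff_eq_pow, this, sub_self, zero_pow hk]; rfl

theorem measurable_diff (j : Fin n) (k : ℕ) {f : (Fin n → ℝ) → 𝕜} (hf : Measurable f) :
    Measurable (fun z : ℝ × (Fin n → ℝ) => diff j k z.1 f z.2) := by
  simp only [diff_apply]
  refine Finset.measurable_sum _ fun i _ => Measurable.const_mul (hf.comp ?_) _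
  exact measurable_snd.add ((measurable_const.mul measurable_fst).smul_const _)

theorem measurable_diff_right (j : Fin n) (k : ℕ) (h : ℝ) {f : (Fin n → ℝ) → 𝕜}
    (hf : Measurable f) : Measurable (diff j k h f) :=
  (measurable_diff j k hf).comp measurable_prodMk_left

theorem comp_add_ae_eq {β : Type*} {f g : (Fin n → ℝ) → β} (h : f =ᵐ[volume] g) (v : Fin n → ℝ) :
    (fun x => f (x + v)) =ᵐ[volume] fun x => g (x + v) :=
  (measurePreserving_add_right volume v).quasiMeasurePreserving.ae_eq_comp h

theorem diff_congr_ae (j : Fin n) (k : ℕ) (h : ℝ) {f g : (Fin n → ℝ) → 𝕜}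
    (hfg : f =ᵐ[volume] g) : diff j k h f =ᵐ[volume] diff j k h g := by
  have : ∀ i ∈ Finset.range (k + 1), ∀ᵐ x : Fin n → ℝ,
      f (x + (i * h) • Pi.single j (1 : ℝ)) = g (x + (i * h) • Pi.single j (1 : ℝ)) :=
    fun i _ => comp_add_ae_eq hfg _
  filter_upwards [(Finset.eventually_all _).2 this] with x hx
  rw [diff_apply, diff_apply]
  exact Finset.sum_congr rfl fun i hi => by rw [hx i hi]

theorem eLpNorm_shift (v : Fin n → ℝ) {f : (Fin n → ℝ) → 𝕜} (hf : Measurable f) (p : ℝ≥0∞) :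
    eLpNorm (shift 𝕜 v f) p volume = eLpNorm f p volume :=
  eLpNorm_comp_measurePreserving hf.aestronglyMeasurable (measurePreserving_add_right volume v)

theorem eLpNorm_diff_le (j : Fin n) (k : ℕ) (h : ℝ) {f : (Fin n → ℝ) → 𝕜} (hf : Measurable f)
    {p : ℝ≥0∞} (hp : 1 ≤ p) :
    eLpNorm (diff j k h f) p volume ≤ 2 ^ k * eLpNorm f p volume := by
  induction k with
  | zero => simp [diff_zero]
  | succ k ih =>
    have hm := measurable_diff_right j k h hf
    have hs : Measurable (shift 𝕜 (Pi.single j h) (diff j k h f)) :=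
      hm.comp (measurable_id.add_const _)
    have : diff j (k + 1) h f = shift 𝕜 (Pi.single j h) (diff j k h f) - diff j k h f := by
      rw [add_comm, diff_add, diff_eq_pow j 1, pow_one]; rfl
    rw [this]
    refine (eLpNorm_sub_le hs.aestronglyMeasurable hm.aestronglyMeasurable hp).trans ?_
    rw [eLpNorm_shift _ hm, ← two_mul, pow_succ', mul_assoc]
    gcongr

/-- Interchanging the two sums in an iterated difference. -/
theorem sum_diff_add_eq (j : Fin n) (k : ℕ) (h s : ℝ) (f : (Fin n → ℝ) → 𝕜) (x : Fin n → ℝ) :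
    ∑ l ∈ Finset.range (k + 1), (-1 : 𝕜) ^ (k - l) * (k.choose l : 𝕜) * diff j k (h + l * s) f x =
      ∑ i ∈ Finset.range (k + 1), (-1 : 𝕜) ^ (k - i) * (k.choose i : 𝕜) *
        diff j k (i * s) f (x + (i * h) • Pi.single j (1 : ℝ)) := by
  simp only [diff_apply, Finset.mul_sum]
  rw [Finset.sum_comm]
  refine Finset.sum_congr rfl fun i _ => Finset.sum_congr rfl fun l _ => ?_
  have : x + (i * h) • (Pi.single j (1 : ℝ) : Fin n → ℝ) + (l * (i * s)) • Pi.single j (1 : ℝ)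
      = x + (i * (h + l * s)) • Pi.single j (1 : ℝ) := by
    rw [add_assoc, ← add_smul]; ring_nf
  rw [this]
  ring

/-- In `sum_diff_add_eq` the term i = 0 vanishes, having step zero, and the term l = 0 is ±Δ^k(h) f.
Since s is free, a single value of the modulus is controlled by averages of the modulus over other
steps, without any monotonicity. -/
theorem eLpNorm_diff_le_sum (j : Fin n) {k : ℕ} (hk : k ≠ 0) (h s : ℝ) {f : (Fin n → ℝ) → 𝕜}
    (hf : Measurable f) {p : ℝ≥0∞} (hp : 1 ≤ p) :
    eLpNorm (diff j k h f) p volume ≤ 2 ^ k * ∑ l ∈ Finset.range k,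
      (eLpNorm (diff j k ((l + 1 : ℕ) * s) f) p volume +
        eLpNorm (diff j k (h + (l + 1 : ℕ) * s) f) p volume) := by
  set c : ℕ → 𝕜 := fun l => (-1 : 𝕜) ^ (k - l) * (k.choose l : 𝕜) with hc
  have hcn : ∀ l, ‖c l‖ₑ ≤ 2 ^ k := by
    intro l
    have h1 : ‖c l‖ ≤ 2 ^ k := by
      rw [hc]
      simp only [norm_mul, norm_pow, norm_neg, norm_one, one_pow, one_mul]
      rw [RCLike.norm_natCast]
      exact_mod_cast Nat.choose_le_two_pow k l
    rw [← ofReal_norm]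
    refine (ENNReal.ofReal_le_ofReal h1).trans (le_of_eq ?_)
    rw [ENNReal.ofReal_pow (by norm_num)]; simp
  have hrep : c 0 • diff j k h f =
      ∑ i ∈ Finset.range k, c (i + 1) • shift 𝕜 (((i + 1 : ℕ) * h) • Pi.single j (1 : ℝ))
        (diff j k ((i + 1 : ℕ) * s) f) -
      ∑ l ∈ Finset.range k, c (l + 1) • diff j k (h + (l + 1 : ℕ) * s) f := by
    funext x
    have := sum_diff_add_eq j k h s f x
    rw [Finset.sum_range_succ', Finset.sum_range_succ'] at this
    simp only [Nat.cast_zero, zero_mul, add_zero, diff_step_zero j hk, Pi.zero_apply,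
      mul_zero, Nat.cast_zero] at this
    simp only [Pi.smul_apply, Pi.sub_apply, Finset.sum_apply, smul_eq_mul, hc, shift_apply]
    rw [← this]
    ring
  have hc0 : eLpNorm (c 0 • diff j k h f) p volume = eLpNorm (diff j k h f) p volume := by
    rw [eLpNorm_const_smul]
    have : ‖c 0‖ₑ = 1 := by simp [hc, ← ofReal_norm]
    rw [this, one_mul]
  have hms : ∀ v u, Measurable (shift 𝕜 v (diff j k u f)) := fun v u =>
    (measurable_diff_right j k u hf).comp (measurable_id.add_const _)
  have hmd : ∀ u, Measurable (diff j k u f) := fun u => measurable_diff_right j k u hf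
  rw [← hc0, hrep]
  refine (eLpNorm_sub_le ?_ ?_ hp).trans ?_
  · exact Finset.aestronglyMeasurable_sum _ fun i _ => ((hms _ _).const_smul _).aestronglyMeasurable
  · exact Finset.aestronglyMeasurable_sum _ fun i _ => ((hmd _).const_smul _).aestronglyMeasurable
  rw [Finset.sum_add_distrib, mul_add, Finset.mul_sum, Finset.mul_sum]
  refine add_le_add ?_ ?_
  · refine (eLpNorm_sum_le (fun i _ => ((hms _ _).const_smul _).aestronglyMeasurable) hp).trans ?_
    refine Finset.sum_le_sum fun i _ => ?_
    rw [eLpNorm_const_smul, eLpNorm_shift _ (hmd _)]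
    gcongr
    exact hcn _
  · refine (eLpNorm_sum_le (fun i _ => ((hmd _).const_smul _).aestronglyMeasurable) hp).trans ?_
    refine Finset.sum_le_sum fun i _ => ?_
    rw [eLpNorm_const_smul]
    gcongr
    exact hcn _

/-- A polynomial in a translation is a sum of D multiples of translates. Each receives the share
e^{τ-D} of the argument e^τ, which is possible because D ≤ e^D. -/
theorem decrRearr_aeval_shift_le (Q : Polynomial 𝕜) : ∃ (C : ℝ≥0) (d : ℕ), ∀ (v : Fin n → ℝ)
    (g : (Fin n → ℝ) → 𝕜) (τ : ℝ),
    decrRearr (Polynomial.aeval (shift 𝕜 v) Q g) (expE τ) ≤ C * decrRearr g (expE (τ - d)) := by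
  refine ⟨∑ i ∈ Finset.range (Q.natDegree + 1), ‖Q.coeff i‖₊, Q.natDegree + 1, fun v g τ => ?_⟩
  have hrep : Polynomial.aeval (shift 𝕜 v) Q g =
      ∑ i ∈ Finset.range (Q.natDegree + 1), Q.coeff i • shift 𝕜 (i • v) g := by
    rw [Polynomial.aeval_eq_sum_range]
    simp [shift_pow]
  set D := Q.natDegree + 1
  have h1 : ∑ _i ∈ Finset.range D, expE (τ - D) ≤ expE τ := by
    rw [Finset.sum_const, Finset.card_range, nsmul_eq_mul]
    have h2 : (D : ℝ≥0∞) ≤ expE D := by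
      rw [expE, ← ENNReal.ofReal_natCast]
      exact ENNReal.ofReal_le_ofReal (by linarith [Real.add_one_le_exp (D : ℝ)])
    calc (D : ℝ≥0∞) * expE (τ - D) ≤ expE D * expE (τ - D) := by gcongr
      _ = expE τ := by rw [← expE_add]; congr 1; ring
  rw [hrep]
  refine (decrRearr_anti _ h1).trans ((decrRearr_sum_le _ _ _).trans ?_)
  push_cast
  rw [Finset.sum_mul]
  refine Finset.sum_le_sum fun i _ => (decrRearr_smul_le _ _ _).trans ?_
  have : decrRearr (shift 𝕜 (i • v) g) = decrRearr g := funext (decrRearr_translate g _)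
  rw [this]
  exact le_of_eq rfl

theorem decrRearr_diff_le (j : Fin n) (k : ℕ) : ∃ (C : ℝ≥0) (d : ℕ), ∀ (h : ℝ)
    (f : (Fin n → ℝ) → 𝕜) (τ : ℝ),
    decrRearr (diff j k h f) (expE τ) ≤ C * decrRearr f (expE (τ - d)) := by
  obtain ⟨C, d, h⟩ := decrRearr_aeval_shift_le (𝕜 := 𝕜) (n := n) ((Polynomial.X - 1) ^ k)
  refine ⟨C, d, fun u f τ => ?_⟩
  have := h (Pi.single j u) f τ
  simpa [diff_eq_pow] using this

/-- Both terms on the left take the value B^k at X = 1. -/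
theorem exists_polynomial_marchaud (𝕜 : Type*) [RCLike 𝕜] (B k : ℕ) : ∃ Q : Polynomial 𝕜,
    (B : Polynomial 𝕜) ^ k - (∑ i ∈ Finset.range B, Polynomial.X ^ i) ^ k
      = Q * (Polynomial.X - 1) := by
  have : Polynomial.X - Polynomial.C (1 : 𝕜) ∣
      (B : Polynomial 𝕜) ^ k - (∑ i ∈ Finset.range B, Polynomial.X ^ i) ^ k := by
    rw [Polynomial.dvd_iff_isRoot, Polynomial.IsRoot]
    simp [Polynomial.eval_finsetSum]
  obtain ⟨Q, hQ⟩ := this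
  exact ⟨Q, by rw [hQ, mul_comm]; simp⟩

/-- Multiply the polynomial identity by (X - 1)^k and evaluate at the translation by h: the factor
(X^B - 1)^k becomes the difference with step B h. Iteration of this identity expands Δ^k in
differences of degree k + 1 with geometrically growing steps. -/
theorem diff_marchaud_step {B k : ℕ} {Q : Polynomial 𝕜}
    (hQ : (B : Polynomial 𝕜) ^ k - (∑ i ∈ Finset.range B, Polynomial.X ^ i) ^ k
      = Q * (Polynomial.X - 1)) (j : Fin n) (h : ℝ) (f : (Fin n → ℝ) → 𝕜) :
    (B : 𝕜) ^ k • diff j k h f =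
      Polynomial.aeval (shift 𝕜 (Pi.single j h)) Q (diff j (k + 1) h f) + diff j k (B * h) f := by
  set T := shift 𝕜 (Pi.single j h : Fin n → ℝ) with hT
  have hB : shift 𝕜 (Pi.single j (B * h) : Fin n → ℝ) = T ^ B := by
    rw [hT, shift_pow, ← Pi.single_smul, nsmul_eq_mul]
  have h1 : (Polynomial.X ^ B - 1 : Polynomial 𝕜) ^ k =
      (∑ i ∈ Finset.range B, Polynomial.X ^ i) ^ k * (Polynomial.X - 1) ^ k := by
    rw [← mul_pow, geom_sum_mul]
  have h2 : (B : Polynomial 𝕜) ^ k * (Polynomial.X - 1) ^ k =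
      Q * (Polynomial.X - 1) ^ (k + 1) + (Polynomial.X ^ B - 1) ^ k := by
    rw [h1, pow_succ' _ k, ← mul_assoc, ← hQ]; ring
  have h3 := congrArg (fun R => Polynomial.aeval T R f) h2
  simp only [map_mul, map_add, map_pow, map_sub, Polynomial.aeval_X, map_one, map_natCast,
    LinearMap.add_apply, Module.End.mul_apply] at h3
  rw [diff_eq_pow, diff_eq_pow, diff_eq_pow, hB, ← h3]
  have : ((B : Module.End 𝕜 ((Fin n → ℝ) → 𝕜)) ^ k) = ((B : 𝕜) ^ k) • 1 := by
    rw [← Nat.cast_pow, ← Nat.cast_pow, Nat.cast_smul_eq_nsmul, nsmul_one]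
  rw [this]
  rfl

theorem diff_marchaud_sum {B k : ℕ} (hB : B ≠ 0) {Q : Polynomial 𝕜}
    (hQ : (B : Polynomial 𝕜) ^ k - (∑ i ∈ Finset.range B, Polynomial.X ^ i) ^ k
      = Q * (Polynomial.X - 1)) (j : Fin n) (h : ℝ) (f : (Fin n → ℝ) → 𝕜) (N : ℕ) :
    diff j k h f = ∑ ν ∈ Finset.range N, (((B : 𝕜) ^ k)⁻¹ ^ (ν + 1)) •
        Polynomial.aeval (shift 𝕜 (Pi.single j (B ^ ν * h))) Q (diff j (k + 1) (B ^ ν * h) f) +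
      ((B : 𝕜) ^ k)⁻¹ ^ N • diff j k (B ^ N * h) f := by
  induction N with
  | zero => simp
  | succ N ih =>
    have hB' : (B : 𝕜) ^ k ≠ 0 := pow_ne_zero _ (by exact_mod_cast hB)
    have h1 := diff_marchaud_step hQ j (B ^ N * h) f
    have h2 : diff j k (B ^ N * h) f = ((B : 𝕜) ^ k)⁻¹ • (Polynomial.aeval
        (shift 𝕜 (Pi.single j (B ^ N * h))) Q (diff j (k + 1) (B ^ N * h) f) +
        diff j k (B * (B ^ N * h)) f) := by
      rw [← h1, smul_smul, inv_mul_cancel₀ hB', one_smul]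
    rw [Finset.sum_range_succ, add_assoc]
    conv_lhs => rw [ih, h2]
    rw [smul_add, smul_add, smul_smul, smul_smul, ← pow_succ, ← mul_assoc, ← pow_succ']

/-- The shares of t in the rearrangement of a Marchaud sum: e^{-ν-2} for the ν-th term and e^{-1}
for the remainder. -/
theorem sum_expE_le_one (N : ℕ) :
    ∑ ν ∈ Finset.range N, expE (-ν - 2) + expE (-1) ≤ 1 := by
  have he : Real.exp (-1) ≤ 1 / 2 := by
    rw [Real.exp_neg, one_div]
    exact inv_anti₀ (by norm_num) (by linarith [Real.add_one_le_exp (1 : ℝ)])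
  have hs : ∀ N : ℕ, ∑ ν ∈ Finset.range N, Real.exp (-ν - 2) ≤ 1 / 2 - (1 / 2) ^ (N + 1) := by
    intro N
    induction N with
    | zero => norm_num
    | succ N ih =>
      have h1 : Real.exp (-N - 2) ≤ (1 / 2) ^ (N + 2) := by
        have : Real.exp (-N - 2) = Real.exp (-1) ^ (N + 2) := by
          rw [← Real.exp_nat_mul]; congr 1; push_cast; ring
        rw [this]
        exact pow_le_pow_left₀ (Real.exp_pos _).le he _
      rw [Finset.sum_range_succ]
      have h2 : (1 / 2 : ℝ) ^ (N + 1) = 2 * (1 / 2) ^ (N + 1 + 1) := by ring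
      have h3 : (1 / 2 : ℝ) ^ (N + 2) = (1 / 2) ^ (N + 1 + 1) := rfl
      linarith
  have h4 := hs N
  have h5 : (0 : ℝ) < (1 / 2) ^ (N + 1) := by positivity
  simp only [expE]
  rw [← ENNReal.ofReal_sum_of_nonneg fun _ _ => (Real.exp_pos _).le,
    ← ENNReal.ofReal_add (Finset.sum_nonneg fun _ _ => (Real.exp_pos _).le) (Real.exp_pos _).le]
  exact ENNReal.ofReal_le_one.2 (by linarith)

theorem tsum_expE_neg_mul_lt_top {γ : ℝ} (hγ : 0 < γ) : ∑' ν : ℕ, expE (-(γ * ν)) < ∞ := by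
  have : ∀ ν : ℕ, expE (-(γ * ν)) = expE (-γ) ^ ν := fun ν => by
    rw [← expE_natCast_mul]; congr 1; ring
  simp only [this]
  rw [ENNReal.tsum_geometric, ENNReal.inv_lt_top]
  refine tsub_pos_of_lt ?_
  rw [expE]
  exact ENNReal.ofReal_lt_one.2 (Real.exp_lt_one_iff.2 (by linarith))

/-- Marchaud's inequality, in the form of a reduction of the degree of the differences by one,
for majorants of slow growth. -/
theorem lorentzSum_diff_le_of_succ (j : Fin n) {k : ℕ} (hk : k ≠ 0) {q κ : ℝ} (hq : 1 ≤ q) (hκ : κ < k)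
    (C : ℝ≥0) : ∃ C' : ℝ≥0, ∀ f : (Fin n → ℝ) → 𝕜, MemS0 f → ∀ F : ℝ → ℝ≥0∞,
      (∀ x d, 0 ≤ d → F (x + d) ≤ expE (κ * d) * F x) →
      (∀ x, lorentzSum q (diff j (k + 1) (Real.exp x) f) ≤ C * F x) →
      ∀ x, lorentzSum q (diff j k (Real.exp x) f) ≤ C' * F x := by
  have hq0 : 0 < q := by linarith
  -- Giving the ν-th term only the share e^{-ν-2} of t costs a factor of order e^{ν/q} ≤ e^ν. The
  -- usual base 2 might not compensate this; B is taken so that (k - κ) log B ≥ 2, which leaves the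
  -- convergent factor e^{-ν}.
  obtain ⟨B, hB⟩ := exists_nat_gt (Real.exp (2 / (k - κ)) + 1)
  have hB0 : (0 : ℝ) < B := by linarith [Real.exp_pos (2 / (k - κ))]
  have hB1 : B ≠ 0 := by rintro rfl; simp at hB0
  obtain ⟨Q, hQ⟩ := exists_polynomial_marchaud 𝕜 B k
  obtain ⟨CQ, d, hCQ⟩ := decrRearr_aeval_shift_le (n := n) Q
  obtain ⟨CD, dD, hCD⟩ := decrRearr_diff_le (𝕜 := 𝕜) j k
  set b := Real.log B with hb
  have hexpb : Real.exp b = B := Real.exp_log hB0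
  have hbpos : 0 < b := Real.log_pos (by linarith [Real.exp_pos (2 / (k - κ))])
  have hb2 : 2 ≤ (k - κ) * b := by
    have h1 : 2 / (k - κ) ≤ b := by
      rw [hb, Real.le_log_iff_exp_le hB0]; linarith
    rw [div_le_iff₀ (by linarith)] at h1
    linarith
  have hnorm : ‖((B : 𝕜) ^ k)⁻¹‖ₑ = expE (-(k * b)) := by
    rw [← ofReal_norm, norm_inv, norm_pow, RCLike.norm_natCast, expE, Real.exp_neg,
      Real.exp_nat_mul, hexpb]
  have hnormp : ∀ N : ℕ, ‖((B : 𝕜) ^ k)⁻¹ ^ N‖ₑ = expE (-(k * b)) ^ N := fun N => by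
    rw [enorm_pow, hnorm]
  have hstep : ∀ (ν : ℕ) (x : ℝ), (B : ℝ) ^ ν * Real.exp x = Real.exp (x + ν * b) := by
    intro ν x
    rw [add_comm, Real.exp_add, Real.exp_nat_mul, hexpb]
  have hfin : ∑' ν : ℕ, expE (-ν) < ∞ := by simpa using tsum_expE_neg_mul_lt_top one_pos
  refine ⟨(expE (d + 2) * CQ * C * ∑' ν : ℕ, expE (-ν)).toNNReal, fun f hf F hF hC x => ?_⟩
  rw [ENNReal.coe_toNNReal (ENNReal.mul_ne_top (ENNReal.mul_ne_top (ENNReal.mul_ne_top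
    (expE_ne_top _) ENNReal.coe_ne_top) ENNReal.coe_ne_top) hfin.ne)]
  -- pointwise estimate of the rearrangement
  have hpt : ∀ μ : ℤ, decrRearr (diff j k (Real.exp x) f) (expE μ) ≤
      ∑' ν : ℕ, expE (-(k * b)) ^ (ν + 1) *
        (CQ * decrRearr (diff j (k + 1) (Real.exp (x + ν * b)) f)
          (expE (μ - (ν + 2 + d : ℤ)))) := by
    intro μ
    set a : ℕ → ℝ≥0∞ := fun ν => expE (-(k * b)) ^ (ν + 1) *
        (CQ * decrRearr (diff j (k + 1) (Real.exp (x + ν * b)) f)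
          (expE (μ - (ν + 2 + d : ℤ)))) with ha
    -- A finite bound for the rearrangement of Δ^k(B^N h) f that does not depend on N; the
    -- coefficient B^{-kN} then sends the remainder to zero.
    set D : ℝ≥0∞ := CD * decrRearr f (expE (μ - 1 - dD)) with hD
    have hDfin : D ≠ ∞ := ENNReal.mul_ne_top ENNReal.coe_ne_top
      (decrRearr_lt_top hf (expE_ne_zero _)).ne
    have hN : ∀ N : ℕ, decrRearr (diff j k (Real.exp x) f) (expE μ) ≤
        ∑' ν, a ν + expE (-(k * b)) ^ N * D := by
      intro N
      have hsum : ∑ ν ∈ Finset.range N, expE (μ - ν - 2) + expE (μ - 1) ≤ expE μ := by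
        have h1 : ∀ ν : ℕ, expE (μ - ν - 2) = expE μ * expE (-ν - 2) := fun ν => by
          rw [← expE_add]; congr 1; ring
        have h2 : expE (μ - 1) = expE μ * expE (-1) := by
          rw [← expE_add]; congr 1
        simp only [h1, h2]
        rw [← Finset.mul_sum, ← mul_add]
        exact mul_le_of_le_one_right zero_le (sum_expE_le_one N)
      refine (decrRearr_anti _ hsum).trans ?_
      rw [diff_marchaud_sum hB1 hQ j (Real.exp x) f N]
      refine (decrRearr_add_le _ _ _ _).trans (add_le_add ?_ ?_)
      · refine (decrRearr_sum_le _ _ _).trans (le_trans ?_ (ENNReal.sum_le_tsum (Finset.range N)))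
        refine Finset.sum_le_sum fun ν _ => (decrRearr_smul_le _ _ _).trans ?_
        rw [hnormp, hstep]
        refine mul_le_mul' le_rfl ((hCQ _ _ _).trans (le_of_eq ?_))
        congr 3
        push_cast
        ring
      · refine (decrRearr_smul_le _ _ _).trans ?_
        rw [hnormp]
        exact mul_le_mul' le_rfl (hCD _ _ _)
    have hlim : Filter.Tendsto (fun N : ℕ => ∑' ν, a ν + expE (-(k * b)) ^ N * D) Filter.atTop
        (nhds (∑' ν, a ν + 0 * D)) := by
      refine Filter.Tendsto.const_add _ (ENNReal.Tendsto.mul_const ?_ (Or.inr hDfin))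
      refine ENNReal.tendsto_pow_atTop_nhds_zero_of_lt_one ?_
      have hkb : 0 < (k : ℝ) * b := mul_pos (by positivity) hbpos
      rw [expE]
      exact ENNReal.ofReal_lt_one.2 (Real.exp_lt_one_iff.2 (by linarith))
    rw [zero_mul, add_zero] at hlim
    exact ge_of_tendsto' hlim hN
  calc lorentzSum q (diff j k (Real.exp x) f)
      ≤ ∑' μ : ℤ, ∑' ν : ℕ, expE (-(k * b)) ^ (ν + 1) * CQ * (expE (μ / q) *
          decrRearr (diff j (k + 1) (Real.exp (x + ν * b)) f) (expE (μ - (ν + 2 + d : ℤ)))) := by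
        refine ENNReal.tsum_le_tsum fun μ => ?_
        refine (mul_le_mul' le_rfl (hpt μ)).trans (le_of_eq ?_)
        rw [← ENNReal.tsum_mul_left]
        exact tsum_congr fun ν => by ring
    _ = ∑' ν : ℕ, expE (-(k * b)) ^ (ν + 1) * CQ * (expE ((ν + 2 + d : ℤ) / q) *
          lorentzSum q (diff j (k + 1) (Real.exp (x + ν * b)) f)) := by
        rw [ENNReal.tsum_comm]
        refine tsum_congr fun ν => ?_
        rw [ENNReal.tsum_mul_left]
        congr 1
        have := tsum_shift_decrRearr q (diff j (k + 1) (Real.exp (x + ν * b)) f) (ν + 2 + d)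
        push_cast at this ⊢
        exact this
    _ ≤ ∑' ν : ℕ, expE (d + 2) * CQ * C * F x * expE (-ν) := by
        refine ENNReal.tsum_le_tsum fun ν => ?_
        have hν : (0 : ℝ) ≤ ν * b := by positivity
        calc _ ≤ expE (-(k * b)) ^ (ν + 1) * CQ * (expE ((ν + 2 + d : ℤ) / q) *
              (C * (expE (κ * (ν * b)) * F x))) := by
              gcongr
              exact (hC _).trans (mul_le_mul' le_rfl (hF x _ hν))
          _ = (expE (-(k * b)) ^ (ν + 1) * expE ((ν + 2 + d : ℤ) / q) * expE (κ * (ν * b))) *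
              (CQ * C * F x) := by ring
          _ ≤ expE (d + 2 - ν) * (CQ * C * F x) := by
              gcongr
              rw [← expE_natCast_mul, ← expE_add, ← expE_add]
              refine expE_mono ?_
              push_cast
              have h1 : ((ν : ℝ) + 2 + d) / q ≤ ν + 2 + d := div_le_self (by positivity) hq
              have h2 : (ν : ℝ) * 2 ≤ ν * ((k - κ) * b) := by gcongr
              have h3 : 0 ≤ (k : ℝ) * b := by positivity
              nlinarith
          _ = _ := by
              rw [sub_eq_add_neg, expE_add]; ring
    _ = _ := by rw [ENNReal.tsum_mul_left]; ring

end

/-! ### Recovering a function from its differences over a box -/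

section

variable {𝕜 : Type*} [RCLike 𝕜] {n : ℕ}

theorem add_mul_add_single (x u : Fin n → ℝ) (l : Fin n → ℕ) (a : Fin n) (hl : l a = 0) (c : ℕ) :
    (x + fun i => (l i : ℝ) * u i) + (c * u a) • Pi.single a (1 : ℝ) =
      x + fun i => ((Function.update l a c i : ℕ) : ℝ) * u i := by
  funext i
  rcases eq_or_ne i a with rfl | hi
  · simp [hl]
  · simp [Function.update_of_ne hi, Pi.single_eq_of_ne hi]

/-- The value g(x) occurs in the difference with coefficient ±1, and the remaining binomial
coefficients add up to at most 2^m. -/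
theorem enorm_le_of_diff_le (a : Fin n) (m : ℕ) (h : ℝ) (g : (Fin n → ℝ) → 𝕜) (x : Fin n → ℝ)
    {M z : ℝ≥0∞} (hz : ‖diff a m h g x‖ₑ ≤ z)
    (hM : ∀ c ∈ Finset.Icc 1 m, ‖g (x + ((c : ℕ) * h) • Pi.single a (1 : ℝ))‖ₑ ≤ M) :
    ‖g x‖ₑ ≤ z + 2 ^ m * M := by
  have h0 := diff_apply a m h g x
  rw [Finset.sum_range_succ'] at h0
  simp only [Nat.cast_zero, zero_mul, zero_smul, add_zero, Nat.choose_zero_right, Nat.cast_one,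
    mul_one, Nat.sub_zero] at h0
  have h1 : (-1 : 𝕜) ^ m * g x = diff a m h g x - ∑ i ∈ Finset.range m,
      (-1 : 𝕜) ^ (m - (i + 1)) * (m.choose (i + 1) : 𝕜) *
        g (x + (((i + 1 : ℕ) : ℝ) * h) • Pi.single a (1 : ℝ)) := by
    rw [h0]; ring
  have hone : ∀ k : ℕ, ‖(-1 : 𝕜) ^ k‖ₑ = 1 := fun k => by simp [← ofReal_norm]
  have h2 : ‖g x‖ₑ = ‖(-1 : 𝕜) ^ m * g x‖ₑ := by rw [enorm_mul, hone, one_mul]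
  rw [h2, h1]
  refine (enorm_sub_le).trans (add_le_add hz ?_)
  refine (enorm_sum_le _ _).trans ?_
  have h3 : ∀ i ∈ Finset.range m, ‖(-1 : 𝕜) ^ (m - (i + 1)) * (m.choose (i + 1) : 𝕜) *
        g (x + (((i + 1 : ℕ) : ℝ) * h) • Pi.single a (1 : ℝ))‖ₑ ≤ (m.choose (i + 1) : ℝ≥0∞) * M := by
    intro i hi
    rw [enorm_mul, enorm_mul, hone, one_mul]
    refine mul_le_mul' (le_of_eq ?_) (hM _ ?_)
    · rw [← ofReal_norm, RCLike.norm_natCast, ENNReal.ofReal_natCast]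
    · simp only [Finset.mem_range, Finset.mem_Icc] at hi ⊢; lia
  refine (Finset.sum_le_sum h3).trans ?_
  rw [← Finset.sum_mul]
  gcongr
  have h4 : ∑ i ∈ Finset.range m, m.choose (i + 1) ≤ 2 ^ m := by
    rw [← Nat.sum_range_choose, Finset.sum_range_succ' _ m]
    exact Nat.le_add_right _ _
  exact_mod_cast h4

/-- Expansion of `g x` along a parallelepiped: a bound from values at remote lattice points and
differences. -/
theorem enorm_le_of_lattice (m : Fin n → ℕ) (g : (Fin n → ℝ) → 𝕜) (x u : Fin n → ℝ) {y z : ℝ≥0∞}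
    (hy : ∀ l : Fin n → ℕ, (∀ i, l i ∈ Finset.Icc 1 (m i)) →
      ‖g (x + fun i => (l i : ℝ) * u i)‖ₑ ≤ y)
    (hz : ∀ i, ∀ l : Fin n → ℕ, (∀ i', l i' ∈ Finset.range (m i' + 1)) →
      ‖diff i (m i) (u i) g (x + fun i' => (l i' : ℝ) * u i')‖ₑ ≤ z) :
    ‖g x‖ₑ ≤ 2 ^ (∑ i, m i) * (y + n * z) := by
  -- S is the set of coordinates in which the lattice point has not yet been moved. Each induction
  -- step moves one coordinate from 0 into 1, …, m a by a difference in that direction.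
  have key : ∀ S : Finset (Fin n), ∀ l : Fin n → ℕ, (∀ i, i ∉ S → l i ∈ Finset.Icc 1 (m i)) →
      (∀ i ∈ S, l i = 0) →
      ‖g (x + fun i => (l i : ℝ) * u i)‖ₑ ≤ 2 ^ (∑ i ∈ S, m i) * (y + S.card * z) := by
    intro S
    induction S using Finset.induction_on with
    | empty =>
      intro l hl _
      simpa using hy l fun i => hl i (by simp)
    | insert a S ha ih =>
      intro l hl hl0
      have hla : l a = 0 := hl0 a (Finset.mem_insert_self _ _)
      have hb := enorm_le_of_diff_le a (m a) (u a) g (x + fun i => (l i : ℝ) * u i)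
        (hz a l fun i => by
          by_cases hi : i ∈ insert a S
          · rw [hl0 i hi]; simp
          · have := Finset.mem_Icc.1 (hl i hi)
            exact Finset.mem_range.2 (by lia))
        (M := 2 ^ (∑ i ∈ S, m i) * (y + S.card * z)) (fun c hc => by
          rw [add_mul_add_single x u l a hla c]
          refine ih _ (fun i hi => ?_) (fun i hi => ?_)
          · rcases eq_or_ne i a with rfl | hia
            · simpa using hc
            · rw [Function.update_of_ne hia]
              exact hl i (by simp [hia, hi])
          · have hia : i ≠ a := fun h => ha (h ▸ hi)
            rw [Function.update_of_ne hia]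
            exact hl0 i (Finset.mem_insert_of_mem hi))
      refine hb.trans ?_
      rw [Finset.sum_insert ha, Finset.card_insert_of_notMem ha, pow_add]
      push_cast
      have h1 : (1 : ℝ≥0∞) ≤ 2 ^ m a * 2 ^ (∑ i ∈ S, m i) := by
        rw [← pow_add]; exact one_le_pow₀ (by norm_num)
      calc z + 2 ^ m a * (2 ^ (∑ i ∈ S, m i) * (y + S.card * z))
          ≤ 2 ^ m a * 2 ^ (∑ i ∈ S, m i) * z +
              2 ^ m a * (2 ^ (∑ i ∈ S, m i) * (y + S.card * z)) := by
            gcongr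
            exact le_mul_of_one_le_left zero_le h1
        _ = _ := by ring
  have := key Finset.univ (fun _ => 0) (by simp) (by simp)
  have h0 : x + (fun _ : Fin n => (0 : ℝ)) = x := add_zero x
  simpa [h0] using this

/-- The diagonal map with entries l i has determinant at least 1, so preimages do not gain volume.
-/
theorem volume_preimage_lattice_le (l : Fin n → ℕ) (hl : ∀ i, 1 ≤ l i) (x : Fin n → ℝ)
    {E : Set (Fin n → ℝ)} (hE : MeasurableSet E) :
    volume {u : Fin n → ℝ | (x + fun i => (l i : ℝ) * u i) ∈ E} ≤ volume E := by
  classical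
  set D : Matrix (Fin n) (Fin n) ℝ := Matrix.diagonal fun i => (l i : ℝ) with hD
  have hdet : 1 ≤ D.det := by
    rw [hD, Matrix.det_diagonal, ← Nat.cast_prod]
    exact_mod_cast Finset.one_le_prod' fun i _ => hl i
  have hE' : MeasurableSet ((fun v => x + v) ⁻¹' E) := (measurable_const_add x) hE
  have hset : {u : Fin n → ℝ | (x + fun i => (l i : ℝ) * u i) ∈ E} =
      Matrix.toLin' D ⁻¹' ((fun v => x + v) ⁻¹' E) := by
    ext u
    have : Matrix.toLin' D u = fun i => (l i : ℝ) * u i := by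
      funext i
      simp [hD, Matrix.mulVec_diagonal]
    simp only [mem_ofPred_eq, mem_preimage, this]
  rw [hset, ← Measure.map_apply (LinearMap.continuous_of_finiteDimensional _).measurable hE',
    Real.map_matrix_volume_pi_eq_smul_volume_pi (by linarith : D.det ≠ 0), Measure.smul_apply,
    smul_eq_mul, measure_preimage_add]
  refine mul_le_of_le_one_left zero_le (ENNReal.ofReal_le_one.2 ?_)
  rw [abs_of_pos (inv_pos.2 (by linarith))]
  exact inv_le_one_of_one_le₀ hdet

/-- Let u range over the box U = ∏ (δ_i, 2δ_i), of volume V. For x in the exceptional set, each u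
either sends one of the ∏ m_i lattice points into {|g| > y}, which by hypothesis uses at most V/2 of
the box, or makes some difference exceed z. Hence the second alternative holds on measure at least
V/2, and integrating in x with Fubini's theorem gives the bound. -/
theorem volume_lt_enorm_le (m : Fin n → ℕ) {g : (Fin n → ℝ) → 𝕜} (hg : Measurable g)
    {δ : Fin n → ℝ} (hδ : ∀ i, 0 < δ i) {y z b : ℝ≥0∞}
    (hy : 2 * (∏ i, (m i : ℝ≥0∞)) * volume {x | y < ‖g x‖ₑ} ≤ ∏ i, ENNReal.ofReal (δ i))
    (hb : ∀ i, ∀ s ∈ Ioo (δ i) (2 * δ i), volume {x | z < ‖diff i (m i) s g x‖ₑ} ≤ b) :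
    volume {x | 2 ^ (∑ i, m i) * (y + n * z) < ‖g x‖ₑ} ≤
      2 * (n * ∏ i, ((m i : ℝ≥0∞) + 1)) * b := by
  set V : ℝ≥0∞ := ∏ i, ENNReal.ofReal (δ i) with hV
  set U : Set (Fin n → ℝ) := Set.pi univ fun i => Ioo (δ i) (2 * δ i) with hU
  have hUm : MeasurableSet U := MeasurableSet.univ_pi fun _ => measurableSet_Ioo
  have hVU : volume U = V := by
    rw [hU, Real.volume_pi_Ioo]
    exact Finset.prod_congr rfl fun i _ => by congr 1; ring
  have hV0 : V ≠ 0 := Finset.prod_ne_zero_iff.2 fun i _ => by simp [hδ i]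
  have hVtop : V ≠ ∞ := ENNReal.prod_ne_top fun i _ => ENNReal.ofReal_ne_top
  set I := Fintype.piFinset fun i => Finset.Icc 1 (m i) with hI
  set J := Fintype.piFinset fun i => Finset.range (m i + 1) with hJ
  set E := {x | y < ‖g x‖ₑ} with hE
  have hEm : MeasurableSet E := measurableSet_lt measurable_const hg.enorm
  set G := {x | 2 ^ (∑ i, m i) * (y + n * z) < ‖g x‖ₑ} with hG
  have hGm : MeasurableSet G := measurableSet_lt measurable_const hg.enorm
  set T : Fin n → (Fin n → ℕ) → Set ((Fin n → ℝ) × (Fin n → ℝ)) := fun i l =>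
    {w | w.2 ∈ U ∧ z < ‖diff i (m i) (w.2 i) g (w.1 + fun i' => (l i' : ℝ) * w.2 i')‖ₑ} with hT
  have hTm : ∀ i l, MeasurableSet (T i l) := by
    intro i l
    refine (measurable_snd hUm).inter (measurableSet_lt measurable_const (Measurable.enorm ?_))
    refine (measurable_diff i (m i) hg).comp (Measurable.prodMk ?_ ?_)
    · exact (measurable_pi_apply i).comp measurable_snd
    · refine measurable_fst.add (measurable_pi_lambda _ fun i' => ?_)
      exact ((measurable_pi_apply i').comp measurable_snd).const_mul _
  set Φ : (Fin n → ℝ) → ℝ≥0∞ := fun x => ∑ i, ∑ l ∈ J, volume (Prod.mk x ⁻¹' T i l) with hΦ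
  have hGΦ : ∀ x ∈ G, V / 2 ≤ Φ x := by
    intro x hx
    have hcover : U ⊆ (⋃ l ∈ I, {u : Fin n → ℝ | (x + fun i => (l i : ℝ) * u i) ∈ E}) ∪
        ⋃ i, ⋃ l ∈ J, Prod.mk x ⁻¹' T i l := by
      intro u hu
      by_contra hc
      simp only [mem_union, mem_iUnion, not_or, not_exists, hE, hT, mem_ofPred_eq, mem_preimage,
        not_lt, not_and, hI, hJ, Fintype.mem_piFinset] at hc
      exact absurd hx (not_lt.2 (enorm_le_of_lattice m g x u (fun l hl => hc.1 l hl)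
        fun i l hl => hc.2 i l hl hu))
    have h1 : V ≤ (∏ i, (m i : ℝ≥0∞)) * volume E + Φ x := by
      rw [← hVU]
      refine (measure_mono hcover).trans ((measure_union_le _ _).trans (add_le_add ?_ ?_))
      · refine (measure_biUnion_finset_le _ _).trans ((Finset.sum_le_sum (g := fun _ => volume E)
          fun l hl => volume_preimage_lattice_le l (fun i => ?_) x hEm).trans ?_)
        · exact (Finset.mem_Icc.1 (Fintype.mem_piFinset.1 hl i)).1
        · rw [Finset.sum_const, hI, Fintype.card_piFinset, nsmul_eq_mul]
          simp
      · refine (measure_iUnion_fintype_le _ _).trans (Finset.sum_le_sum fun i _ => ?_)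
        exact measure_biUnion_finset_le _ _
    have h2 : (∏ i, (m i : ℝ≥0∞)) * volume E ≤ V / 2 := by
      rw [ENNReal.le_div_iff_mul_le (by simp) (by simp)]
      calc _ = 2 * (∏ i, (m i : ℝ≥0∞)) * volume E := by ring
        _ ≤ V := hy
    have h3 : V / 2 + V / 2 ≤ V / 2 + Φ x := by
      rw [ENNReal.add_halves]
      exact h1.trans (add_le_add h2 le_rfl)
    exact (ENNReal.add_le_add_iff_left (ENNReal.div_ne_top hVtop (by simp))).1 h3
  have hΦint : ∫⁻ x, Φ x ≤ V * ((n * ∏ i, ((m i : ℝ≥0∞) + 1)) * b) := by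
    -- For fixed u the slice in x is a translate of a level set of a single difference, of measure
    -- at most b.
    have hslice : ∀ i l, ∫⁻ x, volume (Prod.mk x ⁻¹' T i l) ≤ V * b := by
      intro i l
      rw [← Measure.prod_apply (hTm i l), Measure.prod_apply_symm (hTm i l)]
      calc _ ≤ ∫⁻ u, U.indicator (fun _ => b) u := by
            refine lintegral_mono fun u => ?_
            by_cases hu : u ∈ U
            · rw [indicator_of_mem hu]
              have hset : (fun x => (x, u)) ⁻¹' T i l = (fun x => x + fun i' => (l i' : ℝ) * u i') ⁻¹'
                  {x | z < ‖diff i (m i) (u i) g x‖ₑ} := by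
                ext x; simp [hT, hu]
              rw [hset, measure_preimage_add_right]
              exact hb i (u i) (hu i (mem_univ i))
            · have : (fun x => (x, u)) ⁻¹' T i l = ∅ := by
                ext x; simp [hT, hu]
              rw [this, measure_empty]; exact zero_le
        _ = V * b := by rw [lintegral_indicator hUm, setLIntegral_const, hVU, mul_comm]
    have hmeas : ∀ i l, Measurable fun x => volume (Prod.mk x ⁻¹' T i l) := fun i l =>
      measurable_measure_prodMk_left (hTm i l)
    rw [hΦ, lintegral_finsetSum _ fun i _ => Finset.measurable_fun_sum _ fun l _ => hmeas i l]
    calc _ ≤ ∑ _i : Fin n, ∑ _l ∈ J, V * b := by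
          refine Finset.sum_le_sum fun i _ => ?_
          rw [lintegral_finsetSum _ fun l _ => hmeas i l]
          exact Finset.sum_le_sum fun l _ => hslice i l
      _ = _ := by
          rw [Finset.sum_const, Finset.sum_const, hJ, Fintype.card_piFinset]
          simp only [Finset.card_univ, Fintype.card_fin, Finset.card_range, nsmul_eq_mul]
          push_cast
          ring
  have h4 : V / 2 * volume G ≤ V * ((n * ∏ i, ((m i : ℝ≥0∞) + 1)) * b) := by
    rw [← setLIntegral_const]
    exact ((setLIntegral_mono' hGm hGΦ).trans (setLIntegral_le_lintegral _ _)).trans hΦint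
  have h5 : V * volume G ≤ V * (2 * (n * ∏ i, ((m i : ℝ≥0∞) + 1)) * b) := by
    calc V * volume G = 2 * (V / 2 * volume G) := by
          rw [← mul_assoc, ENNReal.mul_div_cancel (by simp) (by simp)]
      _ ≤ 2 * (V * ((n * ∏ i, ((m i : ℝ≥0∞) + 1)) * b)) := by gcongr
      _ = _ := by ring
  exact (ENNReal.mul_le_mul_iff_right hV0 hVtop).1 h5

/-- The rearrangement at `t` is controlled by its value at `e^s t` and by the differences with
steps adapted to a box of measure comparable with `t`. The factor of the first term does not
depend on `s`. -/
theorem decrRearr_le_of_diff_bounds (hn : 1 ≤ n) (m : Fin n → ℕ) (s : ℝ) :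
    ∃ (K : ℝ) (C : ℝ≥0), 0 < K ∧ ∀ (g : (Fin n → ℝ) → 𝕜), Measurable g → ∀ p : Fin n → ℝ,
      (∀ i, 1 ≤ p i) → ∀ (τ lam : ℝ) (X : Fin n → ℝ) (A : ℝ≥0∞), ∑ i, X i = τ →
      (∀ i, ∀ h ∈ Ioo (K * Real.exp (X i)) (2 * (K * Real.exp (X i))),
        eLpNorm (diff i (m i) h g) (ENNReal.ofReal (p i)) volume ≤ A * expE (lam + τ / p i)) →
      decrRearr g (expE τ) ≤ 2 ^ (∑ i, m i) * decrRearr g (expE (τ + s)) + C * A * expE lam := by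
  set K : ℝ := 1 + 2 * (∏ i, (m i : ℝ)) * Real.exp s with hK
  have hK1 : 1 ≤ K := by
    rw [hK]
    have : 0 ≤ ∏ i, (m i : ℝ) := Finset.prod_nonneg fun i _ => Nat.cast_nonneg _
    have := Real.exp_pos s
    nlinarith [mul_nonneg ‹0 ≤ ∏ i, (m i : ℝ)› this.le]
  set D : ℝ≥0∞ := 2 * (n * ∏ i, ((m i : ℝ≥0∞) + 1)) with hD
  obtain ⟨cD, hcD0, hcD⟩ : ∃ c : ℝ, 0 ≤ c ∧ D ≤ expE c := by
    have : D ≠ ∞ := ENNReal.mul_ne_top (by simp) (ENNReal.mul_ne_top (by simp)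
      (ENNReal.prod_ne_top fun i _ => by simp))
    refine ⟨D.toReal, ENNReal.toReal_nonneg, ?_⟩
    rw [expE, ENNReal.le_ofReal_iff_toReal_le this (Real.exp_pos _).le]
    linarith [Real.add_one_le_exp D.toReal]
  refine ⟨K, (2 ^ (∑ i, m i) * n * expE cD).toNNReal, by linarith,
    fun g hg p hp τ lam X A hX hA => ?_⟩
  rw [ENNReal.coe_toNNReal (ENNReal.mul_ne_top (ENNReal.mul_ne_top (by simp) (by simp))
    (expE_ne_top _))]
  -- The level set of each difference is allowed measure e^{τ - cD}, so that the combinatorial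
  -- factor D brings the total back to e^τ. Chebyshev's inequality at that measure costs e^{cD/p_i}
  -- ≤ e^{cD}, which is the factor in z.
  have hmain := volume_lt_enorm_le m hg (δ := fun i => K * Real.exp (X i))
    (fun i => mul_pos (by linarith) (Real.exp_pos _)) (y := decrRearr g (expE (τ + s)))
    (z := expE cD * A * expE lam) (b := expE (τ - cD)) ?_ ?_
  · refine (decrRearr_le (hmain.trans ?_)).trans (le_of_eq (by ring))
    calc D * expE (τ - cD) ≤ expE cD * expE (τ - cD) := by gcongr
      _ = expE τ := by rw [← expE_add]; congr 1; ring
  · calc 2 * (∏ i, (m i : ℝ≥0∞)) * volume {x | decrRearr g (expE (τ + s)) < ‖g x‖ₑ}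
        ≤ 2 * (∏ i, (m i : ℝ≥0∞)) * expE (τ + s) := by
          gcongr
          exact measure_decrRearr_lt g _
      _ = ENNReal.ofReal (2 * (∏ i, (m i : ℝ)) * Real.exp s * Real.exp τ) := by
          rw [add_comm, expE_add, expE, expE, ENNReal.ofReal_mul (by positivity),
            ENNReal.ofReal_mul (by positivity), ENNReal.ofReal_mul (by positivity),
            ENNReal.ofReal_prod_of_nonneg (by simp)]
          simp [mul_assoc]
      _ ≤ ENNReal.ofReal (∏ i, (K * Real.exp (X i))) := by
          refine ENNReal.ofReal_le_ofReal ?_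
          rw [Finset.prod_mul_distrib, ← Real.exp_sum, hX, Finset.prod_const, Finset.card_univ,
            Fintype.card_fin]
          have : K ≤ K ^ n := le_self_pow₀ hK1 (by lia)
          gcongr
          linarith
      _ = _ := ENNReal.ofReal_prod_of_nonneg fun i _ =>
          mul_nonneg (by linarith) (Real.exp_pos _).le
  · intro i h hh
    refine (measure_mono ?_).trans (measure_decrRearr_lt (diff i (m i) h g) _)
    intro x hx
    rw [mem_ofPred_eq] at hx ⊢
    refine lt_of_le_of_lt ?_ hx
    have hpi : 0 < p i := by linarith [hp i]
    refine (decrRearr_le_eLpNorm (measurable_diff_right i (m i) h hg).aestronglyMeasurable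
      hpi (τ - cD)).trans ?_
    calc _ ≤ expE (-(τ - cD) / p i) * (A * expE (lam + τ / p i)) := by gcongr; exact hA i h hh
      _ = expE (cD / p i) * A * expE lam := by
          have : -(τ - cD) / p i = cD / p i + -(τ / p i) := by ring
          rw [this, expE_add, expE_add, expE_neg]
          calc _ = expE (cD / p i) * A * expE lam * (expE (τ / p i) * (expE (τ / p i))⁻¹) := by ring
            _ = _ := by rw [ENNReal.mul_inv_cancel (expE_ne_zero _) (expE_ne_top _), mul_one]
      _ ≤ _ := by
          gcongr
          exact expE_mono (div_le_self hcD0 (hp i))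

end

/-! ### Slowly varying majorants -/

section

/-- The kernel `e^{-ε|v|}`. -/
noncomputable def decay (ε v : ℝ) : ℝ≥0∞ := expE (-(ε * |v|))

theorem decay_le_one {ε : ℝ} (hε : 0 ≤ ε) (v : ℝ) : decay ε v ≤ 1 := by
  rw [← expE_zero]
  exact expE_mono (by have := mul_nonneg hε (abs_nonneg v); linarith)

theorem measurable_decay (ε : ℝ) : Measurable (decay ε) :=
  measurable_expE.comp (by fun_prop)

theorem lintegral_decay_lt_top {ε : ℝ} (hε : 0 < ε) : ∫⁻ v, decay ε v < ∞ := by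
  have h1 : ∫⁻ v in Ioi 0, decay ε v < ∞ := by
    have h := (exp_neg_integrableOn_Ioi 0 hε).lintegral_lt_top
    refine lt_of_le_of_lt (setLIntegral_mono' measurableSet_Ioi fun v hv => ?_) h
    rw [decay, abs_of_pos hv]
    exact expE_mono (by linarith)
  have h2 : ∫⁻ v in Iic 0, decay ε v < ∞ := by
    have h := (integrableOn_exp_mul_Iic hε 0).lintegral_lt_top
    refine lt_of_le_of_lt (setLIntegral_mono' measurableSet_Iic fun v hv => ?_) h
    rw [decay, abs_of_nonpos hv]
    exact expE_mono (by linarith)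
  rw [← setLIntegral_univ, ← Iic_union_Ioi (a := (0 : ℝ))]
  exact (lintegral_union_le _ _ _).trans_lt (ENNReal.add_lt_top.2 ⟨h2, h1⟩)

theorem decay_sub_le {ε : ℝ} (hε : 0 ≤ ε) (x y u : ℝ) :
    decay ε (x - u) ≤ expE (ε * |x - y|) * decay ε (y - u) := by
  rw [decay, decay, ← expE_add]
  refine expE_mono ?_
  have h1 : |y - u| ≤ |x - y| + |x - u| := by
    have := abs_sub_le y x u
    rwa [abs_sub_comm y x] at this
  nlinarith

theorem lintegral_decay_sub (ε x : ℝ) : ∫⁻ u, decay ε (x - u) = ∫⁻ v, decay ε v :=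
  lintegral_sub_left_eq_self (decay ε) x

theorem eLpNorm_decay_le {ε : ℝ} (hε : 0 ≤ ε) {θ : ℝ≥0∞} (hθ : 1 ≤ θ) :
    eLpNorm (decay ε) θ volume ≤ 1 + ∫⁻ v, decay ε v := by
  rcases eq_or_ne θ ∞ with rfl | htop
  · rw [eLpNorm_exponent_top]
    refine le_trans (eLpNormEssSup_le_of_ae_enorm_bound (C := 1) ?_) le_self_add
    filter_upwards with v using by rw [enorm_eq_self]; exact decay_le_one hε v
  have hθ0 : θ ≠ 0 := (zero_lt_one.trans_le hθ).ne'
  have hθ1 : 1 ≤ θ.toReal := by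
    rw [← ENNReal.toReal_one]; exact ENNReal.toReal_mono htop hθ
  rw [eLpNorm_eq_lintegral_rpow_enorm_toReal hθ0 htop]
  have h1 : ∫⁻ v, ‖decay ε v‖ₑ ^ θ.toReal ≤ 1 + ∫⁻ v, decay ε v := by
    refine (lintegral_mono fun v => ?_).trans le_add_self
    rw [enorm_eq_self]
    exact ENNReal.rpow_le_self_of_le_one (decay_le_one hε v) hθ1
  calc _ ≤ (1 + ∫⁻ v, decay ε v) ^ (1 / θ.toReal) := by gcongr
    _ ≤ (1 + ∫⁻ v, decay ε v) ^ (1 : ℝ) := by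
        refine ENNReal.rpow_le_rpow_of_exponent_le le_self_add ?_
        rw [div_le_one (by linarith)]; exact hθ1
    _ = _ := ENNReal.rpow_one _

/-- The convolution of `A` with the kernel `e^{-ε|v|}`. -/
noncomputable def decayConv (ε : ℝ) (A : ℝ → ℝ≥0∞) (x : ℝ) : ℝ≥0∞ := ∫⁻ u, A u * decay ε (x - u)

theorem decayConv_le {ε : ℝ} (hε : 0 ≤ ε) {A : ℝ → ℝ≥0∞} (x y : ℝ) :
    decayConv ε A x ≤ expE (ε * |x - y|) * decayConv ε A y := by
  unfold decayConv
  rw [← lintegral_const_mul' _ _ (expE_ne_top _)]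
  refine lintegral_mono fun u => ?_
  calc _ ≤ A u * (expE (ε * |x - y|) * decay ε (y - u)) := by
        gcongr; exact decay_sub_le hε x y u
    _ = _ := by ring

theorem measurable_decay_sub (ε x : ℝ) : Measurable fun u => decay ε (x - u) :=
  (measurable_decay ε).comp (measurable_const.sub measurable_id)

theorem measurable_decayConv (ε : ℝ) {A : ℝ → ℝ≥0∞} (hA : Measurable A) :
    Measurable (decayConv ε A) := by
  refine Measurable.lintegral_prod_right' (f := fun z : ℝ × ℝ => A z.2 * decay ε (z.1 - z.2)) ?_
  exact (hA.comp measurable_snd).mul ((measurable_decay ε).comp (measurable_fst.sub measurable_snd))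

/-- The convolution is an L¹ norm for a finite measure whose mass is the integral of the kernel, so
it is dominated by the L^θ norm for the same measure. -/
theorem decayConv_le_eLpNorm (ε : ℝ) {A : ℝ → ℝ≥0∞} (hA : Measurable A) {θ : ℝ≥0∞}
    (hθ : 1 ≤ θ) (x : ℝ) :
    decayConv ε A x ≤ eLpNorm A θ (volume.withDensity fun u => decay ε (x - u)) *
      (∫⁻ v, decay ε v) ^ (1 - 1 / θ.toReal) := by
  set μ := volume.withDensity fun u => decay ε (x - u) with hμ
  have h1 : decayConv ε A x = eLpNorm A 1 μ := by
    rw [eLpNorm_one_eq_lintegral_enorm, hμ,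
      lintegral_withDensity_eq_lintegral_mul _ (measurable_decay_sub ε x) hA.enorm]
    refine lintegral_congr fun u => ?_
    simp [mul_comm]
  have h2 : μ univ = ∫⁻ v, decay ε v := by
    rw [hμ, withDensity_apply _ MeasurableSet.univ, setLIntegral_univ, lintegral_decay_sub]
  rw [h1, ← h2]
  simpa using eLpNorm_le_eLpNorm_mul_rpow_measure_univ hθ (hA.aestronglyMeasurable (μ := μ))

theorem decayConv_le_of_eLpNorm {ε : ℝ} (hε : 0 ≤ ε) {A : ℝ → ℝ≥0∞} (hA : Measurable A)
    {θ : ℝ≥0∞} (hθ : 1 ≤ θ) (x : ℝ) :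
    decayConv ε A x ≤ eLpNorm A θ volume * (∫⁻ v, decay ε v) ^ (1 - 1 / θ.toReal) := by
  refine (decayConv_le_eLpNorm ε hA hθ x).trans (mul_le_mul' (eLpNorm_mono_measure _ ?_) le_rfl)
  refine Measure.le_iff.2 fun s hs => ?_
  rw [withDensity_apply _ hs, ← setLIntegral_one s]
  exact lintegral_mono fun u => decay_le_one hε _

/-- Young's inequality for an integrable kernel: the preceding bound is raised to the power θ and
integrated in x. -/
theorem eLpNorm_decayConv_le {ε : ℝ} (hε : 0 < ε) {A : ℝ → ℝ≥0∞} (hA : Measurable A)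
    {θ : ℝ≥0∞} (hθ : 1 ≤ θ) :
    eLpNorm (decayConv ε A) θ volume ≤ (∫⁻ v, decay ε v) * eLpNorm A θ volume := by
  rcases eq_or_ne θ ∞ with rfl | htop
  · conv_lhs => rw [eLpNorm_exponent_top]
    refine eLpNormEssSup_le_of_ae_enorm_bound ?_
    filter_upwards with x
    rw [enorm_eq_self, mul_comm]
    simpa using decayConv_le_of_eLpNorm hε.le hA hθ x
  have hθ0 : θ ≠ 0 := (zero_lt_one.trans_le hθ).ne'
  have hθ1 : 1 ≤ θ.toReal := by
    rw [← ENNReal.toReal_one]; exact ENNReal.toReal_mono htop hθ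
  set s := θ.toReal with hs
  have hs0 : 0 < s := by linarith
  set κ := ∫⁻ v, decay ε v with hκ
  have hκtop : κ ≠ ∞ := (lintegral_decay_lt_top hε).ne
  have hpt : ∀ x, decayConv ε A x ^ s ≤ κ ^ (s - 1) * ∫⁻ u, A u ^ s * decay ε (x - u) := by
    intro x
    have h := decayConv_le_eLpNorm ε hA hθ x
    rw [eLpNorm_eq_lintegral_rpow_enorm_toReal hθ0 htop,
      lintegral_withDensity_eq_lintegral_mul _ (measurable_decay_sub ε x)
        (hA.enorm.pow_const _)] at h
    have h' := ENNReal.rpow_le_rpow h hs0.le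
    rw [ENNReal.mul_rpow_of_nonneg _ _ hs0.le, ← ENNReal.rpow_mul, ← ENNReal.rpow_mul, ← hs,
      one_div_mul_cancel hs0.ne', ENNReal.rpow_one, sub_mul, one_mul,
      one_div_mul_cancel hs0.ne', mul_comm] at h'
    refine h'.trans (le_of_eq ?_)
    congr 1
    refine lintegral_congr fun u => ?_
    simp [mul_comm]
  have hint : ∫⁻ x, decayConv ε A x ^ s ≤ κ ^ s * ∫⁻ u, A u ^ s := by
    calc ∫⁻ x, decayConv ε A x ^ s ≤ ∫⁻ x, κ ^ (s - 1) * ∫⁻ u, A u ^ s * decay ε (x - u) :=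
          lintegral_mono hpt
      _ = κ ^ (s - 1) * ∫⁻ u, ∫⁻ x, A u ^ s * decay ε (x - u) := by
          rw [lintegral_const_mul' _ _ (ENNReal.rpow_ne_top_of_nonneg (by linarith) hκtop),
            lintegral_lintegral_swap]
          exact (((hA.pow_const s).comp measurable_snd).mul
            ((measurable_decay ε).comp (measurable_fst.sub measurable_snd))).aemeasurable
      _ = κ ^ (s - 1) * (κ * ∫⁻ u, A u ^ s) := by
          congr 1
          rw [← lintegral_const_mul _ (hA.pow_const s)]
          refine lintegral_congr fun u => ?_
          rw [lintegral_const_mul _ (f := fun x => decay ε (x - u))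
            ((measurable_decay ε).comp (measurable_id.sub_const u)), mul_comm]
          congr 1
          exact lintegral_sub_right_eq_self (decay ε) u
      _ = κ ^ s * ∫⁻ u, A u ^ s := by
          rw [← mul_assoc]
          congr 1
          conv_lhs => rw [← ENNReal.rpow_one κ, ← ENNReal.rpow_mul, one_mul,
            ← ENNReal.rpow_add_of_nonneg _ _ (by linarith) zero_le_one]
          congr 1; ring
  rw [eLpNorm_eq_lintegral_rpow_enorm_toReal hθ0 htop,
    eLpNorm_eq_lintegral_rpow_enorm_toReal hθ0 htop, ← hs]
  simp only [enorm_eq_self]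
  calc _ ≤ (κ ^ s * ∫⁻ u, A u ^ s) ^ (1 / s) := by gcongr
    _ = _ := by
      rw [ENNReal.mul_rpow_of_nonneg _ _ (by positivity), ← ENNReal.rpow_mul,
        mul_one_div_cancel hs0.ne', ENNReal.rpow_one]

/-- A positive slowly varying majorant with controlled norm. The majorant is `exp ∘ a`. -/
theorem exists_slow_majorant {ε : ℝ} (hε : 0 < ε) : ∃ C : ℝ≥0, ∀ θ : ℝ≥0∞, 1 ≤ θ →
    ∀ A : ℝ → ℝ≥0∞, Measurable A → ∀ σ : ℝ≥0, 0 < σ → eLpNorm A θ volume ≤ σ →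
    ∃ a : ℝ → ℝ, (∀ x y, |a x - a y| ≤ ε * |x - y|) ∧
      eLpNorm (fun x => expE (a x)) θ volume ≤ C * σ ∧ ∀ x, decayConv ε A x ≤ expE (a x) := by
  have hκ := (lintegral_decay_lt_top hε).ne
  refine ⟨(1 + 2 * ∫⁻ v, decay ε v).toNNReal, fun θ hθ A hA σ hσ hAσ => ?_⟩
  rw [ENNReal.coe_toNNReal (by finiteness)]
  -- The extra term keeps P positive, so that log P is finite, without spoiling the slow variation
  -- or the size of the norm.
  set P : ℝ → ℝ≥0∞ := fun x => decayConv ε A x + σ * decay ε x with hP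
  have hPtop : ∀ x, P x ≠ ∞ := fun x => by
    refine ENNReal.add_ne_top.2 ⟨ne_top_of_le_ne_top ?_ (decayConv_le_of_eLpNorm hε.le hA hθ x),
      ENNReal.mul_ne_top ENNReal.coe_ne_top (expE_ne_top _)⟩
    refine ENNReal.mul_ne_top (ne_top_of_le_ne_top ENNReal.coe_ne_top hAσ) ?_
    refine ENNReal.rpow_ne_top_of_nonneg ?_ hκ
    rcases eq_or_ne θ ∞ with rfl | htop
    · simp
    · have hθ1 : 1 ≤ θ.toReal := by
        rw [← ENNReal.toReal_one]; exact ENNReal.toReal_mono htop hθ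
      rw [sub_nonneg, div_le_one (by linarith)]; exact hθ1
  have hP0 : ∀ x, P x ≠ 0 := fun x => by
    simp only [hP, ne_eq, add_eq_zero, mul_eq_zero, ENNReal.coe_eq_zero, not_and, not_or]
    exact fun _ => ⟨hσ.ne', expE_ne_zero _⟩
  have hPpos : ∀ x, 0 < (P x).toReal := fun x => ENNReal.toReal_pos (hP0 x) (hPtop x)
  have hPvar : ∀ x y, P x ≤ expE (ε * |x - y|) * P y := fun x y => by
    simp only [hP, mul_add]
    refine add_le_add (decayConv_le hε.le x y) ?_
    have := decay_sub_le hε.le x y 0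
    simp only [sub_zero] at this
    calc _ ≤ (σ : ℝ≥0∞) * (expE (ε * |x - y|) * decay ε y) := by gcongr
      _ = _ := by ring
  have hPexp : ∀ x, expE (Real.log (P x).toReal) = P x := fun x => by
    rw [expE, Real.exp_log (hPpos x), ENNReal.ofReal_toReal (hPtop x)]
  refine ⟨fun x => Real.log (P x).toReal, fun x y => ?_, ?_, fun x => ?_⟩
  · have key : ∀ x y, Real.log (P x).toReal ≤ ε * |x - y| + Real.log (P y).toReal := by
      intro x y
      rw [← Real.log_exp (ε * |x - y|), ← Real.log_mul (Real.exp_pos _).ne' (hPpos y).ne']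
      refine Real.log_le_log (hPpos x) ?_
      have h := ENNReal.toReal_mono (ENNReal.mul_ne_top (expE_ne_top _) (hPtop y)) (hPvar x y)
      rwa [ENNReal.toReal_mul, expE, ENNReal.toReal_ofReal (Real.exp_pos _).le] at h
    rw [abs_le]
    constructor
    · have := key y x
      rw [abs_sub_comm] at this
      linarith
    · linarith [key x y]
  · simp only [hPexp]
    refine (eLpNorm_add_le (measurable_decayConv ε hA).aestronglyMeasurable
      ((measurable_decay ε).const_mul _).aestronglyMeasurable hθ).trans ?_
    have h2 : eLpNorm (fun x => (σ : ℝ≥0∞) * decay ε x) θ volume ≤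
        σ * (1 + ∫⁻ v, decay ε v) := by
      refine (eLpNorm_le_nnreal_smul_eLpNorm_of_ae_le_mul' (c := σ) (g := decay ε) ?_ θ).trans ?_
      · filter_upwards with x; simp
      · rw [ENNReal.smul_def, smul_eq_mul]
        gcongr
        exact eLpNorm_decay_le hε.le hθ
    calc _ ≤ (∫⁻ v, decay ε v) * σ + σ * (1 + ∫⁻ v, decay ε v) := by
          refine add_le_add ((eLpNorm_decayConv_le hε hA hθ).trans ?_) h2
          gcongr
      _ = _ := by ring
  · rw [hPexp]; exact le_self_add

/-- The Jacobian a ≥ 1 only helps. -/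
theorem setLIntegral_comp_affine_le (ω : ℝ → ℝ≥0∞) {a b h H : ℝ} (ha : 1 ≤ a) {S : Set ℝ}
    (hS : MeasurableSet S) (hSI : ∀ s ∈ S, b + a * s ∈ Ioo h H) :
    ∫⁻ s in S, ω (b + a * s) ≤ ∫⁻ v in Ioo h H, ω v := by
  have hinj : InjOn (fun s => b + a * s) S := fun s _ t _ hst => by
    have : a * s = a * t := by simpa using hst
    exact mul_left_cancel₀ (by linarith) this
  have himg := lintegral_image_eq_lintegral_abs_deriv_mul (f := fun s => b + a * s)
    (f' := fun _ => a) hS (fun s _ => by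
      simpa using (((hasDerivAt_id s).const_mul a).const_add b).hasDerivWithinAt) hinj ω
  calc ∫⁻ s in S, ω (b + a * s) ≤ ∫⁻ s in S, ENNReal.ofReal |a| * ω (b + a * s) := by
        refine lintegral_mono fun s => le_mul_of_one_le_left zero_le ?_
        rw [ENNReal.one_le_ofReal, abs_of_pos (by linarith)]
        exact ha
    _ = ∫⁻ v in (fun s => b + a * s) '' S, ω v := himg.symm
    _ ≤ _ := lintegral_mono_set (by rintro _ ⟨s, hs, rfl⟩; exact hSI s hs)

/-- A function with the self-improving property of the modulus of smoothness is bounded by its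
logarithmic averages. -/
theorem le_decayConv_of_sum_le {k : ℕ} {r ε : ℝ} (hr : 0 ≤ r) (hε : 0 ≤ ε) :
    ∃ C : ℝ≥0, ∀ ω : ℝ → ℝ≥0∞, Measurable ω →
      (∀ h s, ω h ≤ 2 ^ k * ∑ l ∈ Finset.range k,
        (ω ((l + 1 : ℕ) * s) + ω (h + (l + 1 : ℕ) * s))) →
      ∀ x, ω (Real.exp x) ≤
        C * expE (r * x) * decayConv ε (fun u => expE (-(r * u)) * ω (Real.exp u)) x := by
  -- The inequality is averaged over s ∈ (h, 2h). All arguments on the right then lie in (h,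
  -- (2k+1)h), an interval of logarithmic length c on which the kernel and the power weight are
  -- bounded below.
  set c := Real.log (2 * k + 1) with hc
  have hexpc : Real.exp c = 2 * k + 1 := Real.exp_log (by positivity)
  have hc0 : 0 ≤ c := Real.log_nonneg (by linarith [Nat.cast_nonneg (α := ℝ) k])
  refine ⟨(2 ^ k * (2 * k) * (expE (c + r * c + ε * c))).toNNReal, fun ω hω hsum x => ?_⟩
  rw [ENNReal.coe_toNNReal (ENNReal.mul_ne_top (by finiteness) (expE_ne_top _))]
  set h := Real.exp x with hh
  have hpos : 0 < h := Real.exp_pos x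
  set H := Real.exp (x + c) with hH
  have hHh : H = (2 * k + 1) * h := by rw [hH, Real.exp_add, hexpc, mul_comm]
  -- averaging
  have h1 : ENNReal.ofReal h * ω h ≤ 2 ^ k * (2 * k) * ∫⁻ v in Ioo h H, ω v := by
    calc ENNReal.ofReal h * ω h = ∫⁻ _ in Ioo h (2 * h), ω h := by
          rw [setLIntegral_const, Real.volume_Ioo, mul_comm]; congr 2; ring
      _ ≤ ∫⁻ s in Ioo h (2 * h), 2 ^ k * ∑ l ∈ Finset.range k,
            (ω (0 + (l + 1 : ℕ) * s) + ω (h + (l + 1 : ℕ) * s)) :=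
          lintegral_mono fun s => by simpa using hsum h s
      _ = 2 ^ k * ∑ l ∈ Finset.range k, ((∫⁻ s in Ioo h (2 * h), ω (0 + (l + 1 : ℕ) * s)) +
            ∫⁻ s in Ioo h (2 * h), ω (h + (l + 1 : ℕ) * s)) := by
          rw [lintegral_const_mul' _ _ (by finiteness), lintegral_finsetSum]
          · congr 1
            refine Finset.sum_congr rfl fun l _ => lintegral_add_left ?_ _
            exact hω.comp (by fun_prop)
          · intro l _
            exact (hω.comp (by fun_prop)).add (hω.comp (by fun_prop))
      _ ≤ 2 ^ k * ∑ l ∈ Finset.range k, ((∫⁻ v in Ioo h H, ω v) + ∫⁻ v in Ioo h H, ω v) := by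
          refine mul_le_mul' le_rfl (Finset.sum_le_sum fun l hl => ?_)
          have hl1 : ((l + 1 : ℕ) : ℝ) ≤ k := by
            exact_mod_cast Finset.mem_range.1 hl
          have hl2 : (1 : ℝ) ≤ ((l + 1 : ℕ) : ℝ) := by push_cast; linarith [Nat.cast_nonneg (α := ℝ) l]
          refine add_le_add (setLIntegral_comp_affine_le ω hl2 measurableSet_Ioo (fun s hs => ?_))
            (setLIntegral_comp_affine_le ω hl2 measurableSet_Ioo (fun s hs => ?_))
          all_goals
            have hs1 := hs.1
            have hs2 := hs.2
            rw [mem_Ioo, hHh]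
            constructor <;> nlinarith
      _ = _ := by
          rw [Finset.sum_const, Finset.card_range, nsmul_eq_mul]; ring
  -- exponential change of variables
  have h2 : ∫⁻ v in Ioo h H, ω v ≤ ENNReal.ofReal h * (expE (c + r * c + ε * c) * expE (r * x) *
      decayConv ε (fun u => expE (-(r * u)) * ω (Real.exp u)) x) := by
    have himg : Ioo h H ⊆ Real.exp '' Ioo x (x + c) := by
      intro v hv
      have hv0 : 0 < v := hpos.trans hv.1
      refine ⟨Real.log v, ⟨?_, ?_⟩, Real.exp_log hv0⟩
      · rw [Real.lt_log_iff_exp_lt hv0]; exact hv.1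
      · rw [Real.log_lt_iff_lt_exp hv0]; exact hv.2
    refine (lintegral_mono_set himg).trans ?_
    rw [lintegral_image_eq_lintegral_abs_deriv_mul measurableSet_Ioo
      (fun u _ => (Real.hasDerivAt_exp u).hasDerivWithinAt) Real.exp_injective.injOn, decayConv,
      ← mul_assoc, ← lintegral_const_mul' _ _ (by
        refine ENNReal.mul_ne_top ENNReal.ofReal_ne_top (ENNReal.mul_ne_top ?_ ?_) <;>
        exact expE_ne_top _)]
    refine (setLIntegral_mono' measurableSet_Ioo fun u hu => ?_).trans
      (setLIntegral_le_lintegral (Ioo x (x + c)) _)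
    have hE : ENNReal.ofReal |Real.exp u| = expE u := by rw [abs_of_pos (Real.exp_pos u)]; rfl
    have hEh : ENNReal.ofReal h = expE x := rfl
    rw [hE, hEh, decay, abs_of_nonpos (by linarith [hu.1] : x - u ≤ 0)]
    calc expE u * ω (Real.exp u)
        ≤ expE (x + (c + r * c + ε * c + r * x) + (-(r * u) + -(ε * -(x - u)))) *
            ω (Real.exp u) := by
          gcongr
          refine expE_mono ?_
          have := hu.2
          nlinarith
      _ = _ := by
          simp only [expE_add]; ring
  have h3 : ENNReal.ofReal h * ω h ≤ ENNReal.ofReal h *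
      (2 ^ k * (2 * k) * (expE (c + r * c + ε * c)) * expE (r * x) *
        decayConv ε (fun u => expE (-(r * u)) * ω (Real.exp u)) x) := by
    refine h1.trans ((mul_le_mul' le_rfl h2).trans (le_of_eq ?_))
    ring
  exact (ENNReal.mul_le_mul_iff_right (by simpa using hpos) ENNReal.ofReal_ne_top).1 h3

end

/-! ### Balancing the directions -/

section

/-- All difference quotients of `f` lie in `[a, b]`. -/
def HasSlopes (f : ℝ → ℝ) (a b : ℝ) : Prop :=
  ∀ x y, ∃ c ∈ Icc a b, f y - f x = c * (y - x)

theorem HasSlopes.continuous {f : ℝ → ℝ} {a b : ℝ} (h : HasSlopes f a b) (ha : 0 < a) :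
    Continuous f := by
  refine (LipschitzWith.of_dist_le_mul (K := Real.toNNReal b) fun x y => ?_).continuous
  obtain ⟨c, hc, hxy⟩ := h y x
  have hb : 0 ≤ b := by linarith [hc.1, hc.2]
  rw [Real.dist_eq, hxy, abs_mul, Real.coe_toNNReal _ hb, Real.dist_eq,
    abs_of_pos (by linarith [hc.1] : 0 < c)]
  exact mul_le_mul_of_nonneg_right hc.2 (abs_nonneg _)

theorem HasSlopes.surjective {f : ℝ → ℝ} {a b : ℝ} (h : HasSlopes f a b) (ha : 0 < a) :
    Function.Surjective f := by
  intro t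
  have hcont := h.continuous ha
  refine mem_range_of_exists_le_of_exists_ge hcont ⟨-(|t - f 0| / a), ?_⟩ ⟨|t - f 0| / a, ?_⟩
  · obtain ⟨c, hc, hxy⟩ := h 0 (-(|t - f 0| / a))
    have h1 : a * (|t - f 0| / a) = |t - f 0| := by field_simp
    have h2 : a * (|t - f 0| / a) ≤ c * (|t - f 0| / a) :=
      mul_le_mul_of_nonneg_right hc.1 (by positivity)
    have h3 := neg_abs_le (t - f 0)
    nlinarith
  · obtain ⟨c, hc, hxy⟩ := h 0 (|t - f 0| / a)
    have h1 : a * (|t - f 0| / a) = |t - f 0| := by field_simp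
    have h2 : a * (|t - f 0| / a) ≤ c * (|t - f 0| / a) :=
      mul_le_mul_of_nonneg_right hc.1 (by positivity)
    have h3 := le_abs_self (t - f 0)
    nlinarith

variable {n : ℕ}

/-- At c_i = 1/r_i the two expressions are exactly ρ = r/n - 1/p and β_j, and they depend
continuously on c. Here c stands for the slopes of the inverses of x ↦ r_i x + a_i(x). -/
theorem exists_slope_bound (hn : 1 ≤ n) {r p : Fin n → ℝ} (hr : ∀ i, 0 < r i) {δ : ℝ}
    (hδ : 0 < δ) : ∃ η > 0, ∀ c : Fin n → ℝ, (∀ i, |c i - 1 / r i| ≤ η) →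
      0 < ∑ i, c i ∧
      |(1 - ∑ i, c i / p i) / ∑ i, c i - (meanR r / n - 1 / meanP r p)| ≤ δ ∧
      ∀ j, |c j * ((1 - ∑ i, c i / p i) / ∑ i, c i + 1 / p j) - beta r p j| ≤ δ := by
  set c₀ : Fin n → ℝ := fun i => 1 / r i with hc₀
  have hne : (Finset.univ : Finset (Fin n)).Nonempty := ⟨⟨0, hn⟩, Finset.mem_univ _⟩
  have hS : 0 < ∑ i, c₀ i := Finset.sum_pos (fun i _ => one_div_pos.2 (hr i)) hne
  have hn0 : (n : ℝ) ≠ 0 := by positivity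
  have hL0 : (1 - ∑ i, c₀ i / p i) / ∑ i, c₀ i = meanR r / n - 1 / meanP r p := by
    have h1 : ∑ i, c₀ i / p i = ∑ i, 1 / (p i * r i) :=
      Finset.sum_congr rfl fun i _ => by rw [hc₀]; simp only; rw [div_div, mul_comm]
    have h2 : meanR r / n = (∑ i, c₀ i)⁻¹ := by
      rw [meanR, mul_div_assoc, mul_comm, div_mul_cancel₀ _ hn0]
    have h3 : 1 / meanP r p = (∑ i, c₀ i)⁻¹ * ∑ i, 1 / (p i * r i) := by
      rw [meanP, one_div, mul_inv, inv_inv, inv_div, h2]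
    rw [h1, h2, h3, sub_div, div_eq_mul_inv, div_eq_mul_inv]
    ring
  have hcontL : ContinuousAt (fun c : Fin n → ℝ => (1 - ∑ i, c i / p i) / ∑ i, c i) c₀ := by
    refine ContinuousAt.div ?_ ?_ hS.ne'
    · exact Continuous.continuousAt (by fun_prop)
    · exact Continuous.continuousAt (by fun_prop)
  have hcontB : ∀ j, ContinuousAt (fun c : Fin n → ℝ =>
      c j * ((1 - ∑ i, c i / p i) / ∑ i, c i + 1 / p j)) c₀ := fun j =>
    (continuous_apply j).continuousAt.mul (hcontL.add continuousAt_const)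
  have hev1 : ∀ᶠ c : Fin n → ℝ in nhds c₀, 0 < ∑ i, c i :=
    (Continuous.continuousAt (by fun_prop)).eventually (lt_mem_nhds hS)
  have hev2 := hcontL.eventually (Metric.closedBall_mem_nhds _ hδ)
  have hev3 := Filter.eventually_all.2 fun j =>
    (hcontB j).eventually (Metric.closedBall_mem_nhds _ hδ)
  obtain ⟨η, hη, hball⟩ := Metric.eventually_nhds_iff.1 (hev1.and (hev2.and hev3))
  refine ⟨η / 2, by positivity, fun c hc => ?_⟩
  have hdist : dist c c₀ < η := by
    refine lt_of_le_of_lt ((dist_pi_le_iff (by positivity)).2 fun i => ?_) (half_lt_self hη)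
    rw [Real.dist_eq]; exact hc i
  obtain ⟨h1, h2, h3⟩ := hball hdist
  refine ⟨h1, ?_, fun j => ?_⟩
  · rw [← hL0]; exact h2
  · have hb : beta r p j = c₀ j * ((1 - ∑ i, c₀ i / p i) / ∑ i, c₀ i + 1 / p j) := by
      rw [hL0, beta, hc₀]; ring
    rw [hb]; exact h3 j

/-- Simultaneous balancing of slowly perturbed power functions, in logarithmic variables. -/
theorem exists_balance (hn : 1 ≤ n) {r p : Fin n → ℝ} (hr : ∀ i, 0 < r i) {δ : ℝ}
    (hδ : 0 < δ) : ∃ ε > 0, ∀ a : Fin n → ℝ → ℝ,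
      (∀ i x y, |a i x - a i y| ≤ ε * |x - y|) →
      ∃ (X : Fin n → ℝ → ℝ) (ell : ℝ → ℝ),
        (∀ τ, ∑ i, X i τ = τ) ∧
        (∀ i τ, r i * X i τ + a i (X i τ) = ell τ + τ / p i) ∧
        (∀ j, HasSlopes (X j) (beta r p j - δ) (beta r p j + δ)) ∧
        HasSlopes ell (meanR r / n - 1 / meanP r p - δ) (meanR r / n - 1 / meanP r p + δ) := by
  obtain ⟨η, hη, hslope⟩ := exists_slope_bound hn (p := p) hr hδ
  have hev : ∀ i, ∀ᶠ ε in nhdsWithin (0 : ℝ) (Ioi 0), ∀ c, |c - r i| ≤ ε →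
      0 < c ∧ |c⁻¹ - 1 / r i| ≤ η := by
    intro i
    have h1 : ∀ᶠ c in nhds (r i), 0 < c := lt_mem_nhds (hr i)
    have h2 : ∀ᶠ c in nhds (r i), c⁻¹ ∈ Metric.closedBall (r i)⁻¹ η :=
      (continuousAt_inv₀ (hr i).ne').eventually (Metric.closedBall_mem_nhds _ hη)
    obtain ⟨δ', hδ', hb⟩ := Metric.eventually_nhds_iff.1 (h1.and h2)
    filter_upwards [Ioo_mem_nhdsGT hδ'] with ε hε c hc
    obtain ⟨h3, h4⟩ := hb (y := c) (by rw [Real.dist_eq]; exact hc.trans_lt hε.2)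
    refine ⟨h3, ?_⟩
    rw [one_div]; exact h4
  obtain ⟨ε, hεev, hε⟩ := ((Filter.eventually_all.2 hev).and self_mem_nhdsWithin).exists
  refine ⟨ε, hε, fun a ha => ?_⟩
  -- The perturbed function r_i x + a_i(x) has slopes within ε of r_i, hence is invertible with
  -- inverse slopes within η of 1/r_i.
  have hψ : ∀ i x y, ∃ c, (0 < c ∧ |c⁻¹ - 1 / r i| ≤ η) ∧ |c - r i| ≤ ε ∧
      (r i * y + a i y) - (r i * x + a i x) = c * (y - x) := by
    intro i x y
    rcases eq_or_ne x y with rfl | hxy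
    · exact ⟨r i, hεev i _ (by simpa using hε.le), by simpa using hε.le, by simp⟩
    · have hyx : y - x ≠ 0 := sub_ne_zero.2 hxy.symm
      have hc : |r i + (a i y - a i x) / (y - x) - r i| ≤ ε := by
        rw [add_sub_cancel_left, abs_div, div_le_iff₀ (abs_pos.2 hyx)]
        exact ha i y x
      refine ⟨r i + (a i y - a i x) / (y - x), hεev i _ hc, hc, ?_⟩
      field_simp
      ring
  have hεr : ∀ i, 0 < r i - ε := fun i => (hεev i (r i - ε) (by simp [abs_of_pos hε])).1
  have hψs : ∀ i, HasSlopes (fun x => r i * x + a i x) (r i - ε) (r i + ε) := fun i x y => by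
    obtain ⟨c, _, hc, h⟩ := hψ i x y
    rw [abs_le] at hc
    exact ⟨c, ⟨by linarith [hc.1], by linarith [hc.2]⟩, h⟩
  choose χ hχ using fun i => (hψs i).surjective (hεr i)
  have hχs : ∀ i s t, ∃ c, |c - 1 / r i| ≤ η ∧ c ∈ Icc (r i + ε)⁻¹ (r i - ε)⁻¹ ∧ χ i t - χ i s = c * (t - s) := by
    intro i s t
    obtain ⟨c, ⟨hc0, hc⟩, hcr, h⟩ := hψ i (χ i s) (χ i t)
    rw [abs_le] at hcr
    have h1 := hχ i s
    have h2 := hχ i t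
    simp only at h1 h2
    rw [h1, h2] at h
    exact ⟨c⁻¹, hc, ⟨inv_anti₀ hc0 (by linarith), inv_anti₀ (hεr i) (by linarith)⟩,
      by rw [h]; field_simp⟩
  choose sl hsl hslr hsl' using hχs
  -- With X_i = χ_i(L + τ/p_i) the balancing equations hold for any L. The remaining condition Σ X_i
  -- = τ is one scalar equation, solvable because its left side increases in L with slope bounded
  -- below.
  have hsolve : ∀ τ, ∃ L, ∑ i, χ i (L + τ / p i) = τ := by
    intro τ
    refine HasSlopes.surjective (f := fun L => ∑ i, χ i (L + τ / p i))
      (a := ∑ i, (r i + ε)⁻¹) (b := ∑ i, (r i - ε)⁻¹) (fun x y => ?_) ?_ τ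
    · refine ⟨∑ i, sl i (x + τ / p i) (y + τ / p i), ⟨?_, ?_⟩, ?_⟩
      · exact Finset.sum_le_sum fun i _ => (hslr i _ _).1
      · exact Finset.sum_le_sum fun i _ => (hslr i _ _).2
      · rw [← Finset.sum_sub_distrib, Finset.sum_mul]
        refine Finset.sum_congr rfl fun i _ => ?_
        rw [hsl']; ring
    · exact Finset.sum_pos (fun i _ => inv_pos.2 (by linarith [hr i])) ⟨⟨0, hn⟩, Finset.mem_univ _⟩
  choose ell hell using hsolve
  have hinc : ∀ s t, ∃ c : Fin n → ℝ, (∀ i, |c i - 1 / r i| ≤ η) ∧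
      ell t - ell s = (1 - ∑ i, c i / p i) / (∑ i, c i) * (t - s) ∧
      ∀ j, χ j (ell t + t / p j) - χ j (ell s + s / p j) =
        c j * ((1 - ∑ i, c i / p i) / ∑ i, c i + 1 / p j) * (t - s) := by
    intro s t
    set c : Fin n → ℝ := fun i => sl i (ell s + s / p i) (ell t + t / p i) with hc
    have hcη : ∀ i, |c i - 1 / r i| ≤ η := fun i => hsl i _ _
    have hstep : ∀ i, χ i (ell t + t / p i) - χ i (ell s + s / p i) =
        c i * ((ell t + t / p i) - (ell s + s / p i)) := fun i => hsl' i _ _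
    have hpos := (hslope c hcη).1
    -- Differencing the constraint Σ X_i = τ gives a linear equation for the increment of `ell`.
    have hsum : t - s = (∑ i, c i) * (ell t - ell s) + (∑ i, c i / p i) * (t - s) := by
      conv_lhs => rw [← hell t, ← hell s, ← Finset.sum_sub_distrib]
      rw [Finset.sum_mul, Finset.sum_mul, ← Finset.sum_add_distrib]
      refine Finset.sum_congr rfl fun i _ => ?_
      rw [hstep]; ring
    have hell' : ell t - ell s = (1 - ∑ i, c i / p i) / (∑ i, c i) * (t - s) := by
      field_simp
      linarith
    refine ⟨c, hcη, hell', fun j => ?_⟩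
    rw [hstep]
    have : ell t + t / p j - (ell s + s / p j) = (ell t - ell s) + 1 / p j * (t - s) := by ring
    rw [this, hell']; ring
  refine ⟨fun i τ => χ i (ell τ + τ / p i), ell, hell, fun i τ => hχ i _, fun j s t => ?_,
    fun s t => ?_⟩
  · obtain ⟨c, hc, _, h⟩ := hinc s t
    have := (hslope c hc).2.2 j
    rw [abs_le] at this
    exact ⟨_, ⟨by linarith, by linarith⟩, h j⟩
  · obtain ⟨c, hc, h, _⟩ := hinc s t
    have := (hslope c hc).2.1
    rw [abs_le] at this
    exact ⟨_, ⟨by linarith, by linarith⟩, h⟩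

end

/-! ### Hölder's inequality, changes of variable and absorption -/

section

theorem prod_rpow_eq_rpow_sum {ι : Type*} (s : Finset ι) (N : ℝ≥0∞) {x : ι → ℝ}
    (hx : ∀ i ∈ s, 0 ≤ x i) : ∏ i ∈ s, N ^ x i = N ^ ∑ i ∈ s, x i := by
  classical
  induction s using Finset.induction_on with
  | empty => simp
  | insert a s ha ih =>
    rw [Finset.prod_insert ha, Finset.sum_insert ha, ih fun i hi => hx i (by simp [hi]),
      ENNReal.rpow_add_of_nonneg _ _ (hx a (by simp))
        (Finset.sum_nonneg fun i hi => hx i (by simp [hi]))]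

/-- Hölder's inequality for a weighted geometric mean of several functions. -/
theorem eLpNorm_prod_rpow_le {ι : Type*} [Fintype ι] {F : ι → ℝ → ℝ≥0∞}
    (hF : ∀ i, Measurable (F i)) {e : ι → ℝ} (he : ∀ i, 0 < e i) (hsum : ∑ i, e i = 1)
    {θ : ι → ℝ≥0∞} (hθ : ∀ i, 1 ≤ θ i) {θ' : ℝ≥0∞}
    (hθ' : θ'⁻¹ = ∑ i, ENNReal.ofReal (e i) * (θ i)⁻¹) {N : ℝ≥0∞}
    (hN : ∀ i, eLpNorm (F i) (θ i) volume ≤ N) :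
    eLpNorm (fun x => ∏ i, F i x ^ e i) θ' volume ≤ N := by
  have hNp : ∏ i, N ^ e i = N := by
    rw [prod_rpow_eq_rpow_sum _ _ fun i _ => (he i).le, hsum, ENNReal.rpow_one]
  rcases eq_or_ne θ' ∞ with rfl | htop
  · have hinf : ∀ i, θ i = ∞ := by
      intro i
      rw [ENNReal.inv_top, eq_comm, Finset.sum_eq_zero_iff] at hθ'
      have := hθ' i (Finset.mem_univ i)
      rcases mul_eq_zero.1 this with h | h
      · exact absurd (ENNReal.ofReal_eq_zero.1 h) (not_le.2 (he i))
      · exact ENNReal.inv_eq_zero.1 h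
    rw [eLpNorm_exponent_top]
    refine eLpNormEssSup_le_of_ae_enorm_bound ?_
    have hae : ∀ᵐ x, ∀ i, F i x ≤ N := by
      rw [ae_all_iff]
      intro i
      have h := hN i
      rw [hinf i, eLpNorm_exponent_top] at h
      filter_upwards [ae_le_eLpNormEssSup (f := F i) (μ := volume)] with x hx
      exact le_trans hx h
    filter_upwards [hae] with x hx
    rw [enorm_eq_self]
    calc _ ≤ ∏ i, N ^ e i := Finset.prod_le_prod' fun i _ =>
          ENNReal.rpow_le_rpow (hx i) (he i).le
      _ = N := hNp
  have hinv : ∀ i, (θ i)⁻¹ ≠ ∞ := fun i =>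
    ENNReal.inv_ne_top.2 (zero_lt_one.trans_le (hθ i)).ne'
  have hθ0 : θ' ≠ 0 := by
    rintro rfl
    rw [ENNReal.inv_zero, eq_comm, ENNReal.sum_eq_top] at hθ'
    obtain ⟨i, _, hi⟩ := hθ'
    exact ENNReal.mul_ne_top ENNReal.ofReal_ne_top (hinv i) hi
  set s := θ'.toReal with hs
  have hs0 : 0 < s := ENNReal.toReal_pos hθ0 htop
  -- The Hölder weights e_i θ'/θ_i. If θ_i = ∞, then `toReal` is 0 and so is its inverse: the weight
  -- is 0, as it should be, and the i-th factor is instead bounded pointwise through M.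
  set w : ι → ℝ := fun i => e i * s * (θ i).toReal⁻¹ with hw
  have hw0 : ∀ i, 0 ≤ w i := fun i =>
    mul_nonneg (mul_nonneg (he i).le hs0.le) (inv_nonneg.2 ENNReal.toReal_nonneg)
  have hwsum : ∑ i, w i = 1 := by
    have h := congrArg ENNReal.toReal hθ'
    rw [ENNReal.toReal_inv, ENNReal.toReal_sum fun i _ =>
      ENNReal.mul_ne_top ENNReal.ofReal_ne_top (hinv i)] at h
    simp only [ENNReal.toReal_mul, ENNReal.toReal_inv] at h
    have h2 : ∑ i, w i = s * ∑ i, (ENNReal.ofReal (e i)).toReal * (θ i).toReal⁻¹ := by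
      rw [Finset.mul_sum]
      refine Finset.sum_congr rfl fun i _ => ?_
      rw [ENNReal.toReal_ofReal (he i).le]; ring
    rw [h2, ← h, mul_inv_cancel₀ hs0.ne']
  classical
  set M : ι → ℝ≥0∞ := fun i => if θ i = ∞ then N ^ (e i * s) else 1 with hM
  set G : ι → ℝ → ℝ≥0∞ := fun i x => if θ i = ∞ then 1 else F i x ^ (θ i).toReal with hG
  have hpt : ∀ᵐ x, ∀ i, F i x ^ (e i * s) ≤ M i * G i x ^ w i := by
    rw [ae_all_iff]
    intro i
    by_cases hi : θ i = ∞
    · have h := hN i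
      rw [hi, eLpNorm_exponent_top] at h
      filter_upwards [ae_le_eLpNormEssSup (f := F i) (μ := volume)] with x hx
      simp only [hM, hG, hi, if_true, ENNReal.one_rpow, mul_one]
      exact ENNReal.rpow_le_rpow (le_trans hx h) (mul_pos (he i) hs0).le
    · filter_upwards with x
      simp only [hM, hG, hi, if_false, one_mul]
      rw [← ENNReal.rpow_mul]
      have : (θ i).toReal ≠ 0 :=
        (ENNReal.toReal_pos (zero_lt_one.trans_le (hθ i)).ne' hi).ne'
      refine le_of_eq ?_
      congr 1
      rw [hw]; field_simp
  have hGm : ∀ i, AEMeasurable (G i) volume := fun i => by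
    by_cases hi : θ i = ∞
    · simp only [hG, hi, if_true]; exact aemeasurable_const
    · simp only [hG, hi, if_false]; exact ((hF i).pow_const _).aemeasurable
  have hbound : ∀ i, M i * (∫⁻ x, G i x) ^ w i ≤ N ^ (e i * s) := by
    intro i
    by_cases hi : θ i = ∞
    · simp [hM, hw, hi]
    · have hpos := ENNReal.toReal_pos (zero_lt_one.trans_le (hθ i)).ne' hi
      have h := hN i
      rw [eLpNorm_eq_lintegral_rpow_enorm_toReal (zero_lt_one.trans_le (hθ i)).ne' hi] at h
      simp only [enorm_eq_self] at h
      simp only [hM, hG, hi, if_false, one_mul]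
      have h2 := ENNReal.rpow_le_rpow h (mul_pos (he i) hs0).le
      rw [← ENNReal.rpow_mul] at h2
      convert h2 using 2
      rw [hw]; field_simp
  rw [eLpNorm_eq_lintegral_rpow_enorm_toReal hθ0 htop, ← hs]
  have hmain : ∫⁻ x, ‖∏ i, F i x ^ e i‖ₑ ^ s ≤ N ^ s := by
    calc ∫⁻ x, ‖∏ i, F i x ^ e i‖ₑ ^ s ≤ ∫⁻ x, (∏ i, M i) * ∏ i, G i x ^ w i := by
          refine lintegral_mono_ae ?_
          filter_upwards [hpt] with x hx
          rw [enorm_eq_self, ← ENNReal.prod_rpow_of_nonneg hs0.le, ← Finset.prod_mul_distrib]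
          refine Finset.prod_le_prod' fun i _ => ?_
          rw [← ENNReal.rpow_mul]
          exact hx i
      _ ≤ (∏ i, M i) * ∏ i, (∫⁻ x, G i x) ^ w i := by
          rw [lintegral_const_mul'' _ (Finset.aemeasurable_fun_prod _ fun i _ =>
            (hGm i).pow_const _)]
          gcongr
          exact ENNReal.lintegral_prod_norm_pow_le _ (fun i _ => hGm i) hwsum fun i _ => hw0 i
      _ ≤ ∏ i, N ^ (e i * s) := by
          rw [← Finset.prod_mul_distrib]
          exact Finset.prod_le_prod' fun i _ => hbound i
      _ = N ^ s := by
          rw [prod_rpow_eq_rpow_sum _ _ fun i _ => (mul_pos (he i) hs0).le, ← Finset.sum_mul,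
            hsum, one_mul]
  calc _ ≤ (N ^ s) ^ (1 / s) := by gcongr
    _ = N := by rw [← ENNReal.rpow_mul, mul_one_div_cancel hs0.ne', ENNReal.rpow_one]

theorem HasSlopes.comp {f g : ℝ → ℝ} {a b a' b' : ℝ} (hf : HasSlopes f a b)
    (hg : HasSlopes g a' b') (ha : 0 ≤ a) (ha' : 0 ≤ a') :
    HasSlopes (f ∘ g) (a * a') (b * b') := fun x y => by
  obtain ⟨c', hc', h'⟩ := hg x y
  obtain ⟨c, hc, h⟩ := hf (g x) (g y)
  refine ⟨c * c', ⟨mul_le_mul hc.1 hc'.1 ha' (ha.trans hc.1),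
    mul_le_mul hc.2 hc'.2 (ha'.trans hc'.1) (ha.trans (hc.1.trans hc.2))⟩, ?_⟩
  simp only [Function.comp]
  rw [h, h', mul_assoc]

theorem HasSlopes.rightInverse {f g : ℝ → ℝ} {a b : ℝ} (hf : HasSlopes f a b) (ha : 0 < a)
    (hg : ∀ x, f (g x) = x) : HasSlopes g b⁻¹ a⁻¹ := fun x y => by
  obtain ⟨c, hc, h⟩ := hf (g x) (g y)
  have hc0 : 0 < c := by linarith [hc.1]
  rw [hg, hg] at h
  refine ⟨c⁻¹, ⟨inv_anti₀ hc0 hc.2, inv_anti₀ ha hc.1⟩, ?_⟩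
  rw [h]; field_simp

/-- Slopes bounded below by a make the image of Lebesgue measure under S at most 1/a times Lebesgue
measure. The constant 1 + 1/a exceeds 1, so it dominates its own power 1/θ and serves all θ at once.
-/
theorem eLpNorm_comp_le_of_hasSlopes {a b : ℝ} (ha : 0 < a) : ∃ C : ℝ≥0, ∀ S : ℝ → ℝ,
    HasSlopes S a b → ∀ F : ℝ → ℝ≥0∞, Measurable F → ∀ θ : ℝ≥0∞, 1 ≤ θ →
      eLpNorm (fun x => F (S x)) θ volume ≤ C * eLpNorm F θ volume := by
  set K : ℝ≥0 := (Real.toNNReal a)⁻¹ with hK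
  refine ⟨1 + K, fun S hS F hF θ hθ => ?_⟩
  have hanti : AntilipschitzWith K S := by
    refine AntilipschitzWith.of_le_mul_dist fun x y => ?_
    obtain ⟨c, hc, hxy⟩ := hS y x
    rw [Real.dist_eq, Real.dist_eq, hxy, abs_mul, abs_of_pos (by linarith [hc.1] : 0 < c), hK,
      NNReal.coe_inv, Real.coe_toNNReal _ ha.le, ← mul_assoc]
    refine le_mul_of_one_le_left (abs_nonneg _) ?_
    rw [inv_mul_eq_div, one_le_div ha]; exact hc.1
  have hSm : Measurable S := (hS.continuous ha).measurable
  have hmap : Measure.map S volume ≤ ((1 + K : ℝ≥0) : ℝ≥0∞) • volume := by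
    refine Measure.le_iff.2 fun s hs => ?_
    rw [Measure.map_apply hSm hs, Measure.smul_apply, smul_eq_mul]
    have h := hanti.hausdorffMeasure_preimage_le zero_le_one s
    rw [hausdorffMeasure_real, ENNReal.rpow_one] at h
    refine h.trans ?_
    gcongr
    exact le_add_self
  have h1 : eLpNorm (fun x => F (S x)) θ volume = eLpNorm F θ (Measure.map S volume) :=
    (eLpNorm_map_measure hF.aestronglyMeasurable hSm.aemeasurable).symm
  rw [h1]
  refine (eLpNorm_mono_measure F hmap).trans ?_
  rw [eLpNorm_smul_measure_of_ne_zero (by simp), smul_eq_mul]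
  gcongr
  calc ((1 + K : ℝ≥0) : ℝ≥0∞) ^ (1 / θ).toReal ≤ ((1 + K : ℝ≥0) : ℝ≥0∞) ^ (1 : ℝ) := by
        refine ENNReal.rpow_le_rpow_of_exponent_le (by exact_mod_cast le_self_add) ?_
        rw [← ENNReal.toReal_one]
        refine ENNReal.toReal_mono ENNReal.one_ne_top ?_
        rw [one_div]; exact ENNReal.inv_le_one.2 hθ
    _ = _ := ENNReal.rpow_one _

variable {𝕜 : Type*} [RCLike 𝕜] {n : ℕ}

theorem lorentzSum_diff_le_of_add (j : Fin n) {k : ℕ} (hk : k ≠ 0) {q κ : ℝ} (hq : 1 ≤ q)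
    (hκ : κ < k) (d : ℕ) (C : ℝ≥0) : ∃ C' : ℝ≥0, ∀ f : (Fin n → ℝ) → 𝕜, MemS0 f →
      ∀ F : ℝ → ℝ≥0∞, (∀ x d, 0 ≤ d → F (x + d) ≤ expE (κ * d) * F x) →
      (∀ x, lorentzSum q (diff j (k + d) (Real.exp x) f) ≤ C * F x) →
      ∀ x, lorentzSum q (diff j k (Real.exp x) f) ≤ C' * F x := by
  induction d generalizing C with
  | zero => exact ⟨C, fun f _ F _ h => h⟩
  | succ d ih =>
    obtain ⟨C₁, h₁⟩ := lorentzSum_diff_le_of_succ (𝕜 := 𝕜) j (k := k + d) (by lia) hq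
      (κ := κ) (by push_cast; linarith [Nat.cast_nonneg (α := ℝ) d]) C
    obtain ⟨C₂, h₂⟩ := ih C₁
    exact ⟨C₂, fun f hf F hF h => h₂ f hf F hF (h₁ f hf F hF h)⟩

/-- Summation of the rearrangement estimates: small values of `t` by absorption, large values of
`t` by Chebyshev's inequality. -/
theorem lorentzSum_le_of_absorption {p q γ : ℝ} (hp : 0 < p) (hpq : p < q) (hγ : 0 < γ) {s : ℕ}
    {C₀ : ℝ≥0∞} (hC₀ : C₀ * expE (-(s / q)) ≤ 2⁻¹) : ∃ C : ℝ≥0, ∀ (g : (Fin n → ℝ) → 𝕜)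
    (ell : ℝ → ℝ) (B N : ℝ≥0∞),
    (∀ τ, decrRearr g (expE τ) ≤ C₀ * decrRearr g (expE (τ + s)) + B * expE (ell τ)) →
    (∀ τ, decrRearr g (expE τ) ≠ ∞) →
    (∀ τ, decrRearr g (expE τ) ≤ expE (-τ / p) * N) →
    (∀ τ τ', τ ≤ τ' → τ / q + ell τ ≤ τ' / q + ell τ' - γ * (τ' - τ)) →
    ∀ τ, lorentzSum q g ≤ C * (B * expE (τ / q + ell τ) + expE (τ / q - τ / p) * N) := by
  have hq : 0 < q := hp.trans hpq
  have hγ' : 0 < 1 / p - 1 / q := sub_pos.2 (one_div_lt_one_div_of_lt hp hpq)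
  have hS₁ := tsum_expE_neg_mul_lt_top hγ
  have hS₂ := tsum_expE_neg_mul_lt_top hγ'
  set S₁ := ∑' i : ℕ, expE (-(γ * i)) with hS₁d
  set S₂ := ∑' i : ℕ, expE (-((1 / p - 1 / q) * i)) with hS₂d
  refine ⟨(2 * S₁ + 2 * S₂).toNNReal, fun g ell B N hrec hfin hcheb hell τ => ?_⟩
  rw [ENNReal.coe_toNNReal (by finiteness)]
  set b : ℤ → ℝ≥0∞ := fun ν => expE (ν / q) * decrRearr g (expE ν) with hb
  set ν₀ : ℤ := ⌊τ⌋ with hν₀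
  have hν₁ : (ν₀ : ℝ) ≤ τ := Int.floor_le τ
  have hν₂ : τ < ν₀ + 1 := Int.lt_floor_add_one τ
  set Tail := ∑' i : ℕ, b (ν₀ + 1 + i) with hTail
  have hsplit : lorentzSum q g = Tail + ∑' i : ℕ, b (ν₀ - i) := by
    have h1 : lorentzSum q g = ∑' ν : ℤ, b (ν + (ν₀ + 1)) :=
      ((Equiv.addRight (ν₀ + 1)).tsum_eq b).symm
    have h2 := HasSum.of_nat_of_neg_add_one (f := fun ν : ℤ => b (ν + (ν₀ + 1)))
      (ENNReal.summable.hasSum) (ENNReal.summable.hasSum)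
    rw [h1, h2.tsum_eq, hTail]
    congr 1
    · exact tsum_congr fun i => by congr 1; ring
    · exact tsum_congr fun i => by congr 1; ring
  have hTail_le : Tail ≤ S₂ * (expE (τ / q - τ / p) * N) := by
    rw [hTail, hS₂d, ← ENNReal.tsum_mul_right]
    refine ENNReal.tsum_le_tsum fun i => ?_
    refine (mul_le_mul' le_rfl (hcheb _)).trans ?_
    rw [← mul_assoc, ← mul_assoc, ← expE_add, ← expE_add]
    gcongr
    refine expE_mono ?_
    push_cast
    have : ((ν₀ : ℝ) + 1 + i) / q + -((ν₀ : ℝ) + 1 + i) / p =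
      -((1 / p - 1 / q) * i) + -((1 / p - 1 / q) * (ν₀ + 1)) := by field_simp; ring
    rw [this]
    have h3 : (1 / p - 1 / q) * τ ≤ (1 / p - 1 / q) * (ν₀ + 1) := by gcongr
    have h4 : τ / q - τ / p = -((1 / p - 1 / q) * τ) := by field_simp; ring
    linarith
  set E := S₁ * (B * expE (τ / q + ell τ)) with hE
  have hstep : ∀ i : ℕ, b (ν₀ - i) ≤ 2⁻¹ * b (ν₀ - i + s) +
      expE (-(γ * i)) * (B * expE (τ / q + ell τ)) := by
    intro i
    have h := hrec ((ν₀ - i : ℤ) : ℝ)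
    simp only [hb]
    refine (mul_le_mul' le_rfl h).trans ?_
    rw [mul_add]
    refine add_le_add ?_ ?_
    · calc expE (((ν₀ - i : ℤ) : ℝ) / q) * (C₀ * decrRearr g (expE (((ν₀ - i : ℤ) : ℝ) + s)))
          = (C₀ * expE (-(s / q))) * (expE (((ν₀ - i + s : ℤ) : ℝ) / q) *
              decrRearr g (expE (((ν₀ - i + s : ℤ) : ℝ)))) := by
            have h5 : expE (((ν₀ - i : ℤ) : ℝ) / q) =
                expE (-(s / q)) * expE (((ν₀ - i + s : ℤ) : ℝ) / q) := by
              rw [← expE_add]; congr 1; push_cast; ring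
            rw [h5]
            push_cast
            ring
        _ ≤ _ := by gcongr
    · rw [mul_left_comm, ← expE_add, mul_left_comm (expE (-(γ * i))), ← expE_add]
      gcongr
      refine expE_mono ?_
      have h6 := hell ((ν₀ - i : ℤ) : ℝ) τ (by push_cast; linarith [Nat.cast_nonneg (α := ℝ) i])
      have h7 : γ * i ≤ γ * (τ - ((ν₀ - i : ℤ) : ℝ)) := by
        gcongr; push_cast; linarith
      linarith
  -- Absorption requires a finite quantity, so it is carried out on partial sums, with a bound
  -- independent of R.
  have hpart : ∀ R : ℕ, ∑ i ∈ Finset.range R, b (ν₀ - i) ≤ Tail + 2 * E := by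
    intro R
    set H := ∑ i ∈ Finset.range R, b (ν₀ - i) with hH
    have hHfin : H ≠ ∞ := ENNReal.sum_ne_top.2 fun i _ =>
      ENNReal.mul_ne_top (expE_ne_top _) (hfin _)
    -- Shifting the indices up by s moves at most s of them past ν₀ into the tail; the others stay
    -- among those of H.
    have h1 : ∑ i ∈ Finset.range R, b (ν₀ - i + s) ≤ Tail + H := by
      calc ∑ i ∈ Finset.range R, b (ν₀ - i + s)
          ≤ ∑ i ∈ Finset.range (s + R), b (ν₀ - i + s) :=
            Finset.sum_le_sum_of_subset (Finset.range_mono (by lia))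
        _ = ∑ i ∈ Finset.range s, b (ν₀ - i + s) + H := by
            rw [Finset.sum_range_add]
            congr 1
            refine Finset.sum_congr rfl fun i _ => ?_
            congr 1; push_cast; ring
        _ ≤ Tail + H := by
            gcongr
            rw [← Finset.sum_range_reflect]
            refine le_trans (le_of_eq (Finset.sum_congr rfl fun i hi => ?_))
              (ENNReal.sum_le_tsum (Finset.range s))
            have := Finset.mem_range.1 hi
            congr 1
            lia
    have h2 : H ≤ 2⁻¹ * (Tail + H) + E := by
      calc H ≤ ∑ i ∈ Finset.range R, (2⁻¹ * b (ν₀ - i + s) +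
            expE (-(γ * i)) * (B * expE (τ / q + ell τ))) := Finset.sum_le_sum fun i _ => hstep i
        _ ≤ _ := by
            rw [Finset.sum_add_distrib, ← Finset.mul_sum, ← Finset.sum_mul]
            refine add_le_add (mul_le_mul' le_rfl h1) (mul_le_mul' ?_ le_rfl)
            exact ENNReal.sum_le_tsum _
    have h3 : H + H ≤ H + (Tail + 2 * E) := by
      calc H + H = 2 * H := (two_mul H).symm
        _ ≤ 2 * (2⁻¹ * (Tail + H) + E) := by gcongr
        _ = _ := by
            rw [mul_add, ← mul_assoc, ENNReal.mul_inv_cancel (by simp) (by simp)]; ring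
    exact (ENNReal.add_le_add_iff_left hHfin).1 h3
  rw [hsplit]
  calc Tail + ∑' i : ℕ, b (ν₀ - i) ≤ Tail + (Tail + 2 * E) := by
        gcongr
        exact ENNReal.tsum_le_of_sum_range_le hpart
    _ = 2 * E + 2 * Tail := by ring
    _ ≤ 2 * E + 2 * (S₂ * (expE (τ / q - τ / p) * N)) := by gcongr
    _ ≤ _ := by
        rw [hE]
        calc _ = 2 * S₁ * (B * expE (τ / q + ell τ)) + 2 * S₂ * (expE (τ / q - τ / p) * N) := by
              ring
          _ ≤ (2 * S₁ + 2 * S₂) * (B * expE (τ / q + ell τ)) +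
                (2 * S₁ + 2 * S₂) * (expE (τ / q - τ / p) * N) := by
              gcongr
              · exact le_self_add
              · exact le_add_self
          _ = _ := by ring

end

/-! ### Exponents and the fundamental estimate -/

section

variable {𝕜 : Type*} [RCLike 𝕜] {n : ℕ}

section Exponents

variable {r p q : Fin n → ℝ} {θ : Fin n → ℝ≥0∞}

/-- The limiting smoothness `r/n - 1/p`. -/
noncomputable def rhoExp (r p : Fin n → ℝ) : ℝ := meanR r / n - 1 / meanP r p

/-- The weight of the `i`-th modulus of smoothness in the estimate for the direction `j`. -/
noncomputable def mixWeight (r p q : Fin n → ℝ) (j i : Fin n) : ℝ :=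
  (1 - kappa r p q j) * (meanR r / n / r i) + if i = j then kappa r p q j else 0

theorem beta_mul (hr : ∀ j, 0 < r j) (j : Fin n) : beta r p j * r j = rhoExp r p + 1 / p j := by
  have := (hr j).ne'
  rw [beta, rhoExp]; field_simp; ring

/-- Equivalently 1/q_j = ϰ_j/p_j - (1 - ϰ_j) ρ: the number ϰ_j interpolates between the limiting
exponent -ρ and 1/p_j. The bounds 0 < ϰ_j < 1 follow from it. -/
theorem kappa_identity (hr : ∀ j, 0 < r j) (hβ : ∀ j, 0 < beta r p j) (j : Fin n) :
    (1 - kappa r p q j) * (rhoExp r p + 1 / p j) = 1 / p j - 1 / q j := by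
  have h1 : rhoExp r p + 1 / p j ≠ 0 := by
    rw [← beta_mul hr]; exact (mul_pos (hβ j) (hr j)).ne'
  rw [kappa, beta_mul hr]
  field_simp
  ring

theorem kappa_pos (hr : ∀ j, 0 < r j) (hβ : ∀ j, 0 < beta r p j)
    (hq : ∀ j, 1 / meanP r p - meanR r / n < 1 / q j) (j : Fin n) : 0 < kappa r p q j := by
  have h1 : 0 < rhoExp r p + 1 / p j := by
    rw [← beta_mul hr]; exact mul_pos (hβ j) (hr j)
  have h2 := kappa_identity (q := q) hr hβ j
  have h3 := hq j
  by_contra hc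
  push Not at hc
  have : rhoExp r p + 1 / p j ≤ (1 - kappa r p q j) * (rhoExp r p + 1 / p j) :=
    le_mul_of_one_le_left h1.le (by linarith)
  rw [h2, rhoExp] at this
  linarith

theorem kappa_lt_one (hr : ∀ j, 0 < r j) (hβ : ∀ j, 0 < beta r p j) (hp : ∀ j, 1 ≤ p j)
    (hpq : ∀ j, p j < q j) (j : Fin n) : kappa r p q j < 1 := by
  have h1 : 0 < rhoExp r p + 1 / p j := by
    rw [← beta_mul hr]; exact mul_pos (hβ j) (hr j)
  have h2 := kappa_identity (q := q) hr hβ j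
  have h3 : 1 / q j < 1 / p j := one_div_lt_one_div_of_lt (by linarith [hp j]) (hpq j)
  by_contra hc
  push Not at hc
  have := mul_nonpos_of_nonpos_of_nonneg (by linarith : 1 - kappa r p q j ≤ 0) h1.le
  linarith

theorem alpha_pos (hr : ∀ j, 0 < r j) (hβ : ∀ j, 0 < beta r p j)
    (hq : ∀ j, 1 / meanP r p - meanR r / n < 1 / q j) (j : Fin n) : 0 < alpha r p q j :=
  mul_pos (kappa_pos hr hβ hq j) (hr j)

theorem alpha_lt (hr : ∀ j, 0 < r j) (hβ : ∀ j, 0 < beta r p j) (hp : ∀ j, 1 ≤ p j)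
    (hpq : ∀ j, p j < q j) (j : Fin n) : alpha r p q j < r j :=
  mul_lt_of_lt_one_left (hr j) (kappa_lt_one hr hβ hp hpq j)

/-- Explains the choice of α_j: in the unperturbed case x = β_j τ and the bound e^{τ/q_j + ρτ} is
e^{α_j x}. -/
theorem alpha_mul_beta (hr : ∀ j, 0 < r j) (hβ : ∀ j, 0 < beta r p j) (j : Fin n) :
    alpha r p q j * beta r p j = 1 / q j + rhoExp r p := by
  have h1 := beta_mul (p := p) hr j
  have h2 := kappa_identity (q := q) hr hβ j
  rw [alpha, mul_assoc, mul_comm (r j), h1]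
  linarith

theorem meanR_pos (hn : 1 ≤ n) (hr : ∀ j, 0 < r j) : 0 < meanR r := by
  rw [meanR]
  have : 0 < ∑ j, 1 / r j :=
    Finset.sum_pos (fun i _ => one_div_pos.2 (hr i)) ⟨⟨0, hn⟩, Finset.mem_univ _⟩
  positivity

theorem meanR_div_sum (hn : 1 ≤ n) (hr : ∀ j, 0 < r j) : ∑ i, meanR r / n / r i = 1 := by
  have h1 : 0 < ∑ j, 1 / r j :=
    Finset.sum_pos (fun i _ => one_div_pos.2 (hr i)) ⟨⟨0, hn⟩, Finset.mem_univ _⟩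
  have hn0 : (n : ℝ) ≠ 0 := by positivity
  have h2 : ∑ i, meanR r / n / r i = meanR r / n * ∑ i, 1 / r i := by
    rw [Finset.mul_sum]; exact Finset.sum_congr rfl fun i _ => by ring
  rw [h2, meanR]
  field_simp

theorem mixWeight_pos (hn : 1 ≤ n) (hr : ∀ j, 0 < r j) (hβ : ∀ j, 0 < beta r p j)
    (hp : ∀ j, 1 ≤ p j) (hpq : ∀ j, p j < q j)
    (hq : ∀ j, 1 / meanP r p - meanR r / n < 1 / q j) (j i : Fin n) :
    0 < mixWeight r p q j i := by
  have h1 := kappa_pos hr hβ hq j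
  have h2 := kappa_lt_one hr hβ hp hpq j
  have h3 : 0 < meanR r / n / r i :=
    div_pos (div_pos (meanR_pos hn hr) (by positivity)) (hr i)
  have h4 := mul_pos (by linarith : 0 < 1 - kappa r p q j) h3
  rw [mixWeight]
  split_ifs <;> linarith

theorem mixWeight_sum (hn : 1 ≤ n) (hr : ∀ j, 0 < r j) (j : Fin n) :
    ∑ i, mixWeight r p q j i = 1 := by
  simp only [mixWeight]
  rw [Finset.sum_add_distrib, ← Finset.mul_sum, meanR_div_sum hn hr]
  simp

/-- The exponents of a balanced family combine to the target smoothness. -/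
theorem balanced_exponent (hn : 1 ≤ n) (hr : ∀ j, 0 < r j)
    (hβ : ∀ j, 0 < beta r p j) {X A : Fin n → ℝ} {τ L : ℝ}
    (hX : ∑ i, X i = τ) (hbal : ∀ i, r i * X i + A i = L + τ / p i) (j : Fin n) :
    τ / q j + L = alpha r p q j * X j + ∑ i, mixWeight r p q j i * A i := by
  have hn0 : (n : ℝ) ≠ 0 := by positivity
  have hP : 1 / meanP r p = meanR r / n * ∑ i, 1 / (p i * r i) := by
    rw [meanP, one_div, mul_inv, inv_inv, inv_div]
  -- Averaging the balancing equations with weights proportional to 1/r_i turns the X_i into their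
  -- sum τ and leaves only L.
  have hL : ∑ i, meanR r / n / r i * A i = L - rhoExp r p * τ := by
    have h1 : ∀ i, meanR r / n / r i * A i =
        meanR r / n / r i * L + meanR r / n * (1 / (p i * r i)) * τ - meanR r / n * X i := by
      intro i
      have h2 : A i = L + τ / p i - r i * X i := by linarith [hbal i]
      have := (hr i).ne'
      rw [h2]
      field_simp
    rw [Finset.sum_congr rfl fun i _ => h1 i, Finset.sum_sub_distrib, Finset.sum_add_distrib,
      ← Finset.sum_mul, ← Finset.sum_mul, ← Finset.mul_sum, ← Finset.mul_sum, hX,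
      meanR_div_sum hn hr, rhoExp, hP]
    ring
  have hmix : ∑ i, mixWeight r p q j i * A i =
      (1 - kappa r p q j) * ∑ i, meanR r / n / r i * A i + kappa r p q j * A j := by
    simp only [mixWeight, add_mul]
    rw [Finset.sum_add_distrib, Finset.mul_sum]
    congr 1
    · exact Finset.sum_congr rfl fun i _ => by ring
    · simp
  rw [hmix, hL, alpha]
  have hid := kappa_identity (q := q) hr hβ j
  have h3 : A j = L + τ / p j - r j * X j := by linarith [hbal j]
  rw [h3]
  have h4 : τ / q j = τ * (1 / p j - (1 - kappa r p q j) * (rhoExp r p + 1 / p j)) := by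
    rw [hid]; ring
  rw [h4]
  ring

/-- Since 1/θ is the average of the 1/θ_i with weights (r/n)/r_i, the exponent θ'_j is the one that
Hölder's inequality yields for the weights `mixWeight`. The computation in [0, ∞] includes θ_i = ∞.
-/
theorem theta'_inv (hn : 1 ≤ n) (hr : ∀ j, 0 < r j) (hβ : ∀ j, 0 < beta r p j)
    (hp : ∀ j, 1 ≤ p j) (hpq : ∀ j, p j < q j)
    (hq : ∀ j, 1 / meanP r p - meanR r / n < 1 / q j) (j : Fin n) :
    (theta' r p q θ j)⁻¹ = ∑ i, ENNReal.ofReal (mixWeight r p q j i) * (θ i)⁻¹ := by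
  have h1 := kappa_pos hr hβ hq j
  have h2 := kappa_lt_one hr hβ hp hpq j
  have hR := meanR_pos hn hr
  have hnR : 0 < (n : ℝ) / meanR r := by positivity
  have hT : (meanTheta r θ)⁻¹ = ∑ i, ENNReal.ofReal (meanR r / n / r i) * (θ i)⁻¹ := by
    rw [meanTheta, ENNReal.mul_inv (Or.inl (by simpa using hnR)) (Or.inl ENNReal.ofReal_ne_top),
      inv_inv, ← ENNReal.ofReal_inv_of_pos hnR, inv_div, Finset.mul_sum]
    refine Finset.sum_congr rfl fun i _ => ?_
    rw [one_div, ENNReal.mul_inv (Or.inr ENNReal.ofReal_ne_top) (Or.inr (by simpa using hr i)),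
      ← ENNReal.ofReal_inv_of_pos (hr i), mul_comm (θ i)⁻¹, ← mul_assoc,
      ← ENNReal.ofReal_mul (by positivity), div_eq_mul_inv (meanR r / n)]
  rw [theta', inv_inv, div_eq_mul_inv, div_eq_mul_inv, hT, Finset.mul_sum]
  have h3 : ∀ i, ENNReal.ofReal (mixWeight r p q j i) * (θ i)⁻¹ =
      ENNReal.ofReal (1 - kappa r p q j) * (ENNReal.ofReal (meanR r / n / r i) * (θ i)⁻¹) +
      if i = j then ENNReal.ofReal (kappa r p q j) * (θ i)⁻¹ else 0 := by
    intro i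
    have h4 : 0 < meanR r / n / r i := div_pos (by positivity) (hr i)
    rw [mixWeight, ENNReal.ofReal_add (mul_nonneg (by linarith) h4.le) (by split_ifs <;> linarith),
      ENNReal.ofReal_mul (by linarith), add_mul, mul_assoc]
    congr 1
    split_ifs <;> simp
  rw [Finset.sum_congr rfl fun i _ => h3 i, Finset.sum_add_distrib]
  simp

end Exponents

/-- The modulus of smoothness in the direction `i`, as a function of the step. -/
noncomputable def dirModulus (i : Fin n) (m : ℕ) (p : ℝ) (f : (Fin n → ℝ) → 𝕜) (h : ℝ) : ℝ≥0∞ :=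
  eLpNorm (diff i m h f) (ENNReal.ofReal p) volume

theorem measurable_dirModulus (i : Fin n) (m : ℕ) {p : ℝ} (hp : 0 < p) {f : (Fin n → ℝ) → 𝕜}
    (hf : Measurable f) : Measurable (dirModulus i m p f) := by
  have : dirModulus i m p f = fun h => (∫⁻ x, ‖diff i m h f x‖ₑ ^ p) ^ (1 / p) := by
    funext h
    rw [dirModulus, eLpNorm_eq_lintegral_rpow_enorm_toReal (by simpa using hp)
      ENNReal.ofReal_ne_top, ENNReal.toReal_ofReal hp.le]
  rw [this]
  exact (Measurable.lintegral_prod_right' (f := fun z : ℝ × (Fin n → ℝ) =>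
    ‖diff i m z.1 f z.2‖ₑ ^ p) ((measurable_diff i m hf).enorm.pow_const _)).pow_const _

theorem besovDir_eq (j : Fin n) (k : ℕ) (r p : ℝ) (θ : ℝ≥0∞) (f : (Fin n → ℝ) → 𝕜) :
    besovDir j k r p θ f =
      eLpNorm (fun x => expE (-(r * x)) * dirModulus j k p f (Real.exp x)) θ volume := by
  rw [besovDir, calNorm_eq]
  congr 1
  funext x
  rw [expE, ← Real.exp_mul, dirModulus]
  congr 3
  ring

/-- The moduli of smoothness of `f` have slowly varying majorants of controlled norm. -/
theorem exists_dirModulus_majorant (i : Fin n) {m : ℕ} (hm : m ≠ 0) {r p : ℝ} (hr : 0 < r)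
    (hp : 1 ≤ p) {θ : ℝ≥0∞} (hθ : 1 ≤ θ) {ε : ℝ} (hε : 0 < ε) :
    ∃ C : ℝ≥0, ∀ f : (Fin n → ℝ) → 𝕜, Measurable f → ∀ σ : ℝ≥0, 0 < σ →
      besovDir i m r p θ f ≤ σ →
      ∃ a : ℝ → ℝ, (∀ x y, |a x - a y| ≤ ε * |x - y|) ∧
        eLpNorm (fun x => expE (a x)) θ volume ≤ C * σ ∧
        ∀ x, dirModulus i m p f (Real.exp x) ≤ C * expE (r * x + a x) := by
  obtain ⟨C₁, h₁⟩ := exists_slow_majorant hε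
  obtain ⟨C₂, h₂⟩ := le_decayConv_of_sum_le (k := m) hr.le hε.le
  refine ⟨C₁ + C₂, fun f hf σ hσ hb => ?_⟩
  have hmeas := measurable_dirModulus i m (by linarith : 0 < p) hf
  rw [besovDir_eq] at hb
  obtain ⟨a, ha, han, hac⟩ := h₁ θ hθ
    (fun x => expE (-(r * x)) * dirModulus i m p f (Real.exp x))
    ((measurable_expE.comp (by fun_prop)).mul (hmeas.comp Real.measurable_exp)) σ hσ hb
  refine ⟨a, ha, han.trans ?_, fun x => ?_⟩
  · gcongr; exact le_self_add
  · refine (h₂ _ hmeas (fun h s => ?_) x).trans ?_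
    · exact eLpNorm_diff_le_sum i hm h s hf (by simpa using hp)
    · rw [expE_add, mul_assoc]
      refine mul_le_mul' (by exact_mod_cast le_add_self) (mul_le_mul' le_rfl (hac x))

/-- The fundamental estimate: differences of sufficiently high degree are controlled by the
balanced majorants. -/
theorem lorentzSum_diff_le_of_balance (hn : 1 ≤ n) {r p : Fin n → ℝ} (hr : ∀ i, 0 < r i)
    (hp : ∀ i, 1 ≤ p i) (m : Fin n → ℕ) (j : Fin n) (k : ℕ) {q γ ε : ℝ} (hq : p j < q)
    (hγ : 0 < γ) (hε : 0 < ε) (C₁ : ℝ≥0) :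
    ∃ C : ℝ≥0, ∀ f : (Fin n → ℝ) → 𝕜, Measurable f → MemS0 f →
      ∀ (a X : Fin n → ℝ → ℝ) (ell : ℝ → ℝ), (∀ i x y, |a i x - a i y| ≤ ε * |x - y|) →
      (∀ i x, dirModulus i (m i) (p i) f (Real.exp x) ≤ C₁ * expE (r i * x + a i x)) →
      (∀ τ, ∑ i, X i τ = τ) → (∀ i τ, r i * X i τ + a i (X i τ) = ell τ + τ / p i) →
      (∀ τ τ', τ ≤ τ' → τ / q + ell τ ≤ τ' / q + ell τ' - γ * (τ' - τ)) →
      ∀ τ, lorentzSum q (diff j (k + m j) (Real.exp (X j τ)) f) ≤ C * expE (τ / q + ell τ) := by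
  have hpj : 0 < p j := by linarith [hp j]
  have hq0 : 0 < q := hpj.trans hq
  -- The shift is fixed only now; this is not circular because the factor 2^{Σ m_i} does not depend
  -- on s.
  obtain ⟨s, hs⟩ : ∃ s : ℕ, (2 : ℝ≥0∞) ^ (∑ i, m i) * expE (-(s / q)) ≤ 2⁻¹ := by
    obtain ⟨s, hs⟩ := exists_nat_ge (q * ((∑ i, m i : ℕ) + 1))
    refine ⟨s, ?_⟩
    have h2 : (2 : ℝ≥0∞) ≤ expE 1 := by
      rw [expE, ← ENNReal.ofReal_ofNat]
      exact ENNReal.ofReal_le_ofReal (by linarith [Real.add_one_le_exp (1 : ℝ)])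
    have h3 : ((∑ i, m i : ℕ) : ℝ) + 1 ≤ s / q := by
      rw [le_div_iff₀ hq0]; linarith
    calc (2 : ℝ≥0∞) ^ (∑ i, m i) * expE (-(s / q))
        ≤ expE 1 ^ (∑ i, m i) * expE (-(s / q)) := by gcongr
      _ = expE ((∑ i, m i : ℕ) - s / q) := by
          rw [← expE_natCast_mul, ← expE_add]; congr 1; ring
      _ ≤ expE (-1) := expE_mono (by linarith)
      _ ≤ 2⁻¹ := by rw [expE_neg]; exact ENNReal.inv_le_inv.2 h2
  obtain ⟨K, C₂, hK, hcore⟩ := decrRearr_le_of_diff_bounds (𝕜 := 𝕜) hn m s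
  obtain ⟨C₃, hsum⟩ := lorentzSum_le_of_absorption (𝕜 := 𝕜) (n := n) hpj hq hγ hs
  -- The logarithm of any step in (K e^X, 2K e^X) differs from X by at most D, so replacing it by X
  -- changes the i-th majorant by a factor at most e^{(r_i + ε) D}.
  set D : ℝ := |Real.log K| + Real.log 2 with hD
  have hlog2 : 0 < Real.log 2 := Real.log_pos (by norm_num)
  have hD0 : 0 ≤ D := by positivity
  set A : ℝ≥0∞ := 2 ^ (k + m j) * C₁ * ∑ i, expE ((r i + ε) * D) with hA
  have hAtop : A ≠ ∞ := ENNReal.mul_ne_top (by finiteness)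
    (ENNReal.sum_ne_top.2 fun i _ => expE_ne_top _)
  refine ⟨(C₃ * (C₂ * A + 2 ^ k * C₁)).toNNReal,
    fun f hf hfS a X ell ha hmod hX hbal hell τ => ?_⟩
  rw [ENNReal.coe_toNNReal (by finiteness)]
  set h := Real.exp (X j τ) with hh
  set g := diff j (k + m j) h f with hg
  have hgm : Measurable g := measurable_diff_right j _ h hf
  have hpE : ∀ i, (1 : ℝ≥0∞) ≤ ENNReal.ofReal (p i) := fun i => by simpa using hp i
  have hrec : ∀ τ', decrRearr g (expE τ') ≤
      2 ^ (∑ i, m i) * decrRearr g (expE (τ' + s)) + C₂ * A * expE (ell τ') := by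
    intro τ'
    refine hcore g hgm p hp τ' (ell τ') (fun i => X i τ') A (hX τ') fun i u hu => ?_
    have hu0 : 0 < u := (mul_pos hK (Real.exp_pos _)).trans hu.1
    set v := Real.log u with hv
    have huv : u = Real.exp v := (Real.exp_log hu0).symm
    have hvD : |v - X i τ'| ≤ D := by
      have h1 : Real.log K + X i τ' ≤ v := by
        rw [hv, Real.le_log_iff_exp_le hu0, Real.exp_add, Real.exp_log hK]; exact hu.1.le
      have h2 : v ≤ Real.log 2 + (Real.log K + X i τ') := by
        rw [hv, Real.log_le_iff_le_exp hu0, Real.exp_add, Real.exp_add, Real.exp_log hK,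
          Real.exp_log (by norm_num)]
        exact hu.2.le
      rw [abs_le]
      constructor
      · linarith [neg_abs_le (Real.log K)]
      · linarith [le_abs_self (Real.log K)]
    -- Differences commute, so the difference of g in direction i is a bounded operator applied to
    -- that of f.
    rw [hg, diff_comm]
    refine (eLpNorm_diff_le j _ h (measurable_diff_right i (m i) u hf) (hpE i)).trans ?_
    have h3 := hmod i v
    rw [← huv, dirModulus] at h3
    refine (mul_le_mul' le_rfl h3).trans ?_
    have h4 : r i * v + a i v ≤ (r i + ε) * D + (ell τ' + τ' / p i) := by
      rw [← hbal i τ']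
      have h5 := (abs_le.1 (ha i v (X i τ'))).2
      have h6 := le_abs_self (v - X i τ')
      have h7 : r i * (v - X i τ') ≤ r i * D := mul_le_mul_of_nonneg_left (h6.trans hvD) (hr i).le
      have h8 : ε * |v - X i τ'| ≤ ε * D := mul_le_mul_of_nonneg_left hvD hε.le
      linarith
    calc (2 : ℝ≥0∞) ^ (k + m j) * (C₁ * expE (r i * v + a i v))
        ≤ 2 ^ (k + m j) * (C₁ * (expE ((r i + ε) * D) * expE (ell τ' + τ' / p i))) := by
          rw [← expE_add]
          gcongr
          exact expE_mono h4
      _ = 2 ^ (k + m j) * C₁ * expE ((r i + ε) * D) * expE (ell τ' + τ' / p i) := by ring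
      _ ≤ A * expE (ell τ' + τ' / p i) := by
          rw [hA]
          gcongr
          exact Finset.single_le_sum (f := fun i => expE ((r i + ε) * D)) (fun _ _ => zero_le)
            (Finset.mem_univ i)
  have hfin : ∀ τ', decrRearr g (expE τ') ≠ ∞ := by
    intro τ'
    obtain ⟨C, d, hCd⟩ := decrRearr_diff_le (𝕜 := 𝕜) j (k + m j)
    exact ne_top_of_le_ne_top (ENNReal.mul_ne_top ENNReal.coe_ne_top
      (decrRearr_lt_top hfS (expE_ne_zero _)).ne) (hCd h f τ')
  -- Of the degree k + m_j only m_j is needed for the modulus in direction j; the other k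
  -- differences are bounded trivially.
  have hnorm : eLpNorm g (ENNReal.ofReal (p j)) volume ≤
      2 ^ k * C₁ * expE (ell τ + τ / p j) := by
    rw [hg, diff_add]
    refine (eLpNorm_diff_le j k h (measurable_diff_right j (m j) h hf) (hpE j)).trans ?_
    rw [mul_assoc, ← hbal j τ]
    gcongr
    exact hmod j (X j τ)
  have hfinal := hsum g ell (C₂ * A) _ hrec hfin (fun τ' =>
    (decrRearr_le_eLpNorm hgm.aestronglyMeasurable hpj τ').trans (mul_le_mul' le_rfl hnorm)) hell τ
  refine hfinal.trans (le_of_eq ?_)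
  have h9 : expE (τ / q - τ / p j) * (2 ^ k * C₁ * expE (ell τ + τ / p j)) =
      2 ^ k * C₁ * expE (τ / q + ell τ) := by
    rw [mul_left_comm, ← expE_add]
    congr 2; ring
  rw [h9]
  ring

/-- Majorants of the Lorentz norms of the differences of a measurable function. -/
theorem exists_lorentzSum_majorant (hn : 1 ≤ n) {r p q : Fin n → ℝ} {θ : Fin n → ℝ≥0∞}
    (hr : ∀ j, 0 < r j) (hp : ∀ j, 1 ≤ p j) (hθ : ∀ j, 1 ≤ θ j) (hβ : ∀ j, 0 < beta r p j)
    (hpq : ∀ j, p j < q j) (hq : ∀ j, 1 / meanP r p - meanR r / n < 1 / q j)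
    {m : Fin n → ℕ} (hm : ∀ j, r j < m j) (j : Fin n) {k : ℕ} (hk : alpha r p q j < k) :
    ∃ C : ℝ≥0, ∀ f : (Fin n → ℝ) → 𝕜, Measurable f → MemS0 f → ∀ σ : ℝ≥0, 0 < σ →
      (∀ i, besovDir i (m i) (r i) (p i) (θ i) f ≤ σ) →
      ∃ F : ℝ → ℝ≥0∞, (∀ x, lorentzSum (q j) (diff j k (Real.exp x) f) ≤ F x) ∧
        eLpNorm (fun x => expE (-(alpha r p q j * x)) * F x) (theta' r p q θ j) volume
          ≤ C * σ := by
  have hk0 : k ≠ 0 := by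
    rintro rfl
    have := alpha_pos hr hβ hq j
    simp only [Nat.cast_zero] at hk
    linarith
  have hm0 : ∀ i, m i ≠ 0 := fun i hi => by
    have h1 := hm i
    have h2 := hr i
    rw [hi, Nat.cast_zero] at h1
    linarith
  set ρ := rhoExp r p with hρ
  have hρq : 0 < 1 / q j + ρ := by have := hq j; rw [hρ, rhoExp]; linarith
  have hq1 : 1 ≤ q j := (hp j).trans (hpq j).le
  -- the tolerance in the slopes
  obtain ⟨δ, hδ, hδβ, hδρ, hδk⟩ : ∃ δ > 0, (∀ i, δ < beta r p i) ∧ δ < 1 / q j + ρ ∧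
      (1 / q j + ρ + δ) / (beta r p j - δ) < k := by
    have h1 : ∀ᶠ δ in nhdsWithin (0 : ℝ) (Ioi 0), ∀ i, δ < beta r p i :=
      Filter.eventually_all.2 fun i => nhdsWithin_le_nhds (gt_mem_nhds (hβ i))
    have h2 : ∀ᶠ δ in nhdsWithin (0 : ℝ) (Ioi 0), δ < 1 / q j + ρ :=
      nhdsWithin_le_nhds (gt_mem_nhds hρq)
    have h3 : ContinuousAt (fun δ : ℝ => (1 / q j + ρ + δ) / (beta r p j - δ)) 0 := by
      refine ContinuousAt.div (by fun_prop) (by fun_prop) ?_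
      simpa using (hβ j).ne'
    have h4 : (1 / q j + ρ + 0) / (beta r p j - 0) < k := by
      rw [add_zero, sub_zero, ← alpha_mul_beta hr hβ, mul_div_cancel_right₀ _ (hβ j).ne']
      exact hk
    have h5 : ∀ᶠ δ in nhdsWithin (0 : ℝ) (Ioi 0),
        (1 / q j + ρ + δ) / (beta r p j - δ) < k :=
      nhdsWithin_le_nhds (h3.eventually (gt_mem_nhds h4))
    obtain ⟨δ, ⟨⟨h6, h7⟩, h8⟩, h9⟩ := (((h1.and h2).and h5).and self_mem_nhdsWithin).exists
    exact ⟨δ, h9, h6, h7, h8⟩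
  obtain ⟨ε, hε, hbalance⟩ := exists_balance hn (p := p) hr hδ
  choose C₀ hC₀ using fun i => exists_dirModulus_majorant (𝕜 := 𝕜) i (hm0 i) (hr i) (hp i) (hθ i) hε
  obtain ⟨C₁, hC₁⟩ := lorentzSum_diff_le_of_balance (𝕜 := 𝕜) hn hr hp m j k (hpq j)
    (γ := 1 / q j + ρ - δ) (by linarith) hε (∑ i, C₀ i)
  obtain ⟨C₂, hC₂⟩ := lorentzSum_diff_le_of_add (𝕜 := 𝕜) j hk0 hq1 hδk (m j) C₁
  have hslope : ∀ i, 0 < (beta r p i - δ) * (beta r p j + δ)⁻¹ := fun i =>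
    mul_pos (by linarith [hδβ i]) (inv_pos.2 (by linarith [hβ j]))
  choose C₃ hC₃ using fun i => eLpNorm_comp_le_of_hasSlopes
    (b := (beta r p i + δ) * (beta r p j - δ)⁻¹) (hslope i)
  refine ⟨C₂ * ∑ i, C₃ i * C₀ i, fun f hf hfS σ hσ hfσ => ?_⟩
  choose a ha han hamod using fun i => hC₀ i f hf σ hσ (hfσ i)
  obtain ⟨X, ell, hX, hbal, hXs, hells⟩ := hbalance a ha
  -- T inverts X_j, so that τ = T x is the parameter whose balanced step in direction j is e^x.
  choose T hT using (hXs j).surjective (by linarith [hδβ j])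
  have hTs := (hXs j).rightInverse (by linarith [hδβ j]) hT
  set F : ℝ → ℝ≥0∞ := fun x => expE (T x / q j + ell (T x)) with hF
  have hellmono : ∀ τ τ', τ ≤ τ' →
      τ / q j + ell τ ≤ τ' / q j + ell τ' - (1 / q j + ρ - δ) * (τ' - τ) := by
    intro τ τ' hτ
    obtain ⟨c, hc, hcc⟩ := hells τ τ'
    have h1 : (ρ - δ) * (τ' - τ) ≤ c * (τ' - τ) :=
      mul_le_mul_of_nonneg_right hc.1 (by linarith)
    have h2 : τ' / q j - τ / q j = 1 / q j * (τ' - τ) := by ring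
    nlinarith
  -- The growth rate is a perturbation of (1/q_j + ρ)/β_j = α_j; δ was chosen to keep it below k, as
  -- Marchaud's inequality demands.
  have hgrowth : ∀ x d, 0 ≤ d →
      F (x + d) ≤ expE ((1 / q j + ρ + δ) / (beta r p j - δ) * d) * F x := by
    intro x d hd
    obtain ⟨c, hc, hcc⟩ := hTs x (x + d)
    obtain ⟨c', hc', hcc'⟩ := hells (T x) (T (x + d))
    rw [hF]
    simp only
    rw [← expE_add]
    refine expE_mono ?_
    have hbpos : 0 < beta r p j - δ := by linarith [hδβ j]
    have h0 : 0 ≤ c := le_trans (inv_nonneg.2 (by linarith [hβ j])) hc.1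
    have h1 : T (x + d) - T x = c * d := by rw [hcc]; ring
    have h2 : c * d ≤ (beta r p j - δ)⁻¹ * d := mul_le_mul_of_nonneg_right hc.2 hd
    have h3 : ell (T (x + d)) - ell (T x) ≤ (ρ + δ) * (c * d) := by
      rw [hcc', h1]
      exact mul_le_mul_of_nonneg_right hc'.2 (mul_nonneg h0 hd)
    have h4 : T (x + d) / q j - T x / q j = 1 / q j * (c * d) := by rw [← h1]; ring
    have h5 : (1 / q j + ρ + δ) * (c * d) ≤ (1 / q j + ρ + δ) * ((beta r p j - δ)⁻¹ * d) :=
      mul_le_mul_of_nonneg_left h2 (by linarith)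
    have h6 : (1 / q j + ρ + δ) / (beta r p j - δ) * d =
      (1 / q j + ρ + δ) * ((beta r p j - δ)⁻¹ * d) := by rw [div_eq_mul_inv]; ring
    rw [h6]
    linarith
  have hmod : ∀ i x, dirModulus i (m i) (p i) f (Real.exp x) ≤
      (∑ i, C₀ i : ℝ≥0) * expE (r i * x + a i x) := fun i x => by
    refine (hamod i x).trans (mul_le_mul' ?_ le_rfl)
    exact_mod_cast Finset.single_le_sum (f := C₀) (fun _ _ => zero_le) (Finset.mem_univ i)
  have hhigh : ∀ x, lorentzSum (q j) (diff j (k + m j) (Real.exp x) f) ≤ C₁ * F x := fun x => by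
    have := hC₁ f hf hfS a X ell ha hmod hX hbal hellmono (T x)
    rwa [hT] at this
  refine ⟨fun x => C₂ * F x, hC₂ f hfS F hgrowth hhigh, ?_⟩
  -- the norm of the majorant
  have hFprod : ∀ x, expE (-(alpha r p q j * x)) * F x =
      ∏ i, expE (a i (X i (T x))) ^ mixWeight r p q j i := by
    intro x
    have h1 := balanced_exponent (q := q) hn hr hβ (hX (T x)) (fun i => hbal i (T x)) j
    rw [hT] at h1
    simp only [expE_rpow]
    rw [hF]
    simp only
    rw [← expE_add, h1]
    have h2 : ∀ s : Finset (Fin n), ∏ i ∈ s, expE (a i (X i (T x)) * mixWeight r p q j i) =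
        expE (∑ i ∈ s, a i (X i (T x)) * mixWeight r p q j i) := by
      intro s
      induction s using Finset.induction_on with
      | empty => simp [expE_zero]
      | insert b s hb ih => rw [Finset.prod_insert hb, Finset.sum_insert hb, expE_add, ih]
    rw [h2]
    congr 1
    rw [neg_add_cancel_left]
    exact Finset.sum_congr rfl fun i _ => mul_comm _ _
  have ham : ∀ i, Measurable fun x => expE (a i x) := fun i => by
    refine measurable_expE.comp (Continuous.measurable ?_)
    refine (LipschitzWith.of_dist_le_mul (K := Real.toNNReal ε) fun x y => ?_).continuous
    rw [Real.dist_eq, Real.dist_eq, Real.coe_toNNReal _ hε.le]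
    exact ha i x y
  have hTcont : Continuous T := hTs.continuous (inv_pos.2 (by linarith [hβ j]))
  have hSs : ∀ i, HasSlopes (X i ∘ T) ((beta r p i - δ) * (beta r p j + δ)⁻¹)
      ((beta r p i + δ) * (beta r p j - δ)⁻¹) := fun i =>
    (hXs i).comp hTs (by linarith [hδβ i]) (inv_nonneg.2 (by linarith [hβ j]))
  -- Each factor is e^{a_i} composed with the bi-Lipschitz map X_i ∘ T, so its L^{θ_i} norm is still
  -- controlled by σ.
  have hholder := eLpNorm_prod_rpow_le (F := fun i x => expE (a i (X i (T x))))
    (fun i => (ham i).comp ((hSs i).continuous (hslope i)).measurable)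
    (fun i => mixWeight_pos hn hr hβ hp hpq hq j i) (mixWeight_sum hn hr j) hθ
    (theta'_inv (θ := θ) hn hr hβ hp hpq hq j) (N := (∑ i, C₃ i * C₀ i : ℝ≥0) * σ) fun i => by
      refine (hC₃ i _ (hSs i) _ (ham i) (θ i) (hθ i)).trans ?_
      refine (mul_le_mul' le_rfl (han i)).trans ?_
      rw [← mul_assoc]
      refine mul_le_mul' ?_ le_rfl
      exact_mod_cast Finset.single_le_sum (f := fun i => C₃ i * C₀ i) (fun _ _ => zero_le)
        (Finset.mem_univ i)
  have hscale : eLpNorm (fun x => expE (-(alpha r p q j * x)) * (C₂ * F x))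
      (theta' r p q θ j) volume ≤ C₂ * eLpNorm (fun x => ∏ i, expE (a i (X i (T x))) ^
        mixWeight r p q j i) (theta' r p q θ j) volume := by
    refine (eLpNorm_le_nnreal_smul_eLpNorm_of_ae_le_mul' (c := C₂)
      (g := fun x => ∏ i, expE (a i (X i (T x))) ^ mixWeight r p q j i) ?_ _).trans (le_of_eq ?_)
    · filter_upwards with x
      rw [enorm_eq_self, enorm_eq_self, ← hFprod]
      exact le_of_eq (by ring)
    · rw [ENNReal.smul_def, smul_eq_mul]
  refine hscale.trans ((mul_le_mul' le_rfl hholder).trans (le_of_eq ?_))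
  push_cast
  ring

end

/-! ### Conclusion -/

section

variable {𝕜 : Type*} [RCLike 𝕜] {n : ℕ}

/-- The Fubini arguments need joint measurability of the differences in the step and the point; the
seminorms do not see null sets. -/
theorem MemS0.exists_measurable {f : (Fin n → ℝ) → 𝕜} (hf : MemS0 f) :
    ∃ g : (Fin n → ℝ) → 𝕜, Measurable g ∧ MemS0 g ∧ f =ᵐ[volume] g := by
  refine ⟨hf.1.mk f, hf.1.stronglyMeasurable_mk.measurable,
    ⟨hf.1.stronglyMeasurable_mk.aestronglyMeasurable, fun y hy => ?_⟩, hf.1.ae_eq_mk⟩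
  refine lt_of_le_of_lt (measure_mono_ae ?_) (hf.2 y hy)
  filter_upwards [hf.1.ae_eq_mk] with x hx hxy
  change y < ‖hf.1.mk f x‖ at hxy
  change y < ‖f x‖
  rwa [hx]

theorem besovDir_congr_ae {f g : (Fin n → ℝ) → 𝕜} (h : f =ᵐ[volume] g) (j : Fin n) (k : ℕ)
    (r p : ℝ) (θ : ℝ≥0∞) : besovDir j k r p θ f = besovDir j k r p θ g := by
  rw [besovDir, besovDir]
  congr 1
  funext u
  rw [eLpNorm_congr_ae (diff_congr_ae j k u h)]

/-- The majorants were built for a strictly positive bound σ. Letting σ decrease to the seminorm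
also covers a vanishing seminorm. -/
theorem le_const_mul_of_forall_lt {C : ℝ≥0} {a N : ℝ≥0∞} (hN : N ≠ ∞)
    (h : ∀ σ : ℝ≥0, N < σ → a ≤ C * σ) : a ≤ C * N := by
  refine ENNReal.le_of_forall_pos_le_add fun ε hε _ => ?_
  lift N to ℝ≥0 using hN
  have h1 := h (N + ε / (C + 1)) (by
    exact_mod_cast lt_add_of_pos_right N (div_pos hε (by positivity)))
  refine h1.trans ?_
  have h2 : C * (N + ε / (C + 1)) ≤ C * N + ε := by
    rw [mul_add]
    gcongr
    rw [← mul_div_assoc, div_le_iff₀ (by positivity), mul_comm ε]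
    gcongr
    exact le_self_add
  exact_mod_cast h2

theorem eLpNorm_lorentzSum_diff_le (hn : 1 ≤ n) {r p q : Fin n → ℝ} {θ : Fin n → ℝ≥0∞}
    (hr : ∀ j, 0 < r j) (hp : ∀ j, 1 ≤ p j) (hθ : ∀ j, 1 ≤ θ j) (hβ : ∀ j, 0 < beta r p j)
    (hpq : ∀ j, p j < q j) (hq : ∀ j, 1 / meanP r p - meanR r / n < 1 / q j)
    {m : Fin n → ℕ} (hm : ∀ j, r j < m j) (j : Fin n) {k : ℕ} (hk : alpha r p q j < k) :
    ∃ C : ℝ≥0, ∀ f ∈ besovSpace 𝕜 m r p θ,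
      eLpNorm (fun x => expE (-(alpha r p q j * x)) *
        lorentzSum (q j) (diff j k (Real.exp x) f)) (theta' r p q θ j) volume
        ≤ C * besovSeminorm m r p θ f := by
  obtain ⟨C, hC⟩ := exists_lorentzSum_majorant (𝕜 := 𝕜) hn hr hp hθ hβ hpq hq hm j hk
  refine ⟨C, fun f hf => le_const_mul_of_forall_lt hf.2.ne fun σ hσ => ?_⟩
  obtain ⟨g, hgm, hgS, hfg⟩ := hf.1.exists_measurable
  obtain ⟨F, hF, hFn⟩ := hC g hgm hgS σ (by exact_mod_cast zero_le.trans_lt hσ) fun i => by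
    rw [← besovDir_congr_ae hfg]
    exact (Finset.single_le_sum (f := fun i => besovDir i (m i) (r i) (p i) (θ i) f)
      (fun _ _ => zero_le) (Finset.mem_univ i)).trans hσ.le
  refine (eLpNorm_mono_enorm fun x => ?_).trans hFn
  rw [enorm_eq_self, enorm_eq_self, lorentzSum_congr_ae (diff_congr_ae j k _ hfg)]
  exact mul_le_mul' le_rfl (hF x)

theorem ofReal_exp_rpow (x s : ℝ) : ENNReal.ofReal (Real.exp x ^ (-s)) = expE (-(s * x)) := by
  rw [← Real.exp_mul, expE]; congr 2; ring

theorem eLpNorm_weighted_le {θ : ℝ≥0∞} {α C : ℝ} {G H : ℝ → ℝ≥0∞}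
    (h : ∀ x, G x ≤ expE C * H x) :
    eLpNorm (fun x => expE (-(α * x)) * G x) θ volume ≤
      expE C * eLpNorm (fun x => expE (-(α * x)) * H x) θ volume := by
  refine (eLpNorm_le_nnreal_smul_eLpNorm_of_ae_le_mul' (c := (Real.exp C).toNNReal)
    (g := fun x => expE (-(α * x)) * H x) ?_ θ).trans (le_of_eq ?_)
  · filter_upwards with x
    rw [enorm_eq_self, enorm_eq_self]
    calc _ ≤ expE (-(α * x)) * (expE C * H x) := mul_le_mul' le_rfl (h x)
      _ = expE C * (expE (-(α * x)) * H x) := by ring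
  · rw [ENNReal.smul_def, smul_eq_mul]; rfl

theorem besovLorentzDir_le_lorentzSum (j : Fin n) (k : ℕ) {α q : ℝ} (hq : 1 ≤ q) (θ : ℝ≥0∞)
    (f : (Fin n → ℝ) → 𝕜) : besovLorentzDir j k α q 1 θ f ≤
      expE 2 * eLpNorm (fun x => expE (-(α * x)) *
        lorentzSum q (diff j k (Real.exp x) f)) θ volume := by
  rw [besovLorentzDir, calNorm_eq]
  simp only [ofReal_exp_rpow]
  exact eLpNorm_weighted_le fun x => lorentzNorm_le_lorentzSum hq _

theorem besovDir_le_lorentzSum (j : Fin n) (k : ℕ) {α q : ℝ} (hq : 1 ≤ q) (θ : ℝ≥0∞)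
    (f : (Fin n → ℝ) → 𝕜) : besovDir j k α q θ f ≤
      expE 1 * eLpNorm (fun x => expE (-(α * x)) *
        lorentzSum q (diff j k (Real.exp x) f)) θ volume := by
  rw [besovDir, calNorm_eq]
  simp only [ofReal_exp_rpow]
  exact eLpNorm_weighted_le fun x => eLpNorm_le_lorentzSum hq _

end

end AnisoBesov

theorem theorem3 {𝕜 : Type*} [RCLike 𝕜] {n : ℕ} (hn : 1 ≤ n)
    (r p q : Fin n → ℝ) (θ : Fin n → ℝ≥0∞)
    (hr : ∀ j, 0 < r j) (hp : ∀ j, 1 ≤ p j) (hθ : ∀ j, 1 ≤ θ j)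
    (hβ : ∀ j, 0 < AnisoBesov.beta r p j)
    (hpq : ∀ j, p j < q j)
    (hq : ∀ j, 1 / AnisoBesov.meanP r p - AnisoBesov.meanR r / n < 1 / q j)
    -- the degrees of the differences used in the source space
    (m : Fin n → ℕ) (hm : ∀ j, r j < m j) :
    -- the inequality with the Lorentz norms
    (∀ k : Fin n → ℕ, (∀ j, r j < k j) →
      ∃ c : ℝ≥0, ∀ f ∈ AnisoBesov.besovSpace 𝕜 m r p θ, ∀ j,
        AnisoBesov.besovLorentzDir j (k j) (AnisoBesov.alpha r p q j) (q j) 1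
            (AnisoBesov.theta' r p q θ j) f
          ≤ c * ∑ i, AnisoBesov.besovDir i (m i) (r i) (p i) (θ i) f) ∧
    -- the continuous embedding, for all admissible degrees of differences in the target space
    (∀ l : Fin n → ℕ, (∀ j, AnisoBesov.alpha r p q j < l j) →
      AnisoBesov.besovSpace 𝕜 m r p θ ⊆
          AnisoBesov.besovSpace 𝕜 l (AnisoBesov.alpha r p q) q (AnisoBesov.theta' r p q θ) ∧
      ∃ c : ℝ≥0, ∀ f ∈ AnisoBesov.besovSpace 𝕜 m r p θ,
        AnisoBesov.besovSeminorm l (AnisoBesov.alpha r p q) q (AnisoBesov.theta' r p q θ) f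
          ≤ c * AnisoBesov.besovSeminorm m r p θ f) := by
  have hq1 : ∀ j, 1 ≤ q j := fun j => (hp j).trans (hpq j).le
  refine ⟨fun k hk => ?_, fun l hl => ?_⟩
  · choose C hC using fun j => AnisoBesov.eLpNorm_lorentzSum_diff_le (𝕜 := 𝕜) hn hr hp hθ hβ hpq hq
      hm j (k := k j) ((AnisoBesov.alpha_lt hr hβ hp hpq j).trans (hk j))
    refine ⟨(Real.exp 2).toNNReal * ∑ j, C j, fun f hf j => ?_⟩
    refine (AnisoBesov.besovLorentzDir_le_lorentzSum j (k j) (hq1 j) _ f).trans ?_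
    refine (mul_le_mul' le_rfl (hC j f hf)).trans ?_
    rw [← mul_assoc]
    refine mul_le_mul' ?_ le_rfl
    rw [ENNReal.coe_mul]
    refine mul_le_mul' le_rfl ?_
    exact_mod_cast Finset.single_le_sum (f := C) (fun _ _ => zero_le) (Finset.mem_univ j)
  · choose C hC using fun j => AnisoBesov.eLpNorm_lorentzSum_diff_le (𝕜 := 𝕜) hn hr hp hθ hβ hpq hq
      hm j (k := l j) (hl j)
    have hbound : ∀ f ∈ AnisoBesov.besovSpace 𝕜 m r p θ,
        AnisoBesov.besovSeminorm l (AnisoBesov.alpha r p q) q (AnisoBesov.theta' r p q θ) f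
          ≤ ((Real.exp 1).toNNReal * ∑ j, C j : ℝ≥0) * AnisoBesov.besovSeminorm m r p θ f := by
      intro f hf
      rw [ENNReal.coe_mul, ENNReal.ofNNReal_finsetSum, Finset.mul_sum, Finset.sum_mul]
      refine Finset.sum_le_sum fun j _ => ?_
      refine (AnisoBesov.besovDir_le_lorentzSum j (l j) (hq1 j) _ f).trans ?_
      rw [mul_assoc]
      exact mul_le_mul' le_rfl (hC j f hf)
    refine ⟨fun f hf => ⟨hf.1, (hbound f hf).trans_lt ?_⟩, _, hbound⟩
    exact ENNReal.mul_lt_top ENNReal.coe_lt_top hf.2
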